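/- Let $k$ be an algebraically closed field of characteristic $p>0$, let $\mathcal O$ be a discrete valuation ring that is a finite extension of the ring of Witt vectors $W(k)$, and let $F=\mathcal O[1/p]$ with its absolute value normalized by $|p|=p^{-1}$, $v_p=-\log_p|\cdot|$. Let $\Omega^{\mathrm{imm}}_{\mathrm{an}}$ be the ring (under the usual addition and multiplication of series) of series $x=\sum_{i\in\mathbb Q,\ i\ge 0}x_it^i$ with $x_i\in F$ such that for each real $\rho>0$ the set $\{i:|x_i|>\rho\}$ is well-ordered and, for each $r>0$, $w_r(x)=\sup_i|x_i|p^{-ri}$ is finite. Let $\Omega_{\mathrm{an}}$ be the subring of the series supported on integers $i\ge0$. Let $\Gamma^{\mathrm{imm}}[1/p]$ be the ring of series $\sum_{i\in\mathbb Q}x_it^i$ with bounded coefficients $x_i\in F$ such that for each $\rho>0$ the set $\{i:|x_i|>\rho\}$ is well-ordered, let $\Gamma[1/p]$ be its subfield of series supported on $\mathbb Z$, and let $\Gamma^{\mathrm{alg}}[1/p]$ be the $p$-adic closure (i.e. closure for $\sup_i|x_i|$) in $\Gamma^{\mathrm{imm}}[1/p]$ of the set of elements algebraic over $\Gamma[1/p]$.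 Let $\Omega^{\mathrm{alg}}_{\mathrm{an}}$ be the subring of those $x\in\Omega^{\mathrm{imm}}_{\mathrm{an}}$ such that for each $j$ there is $y=\sum_{i\ge 0}y_it^i\in\Gamma^{\mathrm{alg}}[1/p]$ with $y_i=x_i$ for all $i<j$. Let $R$ be one of $\Omega_{\mathrm{an}}$, $\Omega^{\mathrm{alg}}_{\mathrm{an}}$, $\Omega^{\mathrm{imm}}_{\mathrm{an}}$, with the Fréchet topology defined by the norms $w_r$, $r>0$. The Newton polygon of a nonzero $x=\sum x_it^i\in R$ is the lower boundary of the convex hull of the points $(i,v_p(x_i))$ with $x_i\ne0$; a real number $s>0$ is a slope of $x$ if this polygon contains a segment of slope $-s$. The element $x$ is pure of slope $s$ if $x_0\neq0$ and $s$ is its only slope. A slope factorization of a nonzero $x\in R$ is an expression $x=c\,t^j\prod_{i=1}^Ny_i$ in $R$, where $c$ is a unit of $R$ (possibly $1$), $j\ge 0$, $N$ is a nonnegative integer or $\infty$, each $y_i\in R$ is pure of some slope $s_i$, the sequence $s_1,s_2,\dots$ is strictly decreasing, and, if $N=\infty$, $s_i\to0$ and the product converges in the Fréchet topology. **Proposition.**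 The slope factorization of a nonzero $x\in R$ is unique up to units: if $x=c\,t^j\prod_{i=1}^Ny_i=c'\,t^{j'}\prod_{i=1}^{N'}z_i$ are two slope factorizations, then $j=j'$, $N=N'$, and for every $i$ there is a unit $u_i$ of $R$ with $z_i=u_iy_i$. -/

import Mathlib

namespace AnRing

set_option linter.unusedSectionVars false

/-- The Cauchy product of two generalized power series `∑ x_i t^i`, `∑ y_i t^i` with rational
exponents, a series being identified with its coefficient function `ℚ → F`. The coefficient sums
are infinite; they converge unconditionally in all the rings considered below. -/
noncomputable def conv {F : Type*} [NormedField F] (x y : ℚ → F) : ℚ → F :=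
  fun n => ∑' i : ℚ, x i * y (n - i)

/-- The monomial `a t^j`. -/
def mono {F : Type*} [NormedField F] (j : ℚ) (a : F) : ℚ → F := fun i => if i = j then a else 0

/-- For each `r > 0` the set of exponents `i` with `|x_i| > r` is well-ordered. -/
def WOLevels {F : Type*} [NormedField F] (x : ℚ → F) : Prop :=
  ∀ r : ℝ, 0 < r → {i : ℚ | r < ‖x i‖}.IsWF

/-- The coefficients are bounded. -/
def Bdd {F : Type*} [NormedField F] (x : ℚ → F) : Prop := ∃ C : ℝ, ∀ i, ‖x i‖ ≤ C

section conv

variable {F : Type*} [NormedField F] [IsUltrametricDist F] [CompleteSpace F]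

theorem Bdd.exists_pos {F : Type*} [NormedField F] {x : ℚ → F} (h : Bdd x) :
    ∃ C : ℝ, 0 < C ∧ ∀ i, ‖x i‖ ≤ C := by
  obtain ⟨C, hC⟩ := h
  exact ⟨max C 1, by positivity, fun i => (hC i).trans (le_max_left _ _)⟩

theorem WOLevels.add {x y : ℚ → F} (hx : WOLevels x) (hy : WOLevels y) : WOLevels (x + y) := by
  intro r hr
  have := ((hx r hr).isPWO.union (hy r hr).isPWO).isWF
  refine this.mono fun i hi => ?_
  simp only [Set.mem_ofPred_eq, Pi.add_apply, Set.mem_union] at hi ⊢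
  have := IsUltrametricDist.norm_add_le_max (x i) (y i)
  rcases le_max_iff.1 this with h | h
  · left; linarith
  · right; linarith

theorem Bdd.add {x y : ℚ → F} (hx : Bdd x) (hy : Bdd y) : Bdd (x + y) := by
  obtain ⟨C, hC⟩ := hx
  obtain ⟨D, hD⟩ := hy
  exact ⟨C + D, fun i => (norm_add_le _ _).trans (add_le_add (hC i) (hD i))⟩

theorem wo_mono (j : ℚ) (a : F) : WOLevels (mono j a) := by
  intro r hr
  refine (Set.finite_singleton j).isWF.mono fun i hi => ?_
  by_contra h
  simp only [Set.mem_singleton_iff] at h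
  simp [mono, h] at hi
  linarith

theorem bdd_mono (j : ℚ) (a : F) : Bdd (mono j a) := by
  refine ⟨‖a‖, fun i => ?_⟩
  unfold mono
  split_ifs <;> simp

/-- The family of products `x_i y_j z_k`, `i + j + k = n`, is summable. -/
theorem summable_triple {x y z : ℚ → F} (hx : WOLevels x) (bx : Bdd x) (hy : WOLevels y)
    (yb : Bdd y) (hz : WOLevels z) (bz : Bdd z) (n : ℚ) :
    Summable (fun q : ℚ × ℚ => x q.1 * y q.2 * z (n - q.1 - q.2)) := by
  apply NonarchimedeanAddGroup.summable_of_tendsto_cofinite_zero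
  obtain ⟨A, hA, bx⟩ := bx.exists_pos
  obtain ⟨B, hB, yb⟩ := yb.exists_pos
  obtain ⟨C, hC, bz⟩ := bz.exists_pos
  rw [Metric.tendsto_nhds]
  intro ε hε
  rw [Filter.eventually_cofinite]
  set X := {i : ℚ | ε / (2 * B * C) < ‖x i‖}
  set Y := {i : ℚ | ε / (2 * A * C) < ‖y i‖}
  set Z := {i : ℚ | ε / (2 * A * B) < ‖z i‖}
  have hX : X.IsPWO := (hx _ (by positivity)).isPWO
  have hY : Y.IsPWO := (hy _ (by positivity)).isPWO
  have hZ : Z.IsPWO := (hz _ (by positivity)).isPWO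
  have f1 := Set.AddAntidiagonal.finite_of_isPWO hX (hY.add hZ) n
  have f2 : ∀ i, (Set.antidiagonal Y Z (n - i)).Finite :=
    fun i => Set.AddAntidiagonal.finite_of_isPWO hY hZ (n - i)
  refine ((f1.image Prod.fst).biUnion fun i _ =>
    ((f2 i).image Prod.fst).image (fun j => (i, j))).subset ?_
  rintro ⟨i, j⟩ hq
  simp only [Set.mem_ofPred_eq, dist_zero_right, norm_mul, not_lt] at hq
  have b1 := bx i
  have b2 := yb j
  have b3 := bz (n - i - j)
  have hi : i ∈ X := by
    by_contra h
    simp only [X, Set.mem_ofPred_eq, not_lt] at h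
    have : ‖x i‖ * ‖y j‖ * ‖z (n - i - j)‖ ≤ ε / (2 * B * C) * B * C := by gcongr
    have h2 : ε / (2 * B * C) * B * C = ε / 2 := by field_simp
    linarith
  have hj : j ∈ Y := by
    by_contra h
    simp only [Y, Set.mem_ofPred_eq, not_lt] at h
    have : ‖x i‖ * ‖y j‖ * ‖z (n - i - j)‖ ≤ A * (ε / (2 * A * C)) * C := by gcongr
    have h2 : A * (ε / (2 * A * C)) * C = ε / 2 := by field_simp
    linarith
  have hk : n - i - j ∈ Z := by
    by_contra h
    simp only [Z, Set.mem_ofPred_eq, not_lt] at h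
    have : ‖x i‖ * ‖y j‖ * ‖z (n - i - j)‖ ≤ A * B * (ε / (2 * A * B)) := by gcongr
    have h2 : A * B * (ε / (2 * A * B)) = ε / 2 := by field_simp
    linarith
  simp only [Set.mem_iUnion, Set.mem_image]
  refine ⟨i, ⟨(i, n - i), ?_, rfl⟩, j, ⟨(j, n - i - j), ?_, rfl⟩, rfl⟩
  · exact ⟨hi, Set.mem_add.2 ⟨j, hj, n - i - j, hk, by ring⟩, by ring⟩
  · exact ⟨hj, hk, by ring⟩

theorem summable_conv {x y : ℚ → F} (hx : WOLevels x) (bx : Bdd x) (hy : WOLevels y)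
    (yb : Bdd y) (n : ℚ) : Summable (fun i : ℚ => x i * y (n - i)) := by
  have h := summable_triple hx bx (wo_mono 0 (1 : F)) (bdd_mono 0 1) hy yb n
  have := h.prod_symm.prod_factor 0
  simpa [mono] using this

theorem conv_comm (x y : ℚ → F) : conv x y = conv y x := by
  funext n
  unfold conv
  rw [← (Equiv.subLeft n).tsum_eq]
  simp [mul_comm]

theorem conv_add {x y z : ℚ → F} (hx : WOLevels x) (bx : Bdd x) (hy : WOLevels y)
    (yb : Bdd y) (hz : WOLevels z) (bz : Bdd z) :
    conv x (y + z) = conv x y + conv x z := by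
  funext n
  simp only [conv, Pi.add_apply, mul_add]
  exact (summable_conv hx bx hy yb n).tsum_add (summable_conv hx bx hz bz n)

theorem conv_mono (x : ℚ → F) : conv (mono 0 1) x = x := by
  funext n
  simp only [conv, mono]
  rw [tsum_eq_single 0]
  · simp
  · intro i hi; simp [hi]

theorem conv_assoc {x y z : ℚ → F} (hx : WOLevels x) (bx : Bdd x) (hy : WOLevels y)
    (yb : Bdd y) (hz : WOLevels z) (bz : Bdd z) :
    conv (conv x y) z = conv x (conv y z) := by
  funext n
  have S := summable_triple hx bx hy yb hz bz n
  have e1 : conv x (conv y z) n =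
      ∑' i, ∑' j, x i * y j * z (n - i - j) := by
    simp only [conv]
    refine tsum_congr fun i => ?_
    rw [← tsum_mul_left]
    simp [mul_assoc]
  let e : ℚ × ℚ ≃ ℚ × ℚ :=
    ⟨fun q => (q.1, q.2 - q.1), fun q => (q.1, q.2 + q.1), fun q => by simp, fun q => by simp⟩
  have S' := (e.summable_iff).2 S
  have e2 : conv (conv x y) z n = ∑' m, ∑' i, x i * y (m - i) * z (n - m) := by
    simp only [conv]
    refine tsum_congr fun m => ?_
    rw [← tsum_mul_right]
  rw [e1, e2]
  have S'' : Summable (Function.uncurry fun i m => x i * y (m - i) * z (n - m)) := by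
    refine S'.congr fun q => ?_
    simp [e, Function.uncurry]
  rw [S''.tsum_comm]
  refine tsum_congr fun i => ?_
  rw [← (Equiv.addRight i).tsum_eq]
  simp [sub_sub, add_comm]

theorem norm_conv_le {x y : ℚ → F} {n : ℚ} {C : ℝ} (h : ∀ i, ‖x i‖ * ‖y (n - i)‖ ≤ C) :
    ‖conv x y n‖ ≤ C :=
  IsUltrametricDist.norm_tsum_le_of_forall_le fun i => by simpa using h i

theorem wo_conv {x y : ℚ → F} (hx : WOLevels x) (bx : Bdd x) (hy : WOLevels y)
    (yb : Bdd y) : WOLevels (conv x y) := by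
  intro r hr
  obtain ⟨A, hA, bx⟩ := bx.exists_pos
  obtain ⟨B, hB, yb⟩ := yb.exists_pos
  refine ((hx (r / B) (by positivity)).isPWO.add (hy (r / A) (by positivity)).isPWO).isWF.mono ?_
  intro n hn
  by_contra h
  refine absurd hn (not_lt.2 (norm_conv_le fun i => ?_))
  by_cases h1 : r / B < ‖x i‖
  · have h2 : ‖y (n - i)‖ ≤ r / A := by
      by_contra h2
      exact h (Set.mem_add.2 ⟨i, h1, n - i, not_le.1 h2, by ring⟩)
    calc _ ≤ A * (r / A) := by gcongr; exact bx i
      _ = r := by field_simp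
  · calc _ ≤ r / B * B := by gcongr; exact not_lt.1 h1; exact yb _
      _ = r := by field_simp

theorem bdd_conv {x y : ℚ → F} (bx : Bdd x) (yb : Bdd y) : Bdd (conv x y) := by
  obtain ⟨A, hA, bx⟩ := bx.exists_pos
  obtain ⟨B, hB, yb⟩ := yb.exists_pos
  exact ⟨A * B, fun n => norm_conv_le fun i => by gcongr; exacts [bx i, yb _]⟩

end conv

/- ### The ring `Γ^imm[1/p]` and its subrings -/

/-- The additive group of `Γ^imm[1/p]`: series `∑ x_i t^i` over `i ∈ ℚ`, with bounded coefficients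
in `F = 𝒪[1/p]`, such that for each `r > 0` the set of `i` with `|x_i| > r` is well-ordered. The
ring `Γ^imm` itself is the subset where all coefficients lie in `𝒪`. -/
def gammaImmAddSubgroup (F : Type*) [NormedField F] [IsUltrametricDist F] [CompleteSpace F] :
    AddSubgroup (ℚ → F) where
  carrier := {x | WOLevels x ∧ Bdd x}
  zero_mem' := ⟨fun r hr => by simp [hr.not_gt], ⟨0, fun i => by simp⟩⟩
  add_mem' hx hy := ⟨hx.1.add hy.1, hx.2.add hy.2⟩
  neg_mem' {x} hx := ⟨fun r hr => by simpa using hx.1 r hr, by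
    obtain ⟨C, hC⟩ := hx.2
    exact ⟨C, fun i => by simpa using hC i⟩⟩

/-- `Γ^imm[1/p]`. -/
def GammaImm (F : Type*) [NormedField F] [IsUltrametricDist F] [CompleteSpace F] : Type _ :=
  gammaImmAddSubgroup F

section
variable {F : Type*} [NormedField F] [IsUltrametricDist F] [CompleteSpace F]

/-- The coefficient function of an element of `Γ^imm[1/p]`. -/
def GammaImm.coeff (x : GammaImm F) : ℚ → F := x.1

theorem GammaImm.ext {x y : GammaImm F} (h : x.coeff = y.coeff) : x = y := Subtype.ext h

noncomputable instance : AddCommGroup (GammaImm F) :=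
  inferInstanceAs (AddCommGroup (gammaImmAddSubgroup F))

noncomputable instance : CommRing (GammaImm F) where
  mul x y := ⟨conv x.1 y.1, wo_conv x.2.1 x.2.2 y.2.1 y.2.2, bdd_conv x.2.2 y.2.2⟩
  one := ⟨mono 0 1, wo_mono 0 1, bdd_mono 0 1⟩
  mul_assoc x y z := Subtype.ext (conv_assoc x.2.1 x.2.2 y.2.1 y.2.2 z.2.1 z.2.2)
  mul_comm x y := Subtype.ext (conv_comm _ _)
  one_mul x := Subtype.ext (conv_mono _)
  mul_one x := Subtype.ext ((conv_comm _ _).trans (conv_mono _))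
  zero_mul x := Subtype.ext (funext fun n => by
    change conv (0 : ℚ → F) x.1 n = 0
    simp [conv])
  mul_zero x := Subtype.ext (funext fun n => by
    change conv x.1 (0 : ℚ → F) n = 0
    simp [conv])
  left_distrib x y z := Subtype.ext (conv_add x.2.1 x.2.2 y.2.1 y.2.2 z.2.1 z.2.2)
  right_distrib x y z := Subtype.ext (by
    change conv (x.1 + y.1) z.1 = conv x.1 z.1 + conv y.1 z.1
    rw [conv_comm, conv_add z.2.1 z.2.2 x.2.1 x.2.2 y.2.1 y.2.2, conv_comm z.1, conv_comm z.1])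
  __ := (inferInstance : AddCommGroup (GammaImm F))


theorem conv_ne_zero {x y : ℚ → F} {n : ℚ} (h : conv x y n ≠ 0) :
    ∃ i, x i ≠ 0 ∧ y (n - i) ≠ 0 := by
  by_contra! H
  apply h
  have : ∀ i, x i * y (n - i) = 0 := fun i => by
    by_cases hi : x i = 0
    · simp [hi]
    · simp [H i hi]
  simp [conv, this]

/-- `Γ[1/p]` inside `Γ^imm[1/p]`: the series supported on the integers. Here `Γ` is the `p`-adic
completion of `𝒪[[t]][1/t]`, that is, the ring of series `∑ x_n t^n` over `n ∈ ℤ` with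
coefficients in `𝒪` and `x_n → 0` as `n → -∞`. -/
def Gamma (F : Type*) [NormedField F] [IsUltrametricDist F] [CompleteSpace F] :
    Subring (GammaImm F) where
  carrier := {x | ∀ i, x.coeff i ≠ 0 → ∃ n : ℤ, (n : ℚ) = i}
  zero_mem' i hi := absurd rfl hi
  one_mem' i hi := by
    change mono 0 (1 : F) i ≠ 0 at hi
    by_cases h : i = 0
    · exact ⟨0, by simp [h]⟩
    · simp [mono, h] at hi
  add_mem' {x y} hx hy i hi := by
    change x.coeff i + y.coeff i ≠ 0 at hi
    by_cases h : x.coeff i = 0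
    · rw [h, zero_add] at hi
      exact hy i hi
    · exact hx i h
  neg_mem' {x} hx i hi := hx i (by
    change -x.coeff i ≠ 0 at hi
    simpa using hi)
  mul_mem' {x y} hx hy n hn := by
    obtain ⟨i, h1, h2⟩ := conv_ne_zero (F := F) hn
    obtain ⟨a, ha⟩ := hx i h1
    obtain ⟨b, hb⟩ := hy _ h2
    exact ⟨a + b, by push_cast; rw [ha, hb]; ring⟩

/-- `Γ^alg[1/p]` inside `Γ^imm[1/p]`: the closure, for the `p`-adic topology, of the relative
integral closure of the field `Γ[1/p]`. Its unit ball `Γ^alg` is the `p`-adically complete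
extension of `Γ` inside `Γ^imm` whose residue field is the algebraic closure of `k((t))` in the
residue field `k((t^ℚ))` of `Γ^imm`. -/
def GammaAlg (F : Type*) [NormedField F] [IsUltrametricDist F] [CompleteSpace F] :
    Subring (GammaImm F) where
  carrier := {y | ∀ ε : ℝ, 0 < ε →
    ∃ z ∈ integralClosure (Gamma F) (GammaImm F), ∀ i, ‖y.coeff i - z.coeff i‖ ≤ ε}
  zero_mem' ε hε := ⟨0, zero_mem _, fun i => by simpa using hε.le⟩
  one_mem' ε hε := ⟨1, one_mem _, fun i => by simpa using hε.le⟩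
  add_mem' {x y} hx hy ε hε := by
    obtain ⟨a, ha, hxa⟩ := hx ε hε
    obtain ⟨b, hb, hyb⟩ := hy ε hε
    refine ⟨a + b, add_mem ha hb, fun i => ?_⟩
    change ‖x.coeff i + y.coeff i - (a.coeff i + b.coeff i)‖ ≤ ε
    rw [add_sub_add_comm]
    exact (IsUltrametricDist.norm_add_le_max _ _).trans (max_le (hxa i) (hyb i))
  neg_mem' {x} hx ε hε := by
    obtain ⟨a, ha, hxa⟩ := hx ε hε
    refine ⟨-a, neg_mem ha, fun i => ?_⟩
    change ‖-x.coeff i - -a.coeff i‖ ≤ ε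
    rw [neg_sub_neg, norm_sub_rev]
    exact hxa i
  mul_mem' {x y} hx hy ε hε := by
    obtain ⟨A, hA, bx⟩ := Bdd.exists_pos x.2.2
    obtain ⟨b, hb, hyb⟩ := hy (ε / A) (by positivity)
    obtain ⟨B, hB, yb⟩ := Bdd.exists_pos b.2.2
    obtain ⟨a, ha, hxa⟩ := hx (ε / B) (by positivity)
    refine ⟨a * b, mul_mem ha hb, fun n => ?_⟩
    have e : x * y - a * b = x * (y - b) + (x - a) * b := by ring
    change ‖(x * y - a * b).coeff n‖ ≤ ε
    rw [e]
    refine (IsUltrametricDist.norm_add_le_max _ _).trans (max_le ?_ ?_)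
    · refine norm_conv_le (F := F) fun i => ?_
      calc _ ≤ A * (ε / A) := by gcongr; exacts [bx i, hyb _]
        _ = ε := by field_simp
    · refine norm_conv_le (F := F) fun i => ?_
      calc _ ≤ (ε / B) * B := by gcongr; exacts [hxa i, yb _]
        _ = ε := by field_simp

end

/- ### The rings `Ω^imm_an`, `Ω_an` and `Ω^alg_an` -/

/-- `w_d(x) = max_i |x_i| p^{-d i}` is finite for each `d > 0`, that is, for each `d > 0` there is
a bound `|x_i| ≤ C p^{d i}`. -/
def Growth (p : ℕ) {F : Type*} [NormedField F] (x : ℚ → F) : Prop :=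
  ∀ d : ℝ, 0 < d → ∃ C : ℝ, ∀ i : ℚ, ‖x i‖ ≤ C * (p : ℝ) ^ (d * i)

section
variable {p : ℕ} [hp : Fact p.Prime] {F : Type*} [NormedField F] [IsUltrametricDist F]
  [CompleteSpace F]

theorem Growth.exists_pos {x : ℚ → F} (h : Growth p x) {d : ℝ} (hd : 0 < d) :
    ∃ C : ℝ, 0 < C ∧ ∀ i : ℚ, ‖x i‖ ≤ C * (p : ℝ) ^ (d * i) := by
  obtain ⟨C, hC⟩ := h d hd
  refine ⟨max C 1, by positivity, fun i => (hC i).trans ?_⟩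
  gcongr
  exact le_max_left _ _

/-- The truncation `∑_{i ≤ n} x_i t^i`. -/
def trunc (n : ℚ) (x : ℚ → F) : ℚ → F := fun i => if i ≤ n then x i else 0

theorem wo_trunc (n : ℚ) {x : ℚ → F} (h : WOLevels x) : WOLevels (trunc n x) := fun r hr =>
  (h r hr).mono fun i hi => by
    by_cases hin : i ≤ n
    · simpa [trunc, hin] using hi
    · simp [trunc, hin] at hi
      linarith

theorem bdd_trunc (n : ℚ) {x : ℚ → F} (h : Growth p x) : Bdd (trunc n x) := by
  obtain ⟨C, hC, h⟩ := h.exists_pos one_pos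
  refine ⟨C * (p : ℝ) ^ ((1 : ℝ) * n), fun i => ?_⟩
  have hp1 : (1 : ℝ) ≤ p := by exact_mod_cast hp.out.one_lt.le
  by_cases hin : i ≤ n
  · simp only [trunc, hin, if_true]
    refine (h i).trans ?_
    gcongr
  · simp only [trunc, hin, if_false, norm_zero]
    positivity

theorem conv_trunc {x y : ℚ → F} (hx : ∀ i < 0, x i = 0) (hy : ∀ i < 0, y i = 0) {m n : ℚ}
    (hmn : m ≤ n) : conv (trunc n x) (trunc n y) m = conv x y m := by
  unfold conv
  refine tsum_congr fun i => ?_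
  by_cases h1 : i < 0
  · simp [trunc, hx i h1]
  by_cases h2 : m - i < 0
  · simp [trunc, hy _ h2]
  have : i ≤ n := by linarith
  have : m - i ≤ n := by linarith
  simp [trunc, *]

theorem conv_supp {x y : ℚ → F} (hx : ∀ i < 0, x i = 0) (hy : ∀ i < 0, y i = 0) :
    ∀ i < 0, conv x y i = 0 := by
  intro n hn
  by_contra h
  obtain ⟨i, h1, h2⟩ := conv_ne_zero h
  have h3 : 0 ≤ i := not_lt.1 fun h => h1 (hx i h)
  have h4 : 0 ≤ n - i := not_lt.1 fun h => h2 (hy _ h)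
  linarith

theorem wo_of_trunc {x : ℚ → F} (h : ∀ n, WOLevels (trunc n x)) : WOLevels x := by
  intro r hr
  rw [Set.isWF_iff_no_descending_seq]
  intro f hf hfs
  refine Set.isWF_iff_no_descending_seq.1 (h (f 0) r hr) f hf fun n => ?_
  have h1 : f n ≤ f 0 := hf.antitone (Nat.zero_le n)
  have h2 : r < ‖x (f n)‖ := hfs n
  simpa [trunc, h1] using h2

theorem trunc_conv {x y : ℚ → F} (hx : ∀ i < 0, x i = 0) (hy : ∀ i < 0, y i = 0) (n : ℚ) :
    trunc n (conv x y) = trunc n (conv (trunc n x) (trunc n y)) := by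
  funext m
  by_cases h : m ≤ n
  · simp [trunc, h, ← conv_trunc hx hy h]
  · simp [trunc, h]

theorem growth_conv {x y : ℚ → F} (hx : Growth p x) (hy : Growth p y) :
    Growth p (conv x y) := by
  intro d hd
  have hp0 : (0 : ℝ) < p := by exact_mod_cast hp.out.pos
  obtain ⟨A, hA, bx⟩ := hx.exists_pos hd
  obtain ⟨B, hB, yb⟩ := hy.exists_pos hd
  refine ⟨A * B, fun n => norm_conv_le fun i => ?_⟩
  calc _ ≤ (A * (p : ℝ) ^ (d * i)) * (B * (p : ℝ) ^ (d * (n - i : ℚ))) := by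
        gcongr; exacts [bx i, yb _]
    _ = A * B * ((p : ℝ) ^ (d * i) * (p : ℝ) ^ (d * (n - i : ℚ))) := by ring
    _ = _ := by
        rw [← Real.rpow_add hp0]
        congr 2
        push_cast
        ring

end

/-- The additive group of `Ω^imm_an`: series `∑ x_i t^i` over rational `i ≥ 0` with coefficients in
`F = 𝒪[1/p]`, such that for each `r > 0` the set of `i` with `|x_i| > r` is well-ordered, and
`w_d(x)` is finite for each `d > 0`. -/
def omegaImmAnAddSubgroup (p : ℕ) [Fact p.Prime] (F : Type*) [NormedField F]
    [IsUltrametricDist F] [CompleteSpace F] : AddSubgroup (ℚ → F) where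
  carrier := {x | (∀ i < 0, x i = 0) ∧ WOLevels x ∧ Growth p x}
  zero_mem' := ⟨fun _ _ => rfl, fun r hr => by simp [hr.not_gt], fun d hd => ⟨0, fun i => by simp⟩⟩
  add_mem' {x y} hx hy := ⟨fun i hi => by simp [hx.1 i hi, hy.1 i hi], hx.2.1.add hy.2.1, by
    intro d hd
    obtain ⟨C, hC⟩ := hx.2.2 d hd
    obtain ⟨D, hD⟩ := hy.2.2 d hd
    refine ⟨C + D, fun i => (norm_add_le _ _).trans ?_⟩
    rw [add_mul]
    exact add_le_add (hC i) (hD i)⟩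
  neg_mem' {x} hx := ⟨fun i hi => by simp [hx.1 i hi], fun r hr => by simpa using hx.2.1 r hr, by
    intro d hd
    obtain ⟨C, hC⟩ := hx.2.2 d hd
    exact ⟨C, fun i => by simpa using hC i⟩⟩

/-- The ring `Ω^imm_an`. -/
def OmegaImmAn (p : ℕ) [Fact p.Prime] (F : Type*) [NormedField F] [IsUltrametricDist F]
    [CompleteSpace F] : Type _ :=
  omegaImmAnAddSubgroup p F

section
variable {p : ℕ} [hp : Fact p.Prime] {F : Type*} [NormedField F] [IsUltrametricDist F]
  [CompleteSpace F]

/-- The coefficient function of an element of `Ω^imm_an`. -/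
def OmegaImmAn.coeff (x : OmegaImmAn p F) : ℚ → F := x.1

theorem mono_mem {j : ℚ} (hj : 0 ≤ j) (a : F) : mono j a ∈ omegaImmAnAddSubgroup p F := by
  refine ⟨fun i hi => ?_, wo_mono j a, fun d hd => ?_⟩
  · have : i ≠ j := by rintro rfl; linarith
    simp [mono, this]
  · have hp0 : (0 : ℝ) < p := by exact_mod_cast hp.out.pos
    refine ⟨‖a‖ * ((p : ℝ) ^ (d * j))⁻¹, fun i => ?_⟩
    by_cases h : i = j
    · subst h
      have : (p : ℝ) ^ (d * i) ≠ 0 := by positivity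
      simp [mono, this]
    · simp only [mono, h, if_false, norm_zero]
      positivity

noncomputable instance : AddCommGroup (OmegaImmAn p F) :=
  inferInstanceAs (AddCommGroup (omegaImmAnAddSubgroup p F))

theorem conv_mem {x y : ℚ → F} (hx : x ∈ omegaImmAnAddSubgroup p F)
    (hy : y ∈ omegaImmAnAddSubgroup p F) : conv x y ∈ omegaImmAnAddSubgroup p F := by
  refine ⟨conv_supp hx.1 hy.1, wo_of_trunc fun n => ?_, growth_conv hx.2.2 hy.2.2⟩
  rw [trunc_conv hx.1 hy.1]
  exact wo_trunc n (wo_conv (wo_trunc n hx.2.1) (bdd_trunc n hx.2.2) (wo_trunc n hy.2.1)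
    (bdd_trunc n hy.2.2))

theorem conv_trunc_left {x y : ℚ → F} (hy : ∀ i < 0, y i = 0) (n : ℚ) :
    conv (trunc n x) y n = conv x y n := by
  unfold conv
  refine tsum_congr fun i => ?_
  by_cases h : i ≤ n
  · simp [trunc, h]
  · simp [hy (n - i) (by linarith)]

theorem conv_assoc_an {x y z : ℚ → F} (hx : x ∈ omegaImmAnAddSubgroup p F)
    (hy : y ∈ omegaImmAnAddSubgroup p F) (hz : z ∈ omegaImmAnAddSubgroup p F) :
    conv (conv x y) z = conv x (conv y z) := by
  have key : ∀ {x y z : ℚ → F}, x ∈ omegaImmAnAddSubgroup p F →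
      y ∈ omegaImmAnAddSubgroup p F → z ∈ omegaImmAnAddSubgroup p F → ∀ n,
      conv (conv x y) z n = conv (conv (trunc n x) (trunc n y)) (trunc n z) n := by
    intro x y z hx hy hz n
    have tz : ∀ i < 0, trunc n z i = 0 := fun i hi => by simp [trunc, hz.1 i hi]
    rw [← conv_trunc_left tz (x := conv (trunc n x) (trunc n y)), ← trunc_conv hx.1 hy.1,
      conv_trunc (conv_supp hx.1 hy.1) hz.1 le_rfl]
  have B := fun (n : ℚ) {x : ℚ → F} (hx : x ∈ omegaImmAnAddSubgroup p F) => bdd_trunc n hx.2.2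
  have W := fun (n : ℚ) {x : ℚ → F} (hx : x ∈ omegaImmAnAddSubgroup p F) => wo_trunc n hx.2.1
  funext n
  rw [key hx hy hz, conv_comm x, key hy hz hx, conv_comm _ (trunc n x),
    conv_assoc (W n hx) (B n hx) (W n hy) (B n hy) (W n hz) (B n hz)]

theorem conv_add_an {x y z : ℚ → F} (hx : x ∈ omegaImmAnAddSubgroup p F)
    (hy : y ∈ omegaImmAnAddSubgroup p F) (hz : z ∈ omegaImmAnAddSubgroup p F) :
    conv x (y + z) = conv x y + conv x z := by
  funext n
  have e : trunc n (y + z) = trunc n y + trunc n z := by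
    funext i
    by_cases h : i ≤ n <;> simp [trunc, h]
  rw [Pi.add_apply, ← conv_trunc hx.1 hy.1 le_rfl, ← conv_trunc hx.1 hz.1 le_rfl,
    ← conv_trunc hx.1 (add_mem hy hz).1 le_rfl, e,
    conv_add (wo_trunc n hx.2.1) (bdd_trunc n hx.2.2) (wo_trunc n hy.2.1) (bdd_trunc n hy.2.2)
      (wo_trunc n hz.2.1) (bdd_trunc n hz.2.2), Pi.add_apply]

noncomputable instance : CommRing (OmegaImmAn p F) where
  mul x y := ⟨conv x.1 y.1, conv_mem x.2 y.2⟩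
  one := ⟨mono 0 1, mono_mem le_rfl 1⟩
  mul_assoc x y z := Subtype.ext (conv_assoc_an x.2 y.2 z.2)
  mul_comm x y := Subtype.ext (conv_comm _ _)
  one_mul x := Subtype.ext (conv_mono _)
  mul_one x := Subtype.ext ((conv_comm _ _).trans (conv_mono _))
  zero_mul x := Subtype.ext (funext fun n => by
    change conv (0 : ℚ → F) x.1 n = 0
    simp [conv])
  mul_zero x := Subtype.ext (funext fun n => by
    change conv x.1 (0 : ℚ → F) n = 0
    simp [conv])
  left_distrib x y z := Subtype.ext (conv_add_an x.2 y.2 z.2)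
  right_distrib x y z := Subtype.ext (by
    change conv (x.1 + y.1) z.1 = conv x.1 z.1 + conv y.1 z.1
    rw [conv_comm, conv_add_an z.2 x.2 y.2, conv_comm z.1, conv_comm z.1])
  __ := (inferInstance : AddCommGroup (OmegaImmAn p F))

end

/-- `Ω_an` inside `Ω^imm_an`: the power series `∑_{n ≥ 0} x_n t^n` with integer exponents. -/
def OmegaAn (p : ℕ) [Fact p.Prime] (F : Type*) [NormedField F] [IsUltrametricDist F]
    [CompleteSpace F] : Subring (OmegaImmAn p F) where
  carrier := {x | ∀ i, x.coeff i ≠ 0 → ∃ n : ℕ, (n : ℚ) = i}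
  zero_mem' i hi := absurd rfl hi
  one_mem' i hi := by
    change mono 0 (1 : F) i ≠ 0 at hi
    by_cases h : i = 0
    · exact ⟨0, by simp [h]⟩
    · simp [mono, h] at hi
  add_mem' {x y} hx hy i hi := by
    change x.coeff i + y.coeff i ≠ 0 at hi
    by_cases h : x.coeff i = 0
    · rw [h, zero_add] at hi
      exact hy i hi
    · exact hx i h
  neg_mem' {x} hx i hi := hx i (by
    change -x.coeff i ≠ 0 at hi
    simpa using hi)
  mul_mem' {x y} hx hy n hn := by
    obtain ⟨i, h1, h2⟩ := conv_ne_zero (F := F) hn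
    obtain ⟨a, ha⟩ := hx i h1
    obtain ⟨b, hb⟩ := hy _ h2
    exact ⟨a + b, by push_cast; rw [ha, hb]; ring⟩

/-- `Ω^alg_an` inside `Ω^imm_an`: the series `x` which below each exponent `j` agree with an
element `y` of `Ω^alg[1/p]`, that is, an element of `Γ^alg[1/p]` with no negative exponents. -/
def OmegaAlgAn (p : ℕ) [Fact p.Prime] (F : Type*) [NormedField F] [IsUltrametricDist F]
    [CompleteSpace F] : Subring (OmegaImmAn p F) where
  carrier := {x | ∀ j : ℚ, ∃ y ∈ GammaAlg F,
    (∀ i < 0, y.coeff i = 0) ∧ ∀ i < j, y.coeff i = x.coeff i}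
  zero_mem' j := ⟨0, zero_mem _, fun _ _ => rfl, fun _ _ => rfl⟩
  one_mem' j := ⟨1, one_mem _, (mono_mem (p := p) le_rfl (1 : F)).1, fun _ _ => rfl⟩
  add_mem' {x y} hx hy j := by
    obtain ⟨a, ha, ha0, hxa⟩ := hx j
    obtain ⟨b, hb, hb0, hyb⟩ := hy j
    refine ⟨a + b, add_mem ha hb, fun i hi => ?_, fun i hi => ?_⟩
    · change a.coeff i + b.coeff i = 0
      rw [ha0 i hi, hb0 i hi, add_zero]
    · change a.coeff i + b.coeff i = x.coeff i + y.coeff i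
      rw [hxa i hi, hyb i hi]
  neg_mem' {x} hx j := by
    obtain ⟨a, ha, ha0, hxa⟩ := hx j
    refine ⟨-a, neg_mem ha, fun i hi => ?_, fun i hi => ?_⟩
    · change -a.coeff i = 0
      rw [ha0 i hi, neg_zero]
    · change -a.coeff i = -x.coeff i
      rw [hxa i hi]
  mul_mem' {x y} hx hy j := by
    obtain ⟨a, ha, ha0, hxa⟩ := hx j
    obtain ⟨b, hb, hb0, hyb⟩ := hy j
    refine ⟨a * b, mul_mem ha hb, conv_supp ha0 hb0, fun n hn => ?_⟩
    change conv a.coeff b.coeff n = conv x.coeff y.coeff n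
    rw [← conv_trunc ha0 hb0 le_rfl,
      ← conv_trunc (x := x.coeff) (y := y.coeff) x.2.1 y.2.1 le_rfl]
    have e1 : trunc n a.coeff = trunc n x.coeff := funext fun i => by
      by_cases h : i ≤ n
      · simp [trunc, h, hxa i (h.trans_lt hn)]
      · simp [trunc, h]
    have e2 : trunc n b.coeff = trunc n y.coeff := funext fun i => by
      by_cases h : i ≤ n
      · simp [trunc, h, hyb i (h.trans_lt hn)]
      · simp [trunc, h]
    rw [e1, e2]

/- ### Newton polygons and slope factorizations -/

section
variable {p : ℕ} [hp : Fact p.Prime] {F : Type*} [NormedField F] [IsUltrametricDist F]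
  [CompleteSpace F]

/-- The monomial `t^j` for rational `j ≥ 0`. -/
def tPow (p : ℕ) [Fact p.Prime] (F : Type*) [NormedField F] [IsUltrametricDist F]
    [CompleteSpace F] (j : ℚ≥0) : OmegaImmAn p F :=
  ⟨mono j 1, mono_mem j.2 1⟩

/-- The norm `w_r(x) = max_i |x_i| p^{-r i}`, for `r > 0`. -/
noncomputable def w (r : ℝ) (x : OmegaImmAn p F) : ℝ :=
  ⨆ i : ℚ, ‖x.coeff i‖ * (p : ℝ) ^ (-(r * i))

/-- Convergence of a sequence in the Fréchet topology defined by the norms `w_r`, `r > 0`. -/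
def FrechetTendsto (u : ℕ → OmegaImmAn p F) (x : OmegaImmAn p F) : Prop :=
  ∀ r : ℝ, 0 < r → Filter.Tendsto (fun n => w r (u n - x)) Filter.atTop (nhds 0)

/-- The valuation `v_p` on `F ∖ {0}`, with `|a| = p^{-v_p(a)}`. -/
noncomputable def vp (p : ℕ) (a : F) : ℝ := -Real.logb p ‖a‖

/-- The convex hull of the points `(i, v_p(x_i))` with `x_i ≠ 0`. Its lower boundary is the Newton
polygon of `x`. -/
def newtonHull (x : OmegaImmAn p F) : Set (ℝ × ℝ) :=
  convexHull ℝ {P | ∃ i : ℚ, x.coeff i ≠ 0 ∧ P = ((i : ℝ), vp p (x.coeff i))}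

/-- The real number `s > 0` is a slope of `x`: the Newton polygon of `x` contains a nondegenerate
segment `PQ` of slope `-s`. (A line segment in the convex hull lies on its lower boundary exactly
when no point of the hull lies below the line through it. Only the part of the polygon where it
descends is considered.) -/
def IsSlope (x : OmegaImmAn p F) (s : ℝ) : Prop :=
  0 < s ∧ ∃ P ∈ newtonHull x, ∃ Q ∈ newtonHull x, P.1 < Q.1 ∧ P.2 + s * P.1 = Q.2 + s * Q.1 ∧
    ∀ S ∈ newtonHull x, P.2 + s * P.1 ≤ S.2 + s * S.1

/-- `x` is pure of slope `s`: its constant coefficient is nonzero, and `s` is its only slope. -/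
def IsPure (x : OmegaImmAn p F) (s : ℝ) : Prop :=
  x.coeff 0 ≠ 0 ∧ IsSlope x s ∧ ∀ s', IsSlope x s' → s' = s

/-- A slope factorization `x = c t^j ∏_{i < N} y_i` in `R`, where `N ≤ ∞`, `c` is a unit of `R`,
`y_i` is pure of slope `s_i`, the slopes are strictly decreasing, and, if `N = ∞`, they tend to `0`
and the product converges in the Fréchet topology. The factors are indexed from `0`, and `y_i` and `s_i`
are irrelevant for `i ≥ N`. -/
structure SlopeFactorization (R : Subring (OmegaImmAn p F)) (x : R) where
  /-- the unit `c` -/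
  c : Rˣ
  /-- the exponent `j` of `t` -/
  j : ℚ≥0
  tPow_mem : tPow p F j ∈ R
  /-- the number of factors -/
  N : ℕ∞
  /-- the factors -/
  y : ℕ → R
  /-- the slopes -/
  s : ℕ → ℝ
  isPure : ∀ i : ℕ, (i : ℕ∞) < N → IsPure (y i : OmegaImmAn p F) (s i)
  strictAnti : ∀ i i' : ℕ, i < i' → (i' : ℕ∞) < N → s i' < s i
  tendsto_zero : N = ⊤ → Filter.Tendsto s Filter.atTop (nhds 0)
  /-- the value of the product of the factors -/
  prod : R
  prod_finite : ∀ n : ℕ, N = n → prod = ∏ i ∈ Finset.range n, y i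
  prod_infinite : N = ⊤ →
    FrechetTendsto (fun n => ((∏ i ∈ Finset.range n, y i : R) : OmegaImmAn p F)) prod
  eq : x = (c : R) * ⟨tPow p F j, tPow_mem⟩ * prod

end

end AnRing

/-! For each `r > 0` attach to a series the weights `|x_i| p^{-ri}`. The valuation of `F` is
discrete, so their supremum is attained, and the largest index attaining it is additive under
multiplication (`isTop_conv`, a Gauss lemma). Hence the ring is a domain, `w_r` is multiplicative,
and a factor of a series dominated by its constant term at `r` is dominated by its own constant term
at `r`. A number `s > 0` is a slope exactly when the maximum at `r = s` is attained more than once.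
The index of a unique maximum is locally constant in `r`. So a pure series of slope `s` is dominated
by its constant term for `r > s` and by one fixed index `d` for all `0 < r < s`, while at `s` no
index dominates.

For large `r` the top index of `x` is `j`, which determines `j`. After cancelling `t^j`, the factors
are peeled off in order of decreasing slope, comparing what remains of the two products. The leading
slopes agree: otherwise one remainder would be dominated by its constant term at the larger slope,
and so would the pure factor of that slope on the other side. For equal slopes one has `y A = z B`
with `y` pure of slope `s` and `B` dominated by its constant term at `s`, hence also at some `r <
s`. There `B` is inverted by a geometric series, which gives a quotient `Y` of `z` by `y` that is
bounded at radius `r`. As `y` keeps its dominant index on all of `(0, s)`, the equation `Y y = z`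
carries the bound to every smaller radius (`wt_le_of_conv_eq`), so `y` divides `z` in `Ω^imm_an`. By
symmetry the two are associated there (`dvd_of_mul_eq_mul`, `associated_aux`).

It remains to see that the unit lies in `R`. It is a quotient of elements of `R` by a series with
nonzero constant term, hence a limit, uniformly below each exponent, of elements of `R`
(`quotient_mem_of_closed`). Closedness of `R` under such limits is clear for two of the rings. For
`Ω^alg_an` one must turn elements of `Γ^alg[1/p]` that are small below an exponent `J` into elements
that are small everywhere, without changing them below `J` (`exists_gammaAlg_norm_le`). This is done
by reducing to Hahn series over the residue field, where elements of `Γ^alg` become algebraic over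
the perfect closure of the Laurent series field, and lifting back by Hensel's lemma and Teichmüller
limits. -/

namespace AnRing

set_option linter.unusedSectionVars false

/-! ### Ultrametric inequalities -/

section ultrametric

variable {F : Type*} [NormedField F] [IsUltrametricDist F]

theorem norm_sub_le_max' (a b : F) : ‖a - b‖ ≤ max ‖a‖ ‖b‖ := by
  rw [sub_eq_add_neg, ← norm_neg b]
  exact IsUltrametricDist.norm_add_le_max a (-b)

theorem norm_eq_of_norm_sub_lt {a b : F} (h : ‖a - b‖ < ‖b‖) : ‖a‖ = ‖b‖ := by
  apply le_antisymm
  · have := IsUltrametricDist.norm_add_le_max (a - b) b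
    rw [sub_add_cancel] at this
    exact this.trans (max_le h.le le_rfl)
  · have := norm_sub_le_max' a (a - b)
    rw [sub_sub_cancel] at this
    rcases le_max_iff.1 this with h' | h'
    · exact h'
    · exact absurd h (not_lt.2 h')

end ultrametric

/-! ### Discreteness of the valuation and the weights `|x_i| p^{-ri}` -/

section weights

variable {p : ℕ} [hp : Fact p.Prime] {F : Type*} [NormedField F]

/-- `ϖ` is a uniformizer: it has norm in `(0, 1)` and every nonzero norm is a power of its norm. -/
structure IsUnif (ϖ : F) : Prop where
  pos : 0 < ‖ϖ‖
  lt_one : ‖ϖ‖ < 1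
  exists_zpow : ∀ a : F, a ≠ 0 → ∃ n : ℤ, ‖a‖ = ‖ϖ‖ ^ n

/-- Only finitely many powers of `‖ϖ‖` lie between two positive bounds. This finiteness is what
turns suprema of weights into maxima. -/
theorem IsUnif.finite_norms {ϖ : F} (h : IsUnif ϖ) {ρ : ℝ} (hρ : 0 < ρ) (C : ℝ) :
    {v : ℝ | ∃ a : F, ‖a‖ = v ∧ ρ ≤ v ∧ v ≤ C}.Finite := by
  obtain ⟨N, hN⟩ := exists_pow_lt_of_lt_one hρ h.lt_one
  obtain ⟨M, hM⟩ := exists_pow_lt_of_lt_one (show 0 < (max C 1)⁻¹ by positivity) h.lt_one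
  refine ((Set.finite_Icc (-(M : ℤ)) N).image fun n : ℤ => ‖ϖ‖ ^ n).subset ?_
  rintro v ⟨a, rfl, h1, h2⟩
  obtain ⟨n, hn⟩ := h.exists_zpow a (norm_pos_iff.1 (hρ.trans_le h1))
  refine ⟨n, ⟨?_, ?_⟩, hn.symm⟩
  · by_contra! hlt
    have h3 : ‖ϖ‖ ^ (-(M : ℤ)) ≤ ‖ϖ‖ ^ n := zpow_le_zpow_right_of_le_one₀ h.pos h.lt_one.le hlt.le
    have h4 : C < ‖ϖ‖ ^ (-(M : ℤ)) := by
      rw [zpow_neg, zpow_natCast]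
      refine (le_max_left C 1).trans_lt ?_
      rwa [lt_inv_comm₀ (by positivity) (pow_pos h.pos _)]
    linarith
  · by_contra! hlt
    have h3 : ‖ϖ‖ ^ n ≤ ‖ϖ‖ ^ (N : ℤ) := zpow_le_zpow_right_of_le_one₀ h.pos h.lt_one.le hlt.le
    rw [zpow_natCast] at h3
    linarith

/-- The weighted absolute value `|x_i| p^{-ri}` of a coefficient. -/
noncomputable def wt (p : ℕ) (r : ℝ) (x : ℚ → F) (i : ℚ) : ℝ := ‖x i‖ * (p : ℝ) ^ (-(r * i))


theorem prime_cast_pos (p : ℕ) [hp : Fact p.Prime] : (0 : ℝ) < p := by exact_mod_cast hp.out.pos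

theorem one_lt_prime_cast (p : ℕ) [hp : Fact p.Prime] : (1 : ℝ) < p := by
  exact_mod_cast hp.out.one_lt

theorem prime_rpow_pos (p : ℕ) [Fact p.Prime] (a : ℝ) : 0 < (p : ℝ) ^ a :=
  Real.rpow_pos_of_pos (prime_cast_pos p) a

theorem wt_nonneg (r : ℝ) (x : ℚ → F) (i : ℚ) : 0 ≤ wt p r x i := by
  unfold wt; positivity

theorem wt_pos {r : ℝ} {x : ℚ → F} {i : ℚ} : 0 < wt p r x i ↔ x i ≠ 0 := by
  unfold wt
  rw [mul_pos_iff_of_pos_right (prime_rpow_pos p _), norm_pos_iff]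

theorem wt_eq_zero {r : ℝ} {x : ℚ → F} {i : ℚ} (h : x i = 0) : wt p r x i = 0 := by
  simp [wt, h]

theorem norm_eq_wt (r : ℝ) (x : ℚ → F) (i : ℚ) : ‖x i‖ = wt p r x i * (p : ℝ) ^ (r * i) := by
  rw [wt, mul_assoc, ← Real.rpow_add (prime_cast_pos p)]
  simp

theorem wt_le_iff {r C : ℝ} {x : ℚ → F} {i : ℚ} :
    wt p r x i ≤ C ↔ ‖x i‖ ≤ C * (p : ℝ) ^ (r * i) := by
  rw [norm_eq_wt (p := p) r, mul_le_mul_iff_left₀ (prime_rpow_pos p _)]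

theorem wt_change (r r' : ℝ) (x : ℚ → F) (i : ℚ) :
    wt p r' x i = wt p r x i * (p : ℝ) ^ ((r - r') * i) := by
  rw [wt, wt, mul_assoc, ← Real.rpow_add (prime_cast_pos p)]
  congr 2; ring

theorem wt_mul (r : ℝ) (x y : ℚ → F) (i n : ℚ) :
    ‖x i * y (n - i)‖ * (p : ℝ) ^ (-(r * n)) = wt p r x i * wt p r y (n - i) := by
  have : (p : ℝ) ^ (-(r * n)) = (p : ℝ) ^ (-(r * i)) * (p : ℝ) ^ (-(r * (n - i : ℚ))) := by
    rw [← Real.rpow_add (prime_cast_pos p)]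
    congr 1; push_cast; ring
  rw [wt, wt, this, norm_mul]; ring

theorem Growth.exists_wt_le {x : ℚ → F} (h : Growth p x) {r : ℝ} (hr : 0 < r) :
    ∃ C, 0 < C ∧ ∀ i, wt p r x i ≤ C := by
  obtain ⟨C, hC⟩ := h r hr
  exact ⟨max C 1, by positivity, fun i => (wt_le_iff.2 (hC i)).trans (le_max_left _ _)⟩

theorem bdd_trunc_of_wt_le {x : ℚ → F} {r C : ℝ} (hr : 0 ≤ r) (h : ∀ i, wt p r x i ≤ C) (n : ℚ) :
    Bdd (trunc n x) := by
  have hC : 0 ≤ C := (wt_nonneg r x 0).trans (h 0)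
  refine ⟨C * (p : ℝ) ^ (r * n), fun i => ?_⟩
  by_cases hin : i ≤ n
  · simp only [trunc, hin, if_true]
    refine (wt_le_iff.1 (h i)).trans ?_
    have := (one_lt_prime_cast p).le
    gcongr
  · simp only [trunc, hin, if_false, norm_zero]
    have := prime_rpow_pos p (r * n)
    positivity

/-- A descending sequence in a level set stays below its first term, so approximation below one
exponent suffices. With error at most `ρ`, the ultrametric inequality puts the same sequence into
the level set of `y`. -/
theorem wo_of_approx [IsUltrametricDist F] {x : ℚ → F}
    (h : ∀ m : ℚ, ∀ ε : ℝ, 0 < ε → ∃ y : ℚ → F, WOLevels y ∧ ∀ i ≤ m, ‖y i - x i‖ ≤ ε) :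
    WOLevels x := by
  intro ρ hρ
  rw [Set.isWF_iff_no_descending_seq]
  intro f hf hfs
  obtain ⟨y, hy, hyx⟩ := h (f 0) ρ hρ
  refine Set.isWF_iff_no_descending_seq.1 (hy ρ hρ) f hf fun n => ?_
  have h1 : f n ≤ f 0 := hf.antitone (Nat.zero_le n)
  have h2 : ρ < ‖x (f n)‖ := hfs n
  change ρ < ‖y (f n)‖
  by_contra! h3
  have h4 := norm_sub_le_max' (y (f n)) (y (f n) - x (f n))
  rw [sub_sub_cancel] at h4
  exact absurd (h4.trans (max_le h3 (hyx _ h1))) (not_le.2 h2)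

end weights

/-! ### Maxima of weights, top indices and the Gauss lemma -/

section maxima

variable {p : ℕ} [hp : Fact p.Prime] {F : Type*} [NormedField F] [IsUltrametricDist F]
  [CompleteSpace F] {ϖ : F}

/-- Since `i ≥ 0`, a weight at least `ρ` forces `‖x i‖ ≥ ρ`. In the other direction the growth bound
at `r / 2` makes the weight at `r` at most `C p^{-ri/2}`, which bounds `p^{ri/2}` by `C / ρ` and
hence `‖x i‖` by `C * (C / ρ)`. Discreteness finishes. -/
theorem finite_norms_of_wt_ge (hϖ : IsUnif ϖ) {x : ℚ → F} (hx : Growth p x) {r : ℝ} (hr : 0 < r)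
    {ρ : ℝ} (hρ : 0 < ρ) (h0 : ∀ i < 0, x i = 0) :
    ((fun i => ‖x i‖) '' {i | ρ ≤ wt p r x i}).Finite := by
  obtain ⟨C, hC, hxC⟩ := hx.exists_wt_le (half_pos hr)
  refine (hϖ.finite_norms hρ (C * (C / ρ))).subset ?_
  rintro _ ⟨i, hi, rfl⟩
  simp only [Set.mem_ofPred_eq] at hi
  have hi0 : 0 ≤ i := by
    by_contra! hlt
    rw [wt_eq_zero (h0 i hlt)] at hi
    linarith
  have hi0' : (0 : ℝ) ≤ i := by exact_mod_cast hi0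
  refine ⟨x i, rfl, ?_, ?_⟩
  · change ρ ≤ ‖x i‖
    rw [norm_eq_wt (p := p) r]
    have : 1 ≤ (p : ℝ) ^ (r * i) := Real.one_le_rpow (one_lt_prime_cast p).le (by positivity)
    nlinarith
  · refine (wt_le_iff.1 (hxC i)).trans ?_
    gcongr
    rw [le_div_iff₀ hρ]
    have h1 : wt p r x i = wt p (r / 2) x i * (p : ℝ) ^ ((r / 2 - r) * i) := wt_change _ _ _ _
    have h2 : (p : ℝ) ^ (r / 2 * i) * (p : ℝ) ^ ((r / 2 - r) * i) = 1 := by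
      rw [← Real.rpow_add (prime_cast_pos p)]
      convert Real.rpow_zero _ using 2
      ring
    calc (p : ℝ) ^ (r / 2 * i) * ρ ≤ (p : ℝ) ^ (r / 2 * i) * (C * (p : ℝ) ^ ((r / 2 - r) * i)) := by
          have := prime_rpow_pos p (r / 2 * i)
          gcongr
          refine hi.trans ?_
          rw [h1]
          have := prime_rpow_pos p ((r / 2 - r) * i)
          gcongr
          exact hxC i
      _ = C := by rw [mul_left_comm, h2, mul_one]

theorem exists_wt_max (hϖ : IsUnif ϖ) {x : ℚ → F} (hx : x ∈ omegaImmAnAddSubgroup p F) {r : ℝ}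
    (hr : 0 < r) {T : Set ℚ} (hT : ∃ k ∈ T, x k ≠ 0) :
    ∃ a ∈ T, x a ≠ 0 ∧ ∀ k ∈ T, wt p r x k ≤ wt p r x a := by
  obtain ⟨k₀, hk₀, hxk⟩ := hT
  have hρ : 0 < wt p r x k₀ := wt_pos.2 hxk
  set S := {k | k ∈ T ∧ wt p r x k₀ ≤ wt p r x k} with hS
  have hfin : ((fun i => ‖x i‖) '' S).Finite :=
    (finite_norms_of_wt_ge hϖ hx.2.2 hr hρ hx.1).subset (Set.image_mono fun k hk => hk.2)
  -- Among indices with the same norm the weight decreases with the index, so the least one, which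
  -- exists by well-ordering, represents its norm; only finitely many norms remain to be compared.
  have hmin : ∀ v ∈ (fun i => ‖x i‖) '' S, ∃ m ∈ S, ‖x m‖ = v ∧ ∀ k ∈ S, ‖x k‖ = v → m ≤ k := by
    rintro _ ⟨k, hk, rfl⟩
    have hk0 : 0 < ‖x k‖ := norm_pos_iff.2 (wt_pos.1 (hρ.trans_le hk.2))
    have hwf : {m | m ∈ S ∧ ‖x m‖ = ‖x k‖}.IsWF :=
      (hx.2.1 _ (half_pos hk0)).mono fun m hm => by
        simp only [Set.mem_ofPred_eq] at hm ⊢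
        rw [hm.2]; linarith
    have hne : {m | m ∈ S ∧ ‖x m‖ = ‖x k‖}.Nonempty := ⟨k, hk, rfl⟩
    exact ⟨hwf.min hne, (hwf.min_mem hne).1, (hwf.min_mem hne).2,
      fun m hm hmk => hwf.min_le hne ⟨hm, hmk⟩⟩
  choose! m hmS hmv hml using hmin
  obtain ⟨v, hv, hmax⟩ := Set.exists_max_image _ (fun v => wt p r x (m v)) hfin
    ⟨_, k₀, ⟨hk₀, le_rfl⟩, rfl⟩
  have key : ∀ k ∈ S, wt p r x k ≤ wt p r x (m v) := by
    intro k hk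
    refine le_trans ?_ (hmax _ ⟨k, hk, rfl⟩)
    have hle : m ‖x k‖ ≤ k := hml _ ⟨k, hk, rfl⟩ k hk rfl
    have hle' : ((m ‖x k‖ : ℚ) : ℝ) ≤ k := by exact_mod_cast hle
    have := (one_lt_prime_cast p).le
    rw [wt, wt, hmv _ ⟨k, hk, rfl⟩]
    gcongr
  have hmem := hmS v hv
  refine ⟨m v, hmem.1, wt_pos.1 (hρ.trans_le hmem.2), fun k hk => ?_⟩
  by_cases hkS : wt p r x k₀ ≤ wt p r x k
  · exact key k ⟨hk, hkS⟩
  · exact (not_le.1 hkS).le.trans hmem.2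

/-- Because the maximum over `T` is attained, a strict inequality at each index improves to a
uniform factor `l < 1`. -/
theorem exists_wt_gap (hϖ : IsUnif ϖ) {x : ℚ → F} (hx : x ∈ omegaImmAnAddSubgroup p F) {r : ℝ}
    (hr : 0 < r) {T : Set ℚ} {W : ℝ} (hW : 0 < W) (hT : ∀ k ∈ T, wt p r x k < W) :
    ∃ l : ℝ, 0 ≤ l ∧ l < 1 ∧ ∀ k ∈ T, wt p r x k ≤ l * W := by
  by_cases h : ∃ k ∈ T, x k ≠ 0
  · obtain ⟨a, ha, -, hmax⟩ := exists_wt_max hϖ hx hr h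
    refine ⟨wt p r x a / W, div_nonneg (wt_nonneg _ _ _) hW.le, (div_lt_one hW).2 (hT a ha),
      fun k hk => ?_⟩
    rw [div_mul_cancel₀ _ hW.ne']
    exact hmax k hk
  · push Not at h
    exact ⟨0, le_rfl, one_pos, fun k hk => by rw [wt_eq_zero (h k hk), zero_mul]⟩

/-- `a` is the largest index at which `|x_i| p^{-ri}` takes its maximal value. -/
structure IsTop (p : ℕ) (r : ℝ) (x : ℚ → F) (a : ℚ) : Prop where
  ne_zero : x a ≠ 0
  le : ∀ k, wt p r x k ≤ wt p r x a
  lt : ∀ k, a < k → wt p r x k < wt p r x a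

/-- `d` is the unique index at which `|x_i| p^{-ri}` takes its maximal value. -/
structure Dom (p : ℕ) (r : ℝ) (x : ℚ → F) (d : ℚ) : Prop where
  ne_zero : x d ≠ 0
  lt : ∀ k, k ≠ d → wt p r x k < wt p r x d

theorem Dom.le {r : ℝ} {x : ℚ → F} {d : ℚ} (h : Dom p r x d) (k : ℚ) :
    wt p r x k ≤ wt p r x d := by
  rcases eq_or_ne k d with rfl | hk
  exacts [le_rfl, (h.lt k hk).le]

theorem Dom.isTop {r : ℝ} {x : ℚ → F} {d : ℚ} (h : Dom p r x d) : IsTop p r x d :=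
  ⟨h.ne_zero, h.le, fun k hk => h.lt k hk.ne'⟩

theorem IsTop.unique {r : ℝ} {x : ℚ → F} {a b : ℚ} (ha : IsTop p r x a) (hb : IsTop p r x b) :
    a = b := by
  rcases lt_trichotomy a b with h | h | h
  · exact absurd (ha.lt b h) (not_lt.2 (hb.le a))
  · exact h
  · exact absurd (hb.lt a h) (not_lt.2 (ha.le b))

theorem IsTop.dom_zero {r : ℝ} {x : ℚ → F} (h0 : ∀ i < 0, x i = 0) (h : IsTop p r x 0) :
    Dom p r x 0 := by
  refine ⟨h.ne_zero, fun k hk => ?_⟩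
  rcases lt_or_gt_of_ne hk with hk | hk
  · rw [wt_eq_zero (h0 k hk)]
    exact wt_pos.2 h.ne_zero
  · exact h.lt k hk

theorem exists_isTop (hϖ : IsUnif ϖ) {x : ℚ → F} (hx : x ∈ omegaImmAnAddSubgroup p F) {r : ℝ}
    (hr : 0 < r) (hne : x ≠ 0) : ∃ a, 0 ≤ a ∧ IsTop p r x a := by
  obtain ⟨k, hk⟩ := Function.ne_iff.1 hne
  obtain ⟨a, -, ha, hmax⟩ := exists_wt_max hϖ hx hr (T := Set.univ) ⟨k, trivial, hk⟩
  have hρ : 0 < wt p r x a := wt_pos.2 ha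
  -- At equal weight a larger norm means a larger index, so an index of maximal norm is the last one
  -- attaining the maximum.
  obtain ⟨_, ⟨b, hb, rfl⟩, hbmax⟩ := Set.exists_max_image _ id
    (finite_norms_of_wt_ge hϖ hx.2.2 hr hρ hx.1) ⟨_, a, le_refl (wt p r x a), rfl⟩
  have hbe : wt p r x b = wt p r x a := le_antisymm (hmax b trivial) hb
  have hb0 : x b ≠ 0 := wt_pos.1 (hbe ▸ hρ)
  refine ⟨b, not_lt.1 fun h => hb0 (hx.1 b h), hb0, fun c => hbe ▸ hmax c trivial,
    fun c hc => hbe ▸ lt_of_le_of_ne (hmax c trivial) fun he => ?_⟩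
  have h1 : ‖x c‖ ≤ ‖x b‖ := hbmax _ ⟨c, he.ge, rfl⟩
  rw [norm_eq_wt (p := p) r, norm_eq_wt (p := p) r x b, he, hbe, mul_le_mul_iff_right₀ hρ,
    Real.rpow_le_rpow_left_iff (one_lt_prime_cast p), mul_le_mul_iff_right₀ hr] at h1
  exact absurd hc (not_lt.2 (by exact_mod_cast h1))

/-! ### Convolutions and dominant terms -/

theorem summable_conv_of_nonneg {x y : ℚ → F} (hx : ∀ i < 0, x i = 0) (hy : ∀ i < 0, y i = 0)
    (wx : WOLevels x) (wy : WOLevels y) (bx : ∀ n, Bdd (trunc n x)) (yb : ∀ n, Bdd (trunc n y))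
    (n : ℚ) : Summable fun i => x i * y (n - i) := by
  refine (summable_conv (wo_trunc n wx) (bx n) (wo_trunc n wy) (yb n) n).congr fun i => ?_
  by_cases h1 : i < 0
  · simp [trunc, hx i h1]
  by_cases h2 : n - i < 0
  · simp [trunc, hy _ h2]
  have : i ≤ n := by linarith
  have : n - i ≤ n := by linarith
  simp [trunc, *]

theorem norm_conv_sub_le {x y : ℚ → F} {n i₀ : ℚ} (hs : Summable fun i => x i * y (n - i))
    {c : ℝ} (hc : 0 ≤ c) (h : ∀ i, i ≠ i₀ → ‖x i * y (n - i)‖ ≤ c) :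
    ‖conv x y n - x i₀ * y (n - i₀)‖ ≤ c := by
  rw [conv, hs.tsum_eq_add_tsum_ite i₀, add_sub_cancel_left]
  refine IsUltrametricDist.norm_tsum_le_of_forall_le_of_nonneg hc fun i => ?_
  split_ifs with hi
  · simpa using hc
  · exact h i hi

theorem norm_conv_eq {x y : ℚ → F} {n i₀ : ℚ} (hs : Summable fun i => x i * y (n - i))
    {c : ℝ} (hc : 0 ≤ c) (h : ∀ i, i ≠ i₀ → ‖x i * y (n - i)‖ ≤ c)
    (hlt : c < ‖x i₀ * y (n - i₀)‖) : ‖conv x y n‖ = ‖x i₀ * y (n - i₀)‖ := by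
  exact norm_eq_of_norm_sub_lt ((norm_conv_sub_le hs hc h).trans_lt hlt)

theorem bdd_trunc_of_mem {x : ℚ → F} (hx : x ∈ omegaImmAnAddSubgroup p F) (n : ℚ) :
    Bdd (trunc n x) := bdd_trunc n hx.2.2

theorem summable_conv_of_mem {x y : ℚ → F} (hx : x ∈ omegaImmAnAddSubgroup p F)
    (hy : y ∈ omegaImmAnAddSubgroup p F) (n : ℚ) : Summable fun i => x i * y (n - i) :=
  summable_conv_of_nonneg hx.1 hy.1 hx.2.1 hy.2.1 (bdd_trunc_of_mem hx) (bdd_trunc_of_mem hy) n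

theorem wt_conv_le {r : ℝ} {x y : ℚ → F} {n : ℚ} {C : ℝ}
    (h : ∀ i, wt p r x i * wt p r y (n - i) ≤ C) : wt p r (conv x y) n ≤ C := by
  rw [wt_le_iff]
  refine norm_conv_le fun i => ?_
  have := h i
  rw [← wt_mul, norm_mul] at this
  have h2 := mul_le_mul_of_nonneg_right this (prime_rpow_pos p (r * n)).le
  rwa [mul_assoc, ← Real.rpow_add (prime_cast_pos p), neg_add_cancel, Real.rpow_zero,
    mul_one] at h2

theorem wt_conv_le_mul {r : ℝ} {x y : ℚ → F} {A B : ℝ} (hx : ∀ i, wt p r x i ≤ A)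
    (hy : ∀ i, wt p r y i ≤ B) (n : ℚ) : wt p r (conv x y) n ≤ A * B :=
  wt_conv_le fun i => mul_le_mul (hx i) (hy _) (wt_nonneg _ _ _) ((wt_nonneg _ _ _).trans (hx i))

/-- In the coefficient at `a + b` every pair of indices other than `(a, b)` has one member beyond
its top index, hence is smaller by a uniform factor `c < 1` and cannot cancel the main term. Beyond
`a + b` every pair is of this kind. -/
theorem isTop_conv (hϖ : IsUnif ϖ) {x y : ℚ → F} (hx : x ∈ omegaImmAnAddSubgroup p F)
    (hy : y ∈ omegaImmAnAddSubgroup p F) {r : ℝ} (hr : 0 < r) {a b : ℚ} (ha : IsTop p r x a)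
    (hb : IsTop p r y b) :
    IsTop p r (conv x y) (a + b) ∧
      wt p r (conv x y) (a + b) = wt p r x a * wt p r y b := by
  set A := wt p r x a with hA
  set B := wt p r y b with hB
  have hA0 : 0 < A := wt_pos.2 ha.ne_zero
  have hB0 : 0 < B := wt_pos.2 hb.ne_zero
  obtain ⟨l, hl0, hl1, hl⟩ := exists_wt_gap hϖ hx hr hA0 (T := {k | a < k}) fun k hk => ha.lt k hk
  obtain ⟨m, hm0, hm1, hm⟩ := exists_wt_gap hϖ hy hr hB0 (T := {k | b < k}) fun k hk => hb.lt k hk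
  set c := max l m with hc
  have hc0 : 0 ≤ c := le_max_of_le_left hl0
  have hc1 : c < 1 := max_lt hl1 hm1
  have key : ∀ i j, (a < i ∨ b < j) → wt p r x i * wt p r y j ≤ c * (A * B) := by
    rintro i j (h | h)
    · calc _ ≤ l * A * B := mul_le_mul (hl i h) (hb.le j) (wt_nonneg _ _ _) (by positivity)
        _ ≤ c * A * B := by gcongr; exact le_max_left _ _
        _ = _ := by ring
    · calc _ ≤ A * (m * B) := mul_le_mul (ha.le i) (hm j h) (wt_nonneg _ _ _) (by positivity)
        _ ≤ A * (c * B) := by gcongr; exact le_max_right _ _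
        _ = _ := by ring
  have hAB : 0 < A * B := by positivity
  have hlt : c * (A * B) < A * B := by nlinarith
  have hP := prime_rpow_pos p (r * (a + b : ℚ))
  have hval : wt p r (conv x y) (a + b) = A * B := by
    have h1 : ‖AnRing.conv x y (a + b)‖ = ‖x a * y (a + b - a)‖ := by
      refine norm_conv_eq (c := c * (A * B) * (p : ℝ) ^ (r * (a + b : ℚ)))
        (summable_conv_of_mem hx hy _) (by positivity) (fun i hi => ?_) ?_
      · have h2 : wt p r x i * wt p r y (a + b - i) ≤ c * (A * B) := by
          apply key
          rcases lt_or_gt_of_ne hi with h | h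
          · right; linarith
          · left; exact h
        rw [← wt_mul] at h2
        have h3 := mul_le_mul_of_nonneg_right h2 hP.le
        rwa [mul_assoc, ← Real.rpow_add (prime_cast_pos p), neg_add_cancel, Real.rpow_zero,
          mul_one] at h3
      · have h2 : ‖x a * y (a + b - a)‖ = A * B * (p : ℝ) ^ (r * (a + b : ℚ)) := by
          have h3 := wt_mul (p := p) r x y a (a + b)
          rw [add_sub_cancel_left] at h3 ⊢
          rw [hA, hB, ← h3, mul_assoc, ← Real.rpow_add (prime_cast_pos p), neg_add_cancel,
            Real.rpow_zero, mul_one]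
        rw [h2]
        gcongr
    rw [wt, h1, wt_mul, add_sub_cancel_left]
  refine ⟨⟨wt_pos.1 (hval ▸ hAB), fun k => hval ▸ wt_conv_le_mul ha.le hb.le k, fun k hk => ?_⟩,
    hval⟩
  rw [hval]
  refine (wt_conv_le fun i => key _ _ ?_).trans_lt hlt
  by_contra! h
  linarith [h.1, h.2]

end maxima

/-! ### Multiplicativity in `Ω^imm_an` -/

section ring

variable {p : ℕ} [hp : Fact p.Prime] {F : Type*} [NormedField F] [IsUltrametricDist F]
  [CompleteSpace F] {ϖ : F}

namespace OmegaImmAn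

theorem coeff_neg_index (x : OmegaImmAn p F) {i : ℚ} (hi : i < 0) : x.coeff i = 0 := x.2.1 i hi

theorem ext {x y : OmegaImmAn p F} (h : x.coeff = y.coeff) : x = y := Subtype.ext h

theorem coeff_mul (x y : OmegaImmAn p F) : (x * y).coeff = conv x.coeff y.coeff := rfl

theorem coeff_add (x y : OmegaImmAn p F) (i : ℚ) : (x + y).coeff i = x.coeff i + y.coeff i := rfl

theorem coeff_neg (x : OmegaImmAn p F) (i : ℚ) : (-x).coeff i = -x.coeff i := rfl

theorem coeff_one : (1 : OmegaImmAn p F).coeff = mono 0 1 := rfl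

theorem coeff_sub (x y : OmegaImmAn p F) (i : ℚ) : (x - y).coeff i = x.coeff i - y.coeff i := by
  rw [sub_eq_add_neg, coeff_add, coeff_neg, sub_eq_add_neg]

theorem coeff_tPow (j : ℚ≥0) : (tPow p F j).coeff = mono j 1 := rfl

theorem coeff_ne_zero {x : OmegaImmAn p F} (hx : x ≠ 0) : x.coeff ≠ 0 := fun h => hx (ext h)

theorem exists_wt_le (x : OmegaImmAn p F) {r : ℝ} (hr : 0 < r) :
    ∃ C, 0 < C ∧ ∀ i, wt p r x.coeff i ≤ C := x.2.2.2.exists_wt_le hr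

/-- The constant series `a`. -/
def const (a : F) : OmegaImmAn p F := ⟨mono 0 a, mono_mem le_rfl a⟩

theorem coeff_const_mul (a : F) (x : OmegaImmAn p F) (i : ℚ) :
    (const a * x).coeff i = a * x.coeff i := by
  change conv (mono 0 a) x.coeff i = _
  simp only [conv, mono]
  rw [tsum_eq_single 0]
  · simp
  · intro i hi; simp [hi]

theorem wt_sub_le_max (r : ℝ) (x y : OmegaImmAn p F) (i : ℚ) :
    wt p r (x - y).coeff i ≤ max (wt p r x.coeff i) (wt p r y.coeff i) := by
  unfold wt
  rw [coeff_sub, ← max_mul_of_nonneg _ _ (prime_rpow_pos p _).le]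
  have := prime_rpow_pos p (-(r * i))
  gcongr
  exact norm_sub_le_max' _ _

theorem wt_add_le_max (r : ℝ) (x y : OmegaImmAn p F) (i : ℚ) :
    wt p r (x + y).coeff i ≤ max (wt p r x.coeff i) (wt p r y.coeff i) := by
  unfold wt
  rw [coeff_add, ← max_mul_of_nonneg _ _ (prime_rpow_pos p _).le]
  have := prime_rpow_pos p (-(r * i))
  gcongr
  exact IsUltrametricDist.norm_add_le_max _ _

theorem isTop_mul (hϖ : IsUnif ϖ) {x y : OmegaImmAn p F} {r : ℝ} (hr : 0 < r) {a b : ℚ}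
    (ha : IsTop p r x.coeff a) (hb : IsTop p r y.coeff b) : IsTop p r (x * y).coeff (a + b) :=
  (isTop_conv hϖ x.2 y.2 hr ha hb).1

theorem wt_mul_eq (hϖ : IsUnif ϖ) {x y : OmegaImmAn p F} {r : ℝ} (hr : 0 < r) {a b : ℚ}
    (ha : IsTop p r x.coeff a) (hb : IsTop p r y.coeff b) :
    wt p r (x * y).coeff (a + b) = wt p r x.coeff a * wt p r y.coeff b :=
  (isTop_conv hϖ x.2 y.2 hr ha hb).2

theorem exists_top (hϖ : IsUnif ϖ) {x : OmegaImmAn p F} (hx : x ≠ 0) {r : ℝ} (hr : 0 < r) :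
    ∃ a, 0 ≤ a ∧ IsTop p r x.coeff a := exists_isTop hϖ x.2 hr (coeff_ne_zero hx)

theorem mul_ne_zero_of_unif (hϖ : IsUnif ϖ) {x y : OmegaImmAn p F} (hx : x ≠ 0) (hy : y ≠ 0) :
    x * y ≠ 0 := by
  obtain ⟨a, -, ha⟩ := exists_top hϖ hx one_pos
  obtain ⟨b, -, hb⟩ := exists_top hϖ hy one_pos
  intro h
  have := (isTop_mul hϖ one_pos ha hb).ne_zero
  rw [h] at this
  exact this rfl

theorem ne_zero_of_coeff {x : OmegaImmAn p F} {i : ℚ} (h : x.coeff i ≠ 0) : x ≠ 0 := by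
  rintro rfl; exact h rfl

theorem dom_one (r : ℝ) : Dom p r (1 : OmegaImmAn p F).coeff 0 := by
  have h : (1 : OmegaImmAn p F).coeff 0 ≠ 0 := by simp [coeff_one, mono]
  refine ⟨h, fun k hk => ?_⟩
  rw [wt_eq_zero (by simp [coeff_one, mono, hk])]
  exact wt_pos.2 h

theorem dom_mul (hϖ : IsUnif ϖ) {x y : OmegaImmAn p F} {r : ℝ} (hr : 0 < r)
    (hx : Dom p r x.coeff 0) (hy : Dom p r y.coeff 0) : Dom p r (x * y).coeff 0 := by
  have := isTop_mul hϖ hr hx.isTop hy.isTop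
  rw [add_zero] at this
  exact this.dom_zero (x * y).2.1

/-- Top indices are nonnegative and add up to `0`, so both vanish. -/
theorem dom_of_dom_mul (hϖ : IsUnif ϖ) {x y : OmegaImmAn p F} {r : ℝ} (hr : 0 < r)
    (h : Dom p r (x * y).coeff 0) : Dom p r x.coeff 0 ∧ Dom p r y.coeff 0 := by
  have hx : x ≠ 0 := by rintro rfl; exact h.ne_zero (by rw [zero_mul]; rfl)
  have hy : y ≠ 0 := by rintro rfl; exact h.ne_zero (by rw [mul_zero]; rfl)
  obtain ⟨a, ha0, ha⟩ := exists_top hϖ hx hr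
  obtain ⟨b, hb0, hb⟩ := exists_top hϖ hy hr
  have hab := (isTop_mul hϖ hr ha hb).unique h.isTop
  obtain rfl : a = 0 := by linarith
  obtain rfl : b = 0 := by linarith
  exact ⟨ha.dom_zero x.2.1, hb.dom_zero y.2.1⟩

theorem dom_unit (hϖ : IsUnif ϖ) (u : (OmegaImmAn p F)ˣ) {r : ℝ} (hr : 0 < r) :
    Dom p r (u : OmegaImmAn p F).coeff 0 := by
  refine (dom_of_dom_mul hϖ hr (y := ((u⁻¹ : (OmegaImmAn p F)ˣ) : OmegaImmAn p F)) ?_).1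
  rw [u.mul_inv]
  exact dom_one r

theorem dom_prod (hϖ : IsUnif ϖ) {r : ℝ} (hr : 0 < r) (s : Finset ℕ) (y : ℕ → OmegaImmAn p F)
    (h : ∀ i ∈ s, Dom p r (y i).coeff 0) : Dom p r (∏ i ∈ s, y i).coeff 0 := by
  classical
  induction s using Finset.induction_on with
  | empty => simpa using dom_one r
  | insert a s ha ih =>
    rw [Finset.prod_insert ha]
    exact dom_mul hϖ hr (h a (Finset.mem_insert_self _ _))
      (ih fun i hi => h i (Finset.mem_insert_of_mem hi))

/-- Division with bounds: by multiplicativity the maximal weight of `y` is that of `x * y` divided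
by that of `x`. -/
theorem wt_le_of_mul (hϖ : IsUnif ϖ) {x y : OmegaImmAn p F} {r : ℝ} (hr : 0 < r) {a : ℚ}
    (ha : IsTop p r x.coeff a) {C : ℝ} (h : ∀ i, wt p r (x * y).coeff i ≤ C) (i : ℚ) :
    wt p r y.coeff i ≤ C / wt p r x.coeff a := by
  have hA : 0 < wt p r x.coeff a := wt_pos.2 ha.ne_zero
  by_cases hy : y = 0
  · subst hy
    rw [wt_eq_zero rfl]
    exact div_nonneg ((wt_nonneg _ _ _).trans (h 0)) hA.le
  · obtain ⟨b, -, hb⟩ := exists_top hϖ hy hr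
    rw [le_div_iff₀ hA, mul_comm]
    refine le_trans ?_ (h (a + b))
    rw [wt_mul_eq hϖ hr ha hb]
    gcongr
    exact hb.le i

end OmegaImmAn

end ring

/-! ### Variation of the dominant index with `r`, and slopes -/

section slopes

variable {p : ℕ} [hp : Fact p.Prime] {F : Type*} [NormedField F] [IsUltrametricDist F]
  [CompleteSpace F] {ϖ : F}

theorem Dom.gap (hϖ : IsUnif ϖ) {x : ℚ → F} (hx : x ∈ omegaImmAnAddSubgroup p F) {r : ℝ}
    (hr : 0 < r) {d : ℚ} (h : Dom p r x d) :
    ∃ l : ℝ, 0 < l ∧ l < 1 ∧ ∀ k, k ≠ d → wt p r x k ≤ l * wt p r x d := by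
  have hW : 0 < wt p r x d := wt_pos.2 h.ne_zero
  obtain ⟨l, hl0, hl1, hl⟩ := exists_wt_gap hϖ hx hr hW (T := {k | k ≠ d}) fun k hk => h.lt k hk
  refine ⟨max l (1 / 2), by positivity, max_lt hl1 (by norm_num), fun k hk => (hl k hk).trans ?_⟩
  gcongr
  exact le_max_left _ _

/-- Uniqueness of the maximum is an open condition because of the gap. When `r` increases the
competing weights can only drop; when it decreases they are controlled by interpolating between the
gap at `r` and the growth bound at `r / 2`. -/
theorem Dom.eventually (hϖ : IsUnif ϖ) {x : ℚ → F} (hx : x ∈ omegaImmAnAddSubgroup p F) {r : ℝ}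
    (hr : 0 < r) {d : ℚ} (h : Dom p r x d) : ∀ᶠ r' in nhds r, Dom p r' x d := by
  obtain ⟨l, hl0, hl1, hl⟩ := h.gap hϖ hx hr
  have hW : 0 < wt p r x d := wt_pos.2 h.ne_zero
  set W := wt p r x d
  obtain ⟨C, hC, hxC⟩ := hx.2.2.exists_wt_le (half_pos hr)
  have hp0 := prime_cast_pos p
  have e1 : ∀ᶠ r' in nhds r, l * W < W * (p : ℝ) ^ ((r - r') * d) := by
    refine ContinuousAt.eventually_lt (by fun_prop) ?_ (by simp; nlinarith)
    exact (continuousAt_const.mul (ContinuousAt.rpow continuousAt_const (by fun_prop)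
      (Or.inl hp0.ne')))
  -- The exponent `θ = 2 * r' / r - 1` is the one with `r' = θ r + (1 - θ) r / 2`, so the left side
  -- is the interpolated bound. At `r' = r` it is `l * W`.
  have e2 : ∀ᶠ r' in nhds r, (l * W) ^ (2 * r' / r - 1) * C ^ (1 - (2 * r' / r - 1)) <
      W * (p : ℝ) ^ ((r - r') * d) := by
    refine ContinuousAt.eventually_lt ?_ ?_ ?_
    · exact (ContinuousAt.rpow continuousAt_const (by fun_prop)
        (Or.inl (by positivity))).mul (ContinuousAt.rpow continuousAt_const (by fun_prop)
        (Or.inl hC.ne'))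
    · exact (continuousAt_const.mul (ContinuousAt.rpow continuousAt_const (by fun_prop)
        (Or.inl hp0.ne')))
    · have : 2 * r / r = 2 := by field_simp
      rw [this]
      norm_num
      nlinarith
  have e3 : ∀ᶠ r' in nhds r, r / 2 < r' := lt_mem_nhds (by linarith)
  have e4 : ∀ᶠ r' in nhds r, r' < 2 * r := gt_mem_nhds (by linarith)
  filter_upwards [e1, e2, e3, e4] with r' h1 h2 h3 h4
  refine ⟨h.ne_zero, fun k hk => ?_⟩
  rw [wt_change r r' x d]
  by_cases hk0 : k < 0
  · rw [wt_eq_zero (hx.1 k hk0)]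
    exact mul_pos hW (prime_rpow_pos p _)
  have hk0' : (0 : ℝ) ≤ k := by exact_mod_cast not_lt.1 hk0
  rcases le_or_gt r r' with hle | hgt
  · refine lt_of_le_of_lt ?_ h1
    rw [wt_change r r' x k]
    refine le_trans (mul_le_of_le_one_right (wt_nonneg _ _ _) ?_) (hl k hk)
    exact Real.rpow_le_one_of_one_le_of_nonpos (one_lt_prime_cast p).le
      (mul_nonpos_of_nonpos_of_nonneg (by linarith) hk0')
  · refine lt_of_le_of_lt ?_ h2
    set θ := 2 * r' / r - 1 with hθ
    have hθ0 : 0 ≤ θ := by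
      rw [hθ, sub_nonneg, le_div_iff₀ hr]; linarith
    have hθ1 : 0 ≤ 1 - θ := by
      rw [hθ, sub_nonneg, sub_le_iff_le_add, div_le_iff₀ hr]; linarith
    have hr' : r' = r * θ + r / 2 * (1 - θ) := by rw [hθ]; field_simp; ring
    have key : wt p r' x k = wt p r x k ^ θ * wt p (r / 2) x k ^ (1 - θ) := by
      unfold wt
      rw [Real.mul_rpow (norm_nonneg _) (by positivity), Real.mul_rpow (norm_nonneg _)
        (by positivity), ← Real.rpow_mul hp0.le, ← Real.rpow_mul hp0.le, mul_mul_mul_comm,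
        ← Real.rpow_add hp0]
      rw [← Real.rpow_add_of_nonneg (norm_nonneg _) hθ0 hθ1, add_sub_cancel, Real.rpow_one]
      congr 2
      rw [hr']; ring
    rw [key]
    have := wt_nonneg (p := p) r x k
    have := wt_nonneg (p := p) (r / 2) x k
    gcongr
    · exact hl k hk
    · exact hxC k

/-- The positive indices with `‖x k‖ ≥ ‖x 0‖` are bounded below by some `m > 0`, by well-ordering;
there the weight is at most `C p^{(1 - r) m}`, which tends to `0` as `r` grows. All other positive
indices have smaller norm to begin with. -/
theorem exists_forall_dom_zero {x : ℚ → F} (hx : x ∈ omegaImmAnAddSubgroup p F) (h0 : x 0 ≠ 0) :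
    ∃ R : ℝ, 0 < R ∧ ∀ r, R ≤ r → Dom p r x 0 := by
  have hn : 0 < ‖x 0‖ := norm_pos_iff.2 h0
  have hw0 : ∀ r, wt p r x 0 = ‖x 0‖ := fun r => by simp [wt]
  set T := {k : ℚ | 0 < k ∧ ‖x 0‖ ≤ ‖x k‖} with hT
  have hwf : T.IsWF := (hx.2.1 _ (half_pos hn)).mono fun k hk => by
    simp only [Set.mem_ofPred_eq]
    linarith [hk.2]
  obtain ⟨C, hC, hxC⟩ := hx.2.2.exists_wt_le one_pos
  obtain ⟨m, hm0, hm⟩ : ∃ m : ℚ, 0 < m ∧ ∀ k ∈ T, m ≤ k := by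
    by_cases hne : T.Nonempty
    · exact ⟨hwf.min hne, (hwf.min_mem hne).1, fun k hk => hwf.min_le hne hk⟩
    · exact ⟨1, one_pos, fun k hk => absurd ⟨k, hk⟩ hne⟩
  have hm0' : (0 : ℝ) < m := by exact_mod_cast hm0
  have hlim : Filter.Tendsto (fun r : ℝ => C * (p : ℝ) ^ ((1 - r) * m)) Filter.atTop (nhds 0) := by
    rw [← mul_zero C]
    refine Filter.Tendsto.const_mul C ?_
    have h1 : Filter.Tendsto (fun r : ℝ => (1 - r) * m) Filter.atTop Filter.atBot := by
      refine Filter.Tendsto.atBot_mul_const hm0' ?_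
      exact (Filter.tendsto_atBot_add_const_left _ (1 : ℝ)
        Filter.tendsto_neg_atTop_atBot).congr fun r => by ring
    exact (tendsto_rpow_atBot_of_base_gt_one _ (one_lt_prime_cast p)).comp h1
  obtain ⟨R, hR⟩ := Filter.eventually_atTop.1 (hlim.eventually (gt_mem_nhds hn))
  refine ⟨max R 1, by positivity, fun r hr => ⟨h0, fun k hk => ?_⟩⟩
  have hrR := (le_max_left _ _).trans hr
  have hr1 := (le_max_right _ _).trans hr
  rw [hw0]
  rcases lt_or_gt_of_ne hk with hk | hk
  · rw [wt_eq_zero (hx.1 k hk)]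
    exact hn
  have hk' : (0 : ℝ) < k := by exact_mod_cast hk
  by_cases hkT : k ∈ T
  · refine lt_of_le_of_lt ?_ (hR r hrR)
    rw [wt_change 1 r]
    have h1 : (1 - r) * k ≤ (1 - r) * m :=
      mul_le_mul_of_nonpos_left (by exact_mod_cast hm k hkT) (by linarith)
    have := (one_lt_prime_cast p).le
    gcongr
    exact hxC k
  · have h1 : ‖x k‖ < ‖x 0‖ := by
      by_contra! h
      exact hkT ⟨hk, h⟩
    refine lt_of_le_of_lt ?_ h1
    refine mul_le_of_le_one_right (norm_nonneg _) ?_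
    refine Real.rpow_le_one_of_one_le_of_nonpos (one_lt_prime_cast p).le ?_
    nlinarith

/-! ### Slopes -/

theorem vp_add_eq {s : ℝ} {x : ℚ → F} {i : ℚ} (h : x i ≠ 0) :
    vp p (x i) + s * i = -Real.logb p (wt p s x i) := by
  have h1 := prime_rpow_pos p (-(s * i))
  rw [vp, wt, Real.logb_mul (norm_ne_zero_iff.2 h) h1.ne',
    Real.logb_rpow (prime_cast_pos p) (one_lt_prime_cast p).ne']
  ring

theorem vp_add_le_iff {s : ℝ} {x : ℚ → F} {i j : ℚ} (hi : x i ≠ 0) (hj : x j ≠ 0) :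
    vp p (x i) + s * i ≤ vp p (x j) + s * j ↔ wt p s x j ≤ wt p s x i := by
  rw [vp_add_eq hi, vp_add_eq hj, neg_le_neg_iff,
    Real.logb_le_logb (one_lt_prime_cast p) (wt_pos.2 hj) (wt_pos.2 hi)]

theorem mem_newtonHull {x : OmegaImmAn p F} {i : ℚ} (h : x.coeff i ≠ 0) :
    ((i : ℝ), vp p (x.coeff i)) ∈ newtonHull x := subset_convexHull _ _ ⟨i, h, rfl⟩

/-- On the convex hull the functional `S ↦ S.2 + s * S.1` is minimal only at the vertex of index
`d`, so both ends of a segment of slope `-s` on the lower boundary would be that vertex. -/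
theorem not_isSlope_of_dom {x : OmegaImmAn p F} {s : ℝ} {d : ℚ} (h : Dom p s x.coeff d) :
    ¬ IsSlope x s := by
  rintro ⟨-, P, hP, Q, hQ, hlt, heq, hmin⟩
  set P₀ : ℝ × ℝ := ((d : ℝ), vp p (x.coeff d)) with hP₀
  have hsub : newtonHull x ⊆ {S | P₀.2 + s * P₀.1 < S.2 + s * S.1 ∨ S = P₀} := by
    refine convexHull_min ?_ ?_
    · rintro _ ⟨i, hi, rfl⟩
      rcases eq_or_ne i d with rfl | hid
      · right; rfl
      · left
        refine lt_of_not_ge fun hge => ?_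
        exact absurd ((vp_add_le_iff hi h.ne_zero).1 hge) (not_le.2 (h.lt i hid))
    · rw [convex_iff_forall_pos]
      rintro S hS T hT a b ha hb hab
      have hsum : (a • S + b • T).2 + s * (a • S + b • T).1 =
          a * (S.2 + s * S.1) + b * (T.2 + s * T.1) := by
        simp; ring
      simp only [Set.mem_ofPred_eq] at hS hT ⊢
      have hμ : P₀.2 + s * P₀.1 = a * (P₀.2 + s * P₀.1) + b * (P₀.2 + s * P₀.1) := by
        rw [← add_mul, hab, one_mul]
      rw [hsum]
      rcases hS with hS | rfl <;> rcases hT with hT | rfl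
      · left; nlinarith
      · left; nlinarith
      · left; nlinarith
      · right
        rw [← add_smul, hab, one_smul]
  have h0 : P₀ ∈ newtonHull x := mem_newtonHull h.ne_zero
  have hPP : P = P₀ := by
    rcases hsub hP with h1 | h1
    · exact absurd (hmin P₀ h0) (not_le.2 h1)
    · exact h1
  have hQP : Q = P₀ := by
    rcases hsub hQ with h1 | h1
    · rw [← heq] at h1
      exact absurd (hmin P₀ h0) (not_le.2 h1)
    · exact h1
  rw [hPP, hQP] at hlt
  exact lt_irrefl _ hlt

/-- If a second index attained the maximal weight, the two corresponding points would span a segment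
of slope `-s` on the lower boundary. -/
theorem exists_dom_of_not_isSlope (hϖ : IsUnif ϖ) {x : OmegaImmAn p F} (hx : x ≠ 0) {s : ℝ}
    (hs : 0 < s) (h : ¬ IsSlope x s) : ∃ d, Dom p s x.coeff d := by
  obtain ⟨a, -, ha⟩ := OmegaImmAn.exists_top hϖ hx hs
  refine ⟨a, ha.ne_zero, fun k hk => ?_⟩
  rcases lt_or_gt_of_ne hk with hka | hka
  swap
  · exact ha.lt k hka
  refine lt_of_le_of_ne (ha.le k) fun he => h ?_
  have hk0 : x.coeff k ≠ 0 := wt_pos.1 (he ▸ wt_pos.2 ha.ne_zero)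
  refine ⟨hs, _, mem_newtonHull hk0, _, mem_newtonHull ha.ne_zero, Rat.cast_lt.2 hka,
    le_antisymm ((vp_add_le_iff hk0 ha.ne_zero).2 he.ge) ((vp_add_le_iff ha.ne_zero hk0).2 he.le),
    fun S hS => ?_⟩
  have hsub : newtonHull x ⊆ {S | vp p (x.coeff k) + s * k ≤ S.2 + s * S.1} := by
    refine convexHull_min ?_ ?_
    · rintro _ ⟨i, hi, rfl⟩
      exact (vp_add_le_iff hk0 hi).2 (he ▸ ha.le i)
    · have : IsLinearMap ℝ fun S : ℝ × ℝ => S.2 + s * S.1 :=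
        ⟨fun _ _ => by simp; ring, fun _ _ => by simp; ring⟩
      exact convex_halfSpace_ge this _
  exact hsub hS

/-- By `Dom.eventually` the dominant index is locally constant, hence constant on a connected set of
radii. -/
theorem dom_const_on (hϖ : IsUnif ϖ) {x : OmegaImmAn p F} {I : Set ℝ} (hI : IsPreconnected I)
    (hpos : ∀ r ∈ I, 0 < r) (h : ∀ r ∈ I, ∃ d, Dom p r x.coeff d) {r₀ : ℝ} (hr₀ : r₀ ∈ I)
    {d : ℚ} (hd : Dom p r₀ x.coeff d) : ∀ r ∈ I, Dom p r x.coeff d := by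
  choose! e he using h
  have key : ∀ r ∈ I, ∀ r' ∈ I, e r = e r' := by
    intro r hr r' hr'
    refine hI.induction₂ (fun a b => e a = e b) (fun a ha => ?_) ?_ ?_ hr hr'
    · filter_upwards [mem_nhdsWithin_of_mem_nhds ((he a ha).eventually hϖ x.2 (hpos a ha)),
        self_mem_nhdsWithin] with b hb hbI
      exact (hb.isTop).unique (he b hbI).isTop
    · intro a b c _ _ _ h1 h2; exact h1.trans h2
    · intro a b _ _ h1; exact h1.symm
  intro r hr
  have := hd.isTop.unique (he r₀ hr₀).isTop
  rw [this, key r₀ hr₀ r hr]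
  exact he r hr

theorem IsPure.dom_zero (hϖ : IsUnif ϖ) {x : OmegaImmAn p F} {s : ℝ} (h : IsPure x s) {r : ℝ}
    (hr : s < r) : Dom p r x.coeff 0 := by
  have hs : 0 < s := h.2.1.1
  have hx := OmegaImmAn.ne_zero_of_coeff h.1
  obtain ⟨R, -, hR⟩ := exists_forall_dom_zero x.2 h.1
  refine dom_const_on hϖ (I := Set.Ioi s) isPreconnected_Ioi (fun r hr => hs.trans hr)
    (fun r hr => exists_dom_of_not_isSlope hϖ hx (hs.trans hr) fun hsl => ?_)
    (r₀ := max R (s + 1)) ?_ (hR _ (le_max_left _ _)) r hr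
  · exact absurd (h.2.2 r hsl) (ne_of_gt hr)
  · exact (lt_add_one s).trans_le (le_max_right _ _)

/-- There are no slopes in `(0, s)`. That a single index serves all the way down to `0` is what
later extends bounds on a quotient to small radii. -/
theorem IsPure.exists_dom (hϖ : IsUnif ϖ) {x : OmegaImmAn p F} {s : ℝ} (h : IsPure x s) :
    ∃ d, ∀ r, 0 < r → r < s → Dom p r x.coeff d := by
  have hs : 0 < s := h.2.1.1
  have hx := OmegaImmAn.ne_zero_of_coeff h.1
  have hd : ∀ r ∈ Set.Ioo 0 s, ∃ d, Dom p r x.coeff d := fun r hr =>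
    exists_dom_of_not_isSlope hϖ hx hr.1 fun hsl => absurd (h.2.2 r hsl) (ne_of_lt hr.2)
  have hmem : s / 2 ∈ Set.Ioo 0 s := ⟨by linarith, by linarith⟩
  obtain ⟨d, hd'⟩ := hd _ hmem
  exact ⟨d, fun r h0 h1 => dom_const_on hϖ isPreconnected_Ioo (fun r hr => hr.1) hd hmem hd' r
    ⟨h0, h1⟩⟩

theorem IsPure.not_dom {x : OmegaImmAn p F} {s : ℝ} (h : IsPure x s) {d : ℚ} :
    ¬ Dom p s x.coeff d := fun hd => not_isSlope_of_dom hd h.2.1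

end slopes

/-! ### Limits for the norms `w_r`, and divisibility by pure series -/

section limits

variable {p : ℕ} [hp : Fact p.Prime] {F : Type*} [NormedField F] [IsUltrametricDist F]
  [CompleteSpace F] {ϖ : F}

theorem exists_pointwise_limit {u : ℕ → ℚ → F} {r : ℝ}
    (h : ∀ ε : ℝ, 0 < ε → ∃ N, ∀ n ≥ N, ∀ m ≥ N, ∀ i, wt p r (u n - u m) i ≤ ε) :
    ∃ x : ℚ → F, ∀ i, Filter.Tendsto (fun n => u n i) Filter.atTop (nhds (x i)) := by
  have : ∀ i, ∃ a, Filter.Tendsto (fun n => u n i) Filter.atTop (nhds a) := by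
    intro i
    refine cauchySeq_tendsto_of_complete (Metric.cauchySeq_iff.2 fun ε hε => ?_)
    have hP := prime_rpow_pos p (r * i)
    obtain ⟨N, hN⟩ := h (ε / 2 / (p : ℝ) ^ (r * i)) (by positivity)
    refine ⟨N, fun n hn m hm => ?_⟩
    have := wt_le_iff.1 (hN n hn m hm i)
    rw [div_mul_cancel₀ _ hP.ne'] at this
    rw [dist_eq_norm]
    exact this.trans_lt (by linarith)
  choose x hx using this
  exact ⟨x, hx⟩

theorem wt_sub_limit_le {u : ℕ → ℚ → F} {x : ℚ → F} {r ε : ℝ} {N : ℕ}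
    (hx : ∀ i, Filter.Tendsto (fun n => u n i) Filter.atTop (nhds (x i)))
    (h : ∀ n ≥ N, ∀ m ≥ N, ∀ i, wt p r (u n - u m) i ≤ ε) (n : ℕ) (hn : N ≤ n) (i : ℚ) :
    wt p r (u n - x) i ≤ ε := by
  have h1 : Filter.Tendsto (fun m => wt p r (u n - u m) i) Filter.atTop
      (nhds (wt p r (u n - x) i)) := by
    unfold wt
    exact ((tendsto_const_nhds.sub (hx i)).norm).mul_const _
  exact le_of_tendsto h1 (Filter.eventually_atTop.2 ⟨N, fun m hm => h n hn m hm i⟩)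

theorem limit_supp {u : ℕ → ℚ → F} {x : ℚ → F}
    (hx : ∀ i, Filter.Tendsto (fun n => u n i) Filter.atTop (nhds (x i))) {i : ℚ}
    (h : ∀ n, u n i = 0) : x i = 0 := by
  have := hx i
  simp only [h] at this
  exact tendsto_nhds_unique this tendsto_const_nhds

theorem limit_wo {u : ℕ → ℚ → F} {x : ℚ → F} {r : ℝ} (hr : 0 ≤ r)
    (h : ∀ ε : ℝ, 0 < ε → ∃ N, ∀ n ≥ N, ∀ i, wt p r (u n - x) i ≤ ε)
    (hu : ∀ n, WOLevels (u n)) : WOLevels x := by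
  refine wo_of_approx fun m ε hε => ?_
  have hP := prime_rpow_pos p (r * m)
  obtain ⟨N, hN⟩ := h (ε / (p : ℝ) ^ (r * m)) (by positivity)
  refine ⟨u N, hu N, fun i hi => ?_⟩
  refine (wt_le_iff.1 (hN N le_rfl i)).trans ?_
  have hi' : (i : ℝ) ≤ m := by exact_mod_cast hi
  have := (one_lt_prime_cast p).le
  calc _ ≤ ε / (p : ℝ) ^ (r * m) * (p : ℝ) ^ (r * m) := by gcongr
    _ = ε := div_mul_cancel₀ _ hP.ne'

/-- For `i ≥ 0` the bounds get weaker as `r` grows, so only small radii matter. -/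
theorem growth_of_small {x : ℚ → F} (h0 : ∀ i < 0, x i = 0) {r₁ : ℝ} (hr₁ : 0 < r₁)
    (h : ∀ r, 0 < r → r < r₁ → ∃ C, ∀ i, wt p r x i ≤ C) : Growth p x := by
  intro d hd
  obtain ⟨C, hC⟩ := h (min d (r₁ / 2)) (by positivity) ((min_le_right _ _).trans_lt (by linarith))
  have hC0 := (wt_nonneg _ _ 0).trans (hC 0)
  refine ⟨C, fun i => ?_⟩
  by_cases hi : i < 0
  · rw [h0 i hi, norm_zero]
    have := prime_rpow_pos p (d * i)
    positivity
  refine (wt_le_iff.1 (hC i)).trans ?_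
  have hi' : (0 : ℝ) ≤ i := by exact_mod_cast not_lt.1 hi
  have := (one_lt_prime_cast p).le
  gcongr
  exact min_le_left _ _

namespace OmegaImmAn

theorem exists_limit {u : ℕ → OmegaImmAn p F} (h : ∀ r : ℝ, 0 < r → ∀ ε : ℝ, 0 < ε →
      ∃ N, ∀ n ≥ N, ∀ m ≥ N, ∀ i, wt p r (u n - u m).coeff i ≤ ε) :
    ∃ x : OmegaImmAn p F, ∀ r : ℝ, 0 < r → ∀ ε : ℝ, 0 < ε →
      ∃ N, ∀ n ≥ N, ∀ i, wt p r (u n - x).coeff i ≤ ε := by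
  have hsub : ∀ n m, (u n - u m).coeff = (u n).coeff - (u m).coeff :=
    fun n m => funext fun i => coeff_sub _ _ i
  simp only [hsub] at h
  obtain ⟨x, hx⟩ := exists_pointwise_limit (h 1 one_pos)
  have hlim : ∀ r : ℝ, 0 < r → ∀ ε : ℝ, 0 < ε →
      ∃ N, ∀ n ≥ N, ∀ i, wt p r ((u n).coeff - x) i ≤ ε := by
    intro r hr ε hε
    obtain ⟨N, hN⟩ := h r hr ε hε
    exact ⟨N, wt_sub_limit_le hx hN⟩
  have h0 : ∀ i < 0, x i = 0 := fun i hi => limit_supp hx fun n => (u n).coeff_neg_index hi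
  have hmem : x ∈ omegaImmAnAddSubgroup p F := by
    refine ⟨h0, limit_wo zero_le_one (hlim 1 one_pos) fun n => (u n).2.2.1, fun d hd => ?_⟩
    obtain ⟨N, hN⟩ := hlim d hd 1 one_pos
    obtain ⟨C, hC, huC⟩ := (u N).exists_wt_le hd
    refine ⟨max C 1, fun i => wt_le_iff.1 ?_⟩
    have e : x i = (u N).coeff i - ((u N).coeff - x) i := by simp
    calc wt p d x i ≤ max (wt p d (u N).coeff i) (wt p d ((u N).coeff - x) i) := by
          unfold wt
          rw [← max_mul_of_nonneg _ _ (prime_rpow_pos p _).le]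
          have := prime_rpow_pos p (-(d * i))
          gcongr
          rw [e]
          exact norm_sub_le_max' _ _
      _ ≤ _ := max_le_max (huC i) (hN N le_rfl i)
  refine ⟨⟨x, hmem⟩, fun r hr ε hε => ?_⟩
  obtain ⟨N, hN⟩ := hlim r hr ε hε
  refine ⟨N, fun n hn i => ?_⟩
  have : (u n - ⟨x, hmem⟩ : OmegaImmAn p F).coeff = (u n).coeff - x :=
    funext fun i => coeff_sub _ _ i
  rw [this]
  exact hN n hn i

theorem eq_of_wt_sub_le {x y : OmegaImmAn p F} {r : ℝ}
    (h : ∀ ε : ℝ, 0 < ε → ∀ i, wt p r (x - y).coeff i ≤ ε) : x = y := by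
  refine ext (funext fun i => ?_)
  by_contra hne
  have h1 : 0 < wt p r (x - y).coeff i := wt_pos.2 (by rwa [coeff_sub, sub_ne_zero])
  linarith [h _ (half_pos h1) i]

theorem _root_.AnRing.FrechetTendsto.exists_wt_le {u : ℕ → OmegaImmAn p F} {x : OmegaImmAn p F}
    (h : FrechetTendsto u x) {r : ℝ} (hr : 0 < r) {ε : ℝ} (hε : 0 < ε) :
    ∃ N, ∀ n ≥ N, ∀ i, wt p r (u n - x).coeff i ≤ ε := by
  obtain ⟨N, hN⟩ := Filter.eventually_atTop.1 ((h r hr).eventually (gt_mem_nhds hε))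
  refine ⟨N, fun n hn i => le_trans ?_ (hN n hn).le⟩
  obtain ⟨C, -, hC⟩ := (u n - x).exists_wt_le hr
  exact le_ciSup (f := fun i => wt p r (u n - x).coeff i)
    ⟨C, by rintro _ ⟨i, rfl⟩; exact hC i⟩ i

/-- If the dominant index of a limit is approached by series dominated by their constant
coefficients, it is `0`. -/
theorem dom_zero_of_limit (hϖ : IsUnif ϖ) {u : ℕ → OmegaImmAn p F} {x : OmegaImmAn p F}
    (hx : x ≠ 0) {r : ℝ} (hr : 0 < r) (hu : ∀ n, Dom p r (u n).coeff 0)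
    (h : ∀ ε : ℝ, 0 < ε → ∃ N, ∀ n ≥ N, ∀ i, wt p r (u n - x).coeff i ≤ ε) :
    Dom p r x.coeff 0 := by
  obtain ⟨a, ha0, ha⟩ := exists_top hϖ hx hr
  have hW : 0 < wt p r x.coeff a := wt_pos.2 ha.ne_zero
  obtain ⟨N, hN⟩ := h _ (half_pos hW)
  have hN := hN N le_rfl
  suffices a = 0 by subst this; exact ha.dom_zero x.2.1
  by_contra hne
  have h1 := (hu N).lt a hne
  have h2 : wt p r x.coeff a ≤ wt p r (u N).coeff a := by
    have := wt_sub_le_max r (u N) (u N - x) a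
    rw [sub_sub_cancel] at this
    rcases le_max_iff.1 this with h | h
    · exact h
    · linarith [hN a]
  have h3 : wt p r (u N).coeff 0 ≤ wt p r x.coeff a := by
    have := wt_add_le_max r (u N - x) x 0
    rw [sub_add_cancel] at this
    refine this.trans (max_le ?_ (ha.le 0))
    linarith [hN 0]
  linarith

/-- Normalizing a series dominated by its constant coefficient to the form `1 - b`. -/
theorem exists_wt_one_sub_le (hϖ : IsUnif ϖ) {x : OmegaImmAn p F} {r : ℝ} (hr : 0 < r)
    (hx : Dom p r x.coeff 0) : ∃ l : ℝ, 0 ≤ l ∧ l < 1 ∧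
      ∀ i, wt p r (1 - const (x.coeff 0)⁻¹ * x).coeff i ≤ l := by
  obtain ⟨l, hl0, hl1, hl⟩ := hx.gap hϖ x.2 hr
  have hn : 0 < ‖x.coeff 0‖ := norm_pos_iff.2 hx.ne_zero
  refine ⟨l, hl0.le, hl1, fun i => ?_⟩
  rcases eq_or_ne i 0 with rfl | hi
  · rw [wt_eq_zero]
    · exact hl0.le
    · rw [coeff_sub, coeff_const_mul, inv_mul_cancel₀ hx.ne_zero, coeff_one]
      simp [mono]
  · have h1 := hl i hi
    rw [wt, wt] at h1
    rw [wt, coeff_sub, coeff_const_mul, coeff_one]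
    simp only [mono, hi, if_false, zero_sub, norm_neg, norm_mul, norm_inv]
    simp only [Rat.cast_zero, mul_zero, neg_zero, Real.rpow_zero, mul_one] at h1
    rw [mul_assoc, inv_mul_le_iff₀ hn, mul_comm _ l]
    exact h1

theorem wt_pow_le {b : OmegaImmAn p F} {r l : ℝ} (hb : ∀ i, wt p r b.coeff i ≤ l) (n : ℕ) (i : ℚ) :
    wt p r (b ^ n).coeff i ≤ l ^ n := by
  have hl : 0 ≤ l := (wt_nonneg _ _ 0).trans (hb 0)
  induction n generalizing i with
  | zero =>
    rw [pow_zero, pow_zero]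
    refine ((dom_one r).le i).trans ?_
    simp [wt, coeff_one, mono]
  | succ n ih =>
    rw [pow_succ, pow_succ]
    exact wt_conv_le_mul ih hb i

end OmegaImmAn

/-- If `Z * y = z`, where `y` has the same dominant index at `r` and at `r₁ > r`, then a bound for
`Z` at `r₁` and one for `z` at `r` give a bound for `Z` at `r`. -/
theorem wt_le_of_conv_eq (hϖ : IsUnif ϖ) {Z y z : ℚ → F} (hZ0 : ∀ i < 0, Z i = 0)
    (wZ : WOLevels Z) {r r₁ C D : ℝ} (hr : 0 < r) (hrr : r < r₁) (hZ : ∀ i, wt p r₁ Z i ≤ C)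
    (hy : y ∈ omegaImmAnAddSubgroup p F) {d : ℚ} (hd : Dom p r y d) (hd₁ : Dom p r₁ y d)
    (hz : ∀ i, wt p r z i ≤ D) (hconv : conv Z y = z) (K : ℚ) :
    wt p r Z K ≤ D / wt p r y d := by
  have hr₁ : 0 < r₁ := hr.trans hrr
  have hp0 := prime_cast_pos p
  have hp1 := (one_lt_prime_cast p).le
  have hD : 0 ≤ D := (wt_nonneg _ _ 0).trans (hz 0)
  have hC : 0 ≤ C := (wt_nonneg _ _ 0).trans (hZ 0)
  have hyd : 0 < wt p r y d := wt_pos.2 hd.ne_zero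
  have hnd : 0 < ‖y d‖ := norm_pos_iff.2 hd.ne_zero
  by_cases hK : K < 0
  · rw [wt_eq_zero (hZ0 K hK)]; positivity
  have hK0 : (0 : ℝ) ≤ K := by exact_mod_cast not_lt.1 hK
  obtain ⟨l₀, hl₀0, hl₀1, hl₀⟩ := hd.gap hϖ hy hr
  obtain ⟨l₁, hl₁0, hl₁1, hl₁⟩ := hd₁.gap hϖ hy hr₁
  set l := max l₀ l₁ with hl
  have hl0 : 0 < l := lt_max_of_lt_left hl₀0
  have hl1 : l < 1 := max_lt hl₀1 hl₁1
  have hy₀ : ∀ m, m ≠ d → ‖y m‖ ≤ l * ‖y d‖ * (p : ℝ) ^ (r * (m - d)) := by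
    intro m hm
    refine (wt_le_iff.1 (hl₀ m hm)).trans ?_
    rw [wt, ← mul_assoc, mul_assoc _ _ ((p : ℝ) ^ (r * m)), ← Real.rpow_add hp0]
    have : -(r * d) + r * m = r * ((m : ℝ) - d) := by ring
    rw [this]
    gcongr
    exact le_max_left _ _
  have hy₁ : ∀ m, m ≠ d → ‖y m‖ ≤ l * ‖y d‖ * (p : ℝ) ^ (r₁ * (m - d)) := by
    intro m hm
    refine (wt_le_iff.1 (hl₁ m hm)).trans ?_
    rw [wt, ← mul_assoc, mul_assoc _ _ ((p : ℝ) ^ (r₁ * m)), ← Real.rpow_add hp0]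
    have : -(r₁ * d) + r₁ * m = r₁ * ((m : ℝ) - d) := by ring
    rw [this]
    gcongr
    exact le_max_right _ _
  -- The exponent function is tailored to the index `K`: it has slope `r` up to `K` and slope `r₁`
  -- beyond. Thus the bound at `r₁` still bounds all the weights `‖Z i‖ p^{-e i}`, while at `i = K`
  -- the weight is exactly the one at radius `r`. All slopes of `e` lie between `r` and `r₁`, where
  -- `y` is dominated by its term at `d`.
  let e : ℚ → ℝ := fun i => r * min (i : ℝ) K + r₁ * max ((i : ℝ) - K) 0
  have helo : ∀ i : ℚ, (i : ℝ) ≤ K → e i = r * i := fun i h => by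
    simp only [e]; rw [min_eq_left h, max_eq_right (by linarith)]; ring
  have hehi : ∀ i : ℚ, (K : ℝ) ≤ i → e i = r * K + r₁ * (i - K) := fun i h => by
    simp only [e]; rw [min_eq_right h, max_eq_left (by linarith)]
  have he1 : ∀ i j : ℚ, i ≤ j → r * (j - i) ≤ e j - e i ∧ e j - e i ≤ r₁ * (j - i) := by
    intro i j hij
    have hij' : (i : ℝ) ≤ j := by exact_mod_cast hij
    rcases le_total (i : ℝ) K with h1 | h1 <;> rcases le_total (j : ℝ) K with h2 | h2
    · rw [helo i h1, helo j h2]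
      constructor <;> nlinarith
    · rw [helo i h1, hehi j h2]
      constructor <;> nlinarith
    · rw [hehi i h1, helo j h2]
      constructor <;> nlinarith
    · rw [hehi i h1, hehi j h2]
      constructor <;> nlinarith
  have he0 : e 0 = 0 := by
    rw [helo 0 (by rwa [Rat.cast_zero]), Rat.cast_zero, mul_zero]
  have heK : e K = r * K := by simp [e]
  have hei : ∀ i : ℚ, 0 ≤ i → r * i ≤ e i := fun i hi => by
    have := (he1 0 i hi).1
    rw [he0] at this
    simpa using this
  have hei₁ : ∀ i : ℚ, r₁ * i - (r₁ - r) * K ≤ e i := by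
    intro i
    rcases le_total i K with h | h
    · have := (he1 i K h).2
      rw [heK] at this; linarith
    · have hh : (K : ℝ) ≤ i := by exact_mod_cast h
      rw [hehi i hh]
      linarith
  let V : ℚ → ℝ := fun i => ‖Z i‖ * (p : ℝ) ^ (-e i)
  have hV0 : ∀ i, 0 ≤ V i := fun i => by positivity
  have hZV : ∀ i, ‖Z i‖ = V i * (p : ℝ) ^ e i := fun i => by
    simp only [V]
    rw [mul_assoc, ← Real.rpow_add hp0, neg_add_cancel, Real.rpow_zero, mul_one]
  -- This crude bound, which depends on `K`, only serves to make the supremum of `V` finite.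
  have hVb : ∀ i, V i ≤ C * (p : ℝ) ^ ((r₁ - r) * K) := by
    intro i
    calc V i ≤ C * (p : ℝ) ^ (r₁ * i) * (p : ℝ) ^ (-e i) := by
          simp only [V]; gcongr; exact wt_le_iff.1 (hZ i)
      _ = C * (p : ℝ) ^ (r₁ * i + -e i) := by rw [mul_assoc, ← Real.rpow_add hp0]
      _ ≤ _ := by
          gcongr
          linarith [hei₁ i]
  set M := D / wt p r y d with hM
  have hM0 : 0 ≤ M := by positivity
  -- In the coefficient of `conv Z y` at `i + d` the term `Z i * y d` is isolated. The other terms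
  -- are smaller by the factor `l`: for `k < i` by the gap of `y` at `r`, for `k > i` by the gap at
  -- `r₁`. Hence `Z i * y d` is controlled by `z` or by `l * S`.
  have step : ∀ S, (∀ i, V i ≤ S) → ∀ i, V i ≤ max M (l * S) := by
    intro S hS i
    have hS0 : 0 ≤ S := (hV0 0).trans (hS 0)
    by_cases hi : i < 0
    · simp only [V, hZ0 i hi, norm_zero, zero_mul]
      exact le_max_of_le_left hM0
    have hs := summable_conv_of_nonneg hZ0 hy.1 wZ hy.2.1 (bdd_trunc_of_wt_le hr₁.le hZ)
      (bdd_trunc_of_mem hy) (i + d)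
    have h1 : ‖conv Z y (i + d) - Z i * y (i + d - i)‖ ≤ l * S * ‖y d‖ * (p : ℝ) ^ e i := by
      refine norm_conv_sub_le hs (by positivity) fun k hk => ?_
      have hm : i + d - k ≠ d := fun h => hk (by linarith)
      rw [norm_mul]
      rcases lt_or_gt_of_ne hk with hki | hki
      · calc ‖Z k‖ * ‖y (i + d - k)‖
            ≤ (S * (p : ℝ) ^ e k) * (l * ‖y d‖ * (p : ℝ) ^ (r * ((i + d - k : ℚ) - d))) := by
              rw [hZV k]; gcongr; exacts [hS k, hy₀ _ hm]
          _ = l * S * ‖y d‖ * (p : ℝ) ^ (e k + r * ((i + d - k : ℚ) - d)) := by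
              rw [Real.rpow_add hp0 (e k)]; ring
          _ ≤ _ := by
              gcongr
              have := (he1 k i hki.le).1
              push_cast
              linarith
      · calc ‖Z k‖ * ‖y (i + d - k)‖
            ≤ (S * (p : ℝ) ^ e k) * (l * ‖y d‖ * (p : ℝ) ^ (r₁ * ((i + d - k : ℚ) - d))) := by
              rw [hZV k]; gcongr; exacts [hS k, hy₁ _ hm]
          _ = l * S * ‖y d‖ * (p : ℝ) ^ (e k + r₁ * ((i + d - k : ℚ) - d)) := by
              rw [Real.rpow_add hp0 (e k)]; ring
          _ ≤ _ := by
              gcongr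
              have := (he1 i k hki.le).2
              push_cast
              linarith
    rw [hconv, add_sub_cancel_left] at h1
    have h2 : ‖Z i‖ * ‖y d‖ ≤ max ‖z (i + d)‖ (l * S * ‖y d‖ * (p : ℝ) ^ e i) := by
      rw [← norm_mul]
      have := norm_sub_le_max' (z (i + d)) (z (i + d) - Z i * y d)
      rw [sub_sub_cancel] at this
      exact this.trans (max_le_max le_rfl h1)
    have hpe := prime_rpow_pos p (e i)
    rcases le_max_iff.1 h2 with h | h
    · refine le_max_of_le_left ?_
      rw [hM, le_div_iff₀ hyd]
      have h3 := wt_le_iff.1 (hz (i + d))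
      calc V i * wt p r y d = (‖Z i‖ * ‖y d‖) * ((p : ℝ) ^ (-e i) * (p : ℝ) ^ (-(r * d))) := by
            simp only [V, wt]; ring
        _ ≤ (D * (p : ℝ) ^ (r * (i + d : ℚ))) * ((p : ℝ) ^ (-e i) * (p : ℝ) ^ (-(r * d))) := by
            exact mul_le_mul_of_nonneg_right (h.trans h3) (by positivity)
        _ = D * (p : ℝ) ^ (r * i - e i) := by
            rw [mul_assoc, ← Real.rpow_add hp0, ← Real.rpow_add hp0]
            congr 2; push_cast; ring
        _ ≤ D * 1 := by
            gcongr
            refine Real.rpow_le_one_of_one_le_of_nonpos hp1 ?_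
            linarith [hei i (not_lt.1 hi)]
        _ = D := mul_one D
    · refine le_max_of_le_right ?_
      rw [hZV i] at h
      have h4 : V i * ((p : ℝ) ^ e i * ‖y d‖) ≤ l * S * ((p : ℝ) ^ e i * ‖y d‖) := by
        calc _ = V i * (p : ℝ) ^ e i * ‖y d‖ := by ring
          _ ≤ _ := h
          _ = _ := by ring
      exact le_of_mul_le_mul_right h4 (by positivity)
  have hbdd : BddAbove (Set.range V) := ⟨_, by rintro _ ⟨i, rfl⟩; exact hVb i⟩
  -- The supremum satisfies `S ≤ max M (l * S)` with `l < 1`, which forces `S ≤ M`; the auxiliary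
  -- bound has disappeared.
  have hsup : (⨆ i, V i) ≤ max M (l * ⨆ i, V i) := ciSup_le (step _ (le_ciSup hbdd))
  have hle : (⨆ i, V i) ≤ M := by
    rcases le_max_iff.1 hsup with h | h
    · exact h
    · nlinarith
  have hVK : V K = wt p r Z K := by simp only [V, wt, heK]
  rw [← hVK]
  exact (le_ciSup hbdd K).trans hle

namespace OmegaImmAn

/-- A pure series of slope `s` is coprime to any series whose slopes are all smaller than `s`. -/
theorem dvd_of_mul_eq_mul (hϖ : IsUnif ϖ) {y A z B : OmegaImmAn p F} {s : ℝ} (hy : IsPure y s)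
    (hB : Dom p s B.coeff 0) (h : y * A = z * B) : y ∣ z := by
  have hs : 0 < s := hy.2.1.1
  -- Dominance of `B` is open in the radius, which leaves room to go strictly below `s`, where `y`
  -- has its constant dominant index.
  obtain ⟨r, hrB, hr0, hrs⟩ : ∃ r, Dom p r B.coeff 0 ∧ 0 < r ∧ r < s := by
    have h1 := ((hB.eventually hϖ B.2 hs).filter_mono nhdsWithin_le_nhds).and
      (Ioo_mem_nhdsLT hs)
    obtain ⟨r, h1, h2⟩ := h1.exists
    exact ⟨r, h1, h2.1, h2.2⟩
  obtain ⟨l, hl0, hl1, hl⟩ := exists_wt_one_sub_le hϖ hr0 hrB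
  set b := 1 - const (B.coeff 0)⁻¹ * B with hb
  set A' := const (B.coeff 0)⁻¹ * A with hA'
  have hA'b : y * A' = z * (1 - b) := by
    rw [hb, hA', sub_sub_cancel, mul_left_comm, h, mul_left_comm]
  obtain ⟨a, ha, hAa⟩ := A'.exists_wt_le hr0
  obtain ⟨cy, hcy, hycy⟩ := y.exists_wt_le hr0
  obtain ⟨cz, hcz, hzcz⟩ := z.exists_wt_le hr0
  -- These are the partial sums of `A' / (1 - b)`. Since `y * A' = z * (1 - b)`, their limit is the
  -- quotient of `z` by `y`.
  let Z : ℕ → OmegaImmAn p F := fun N => A' * ∑ n ∈ Finset.range N, b ^ n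
  have hZy : ∀ N, Z N * y = z - z * b ^ N := by
    intro N
    calc Z N * y = (y * A') * ∑ n ∈ Finset.range N, b ^ n := by simp only [Z]; ring
      _ = z * ((1 - b) * ∑ n ∈ Finset.range N, b ^ n) := by rw [hA'b]; ring
      _ = z * (1 - b ^ N) := by rw [mul_neg_geom_sum]
      _ = _ := by ring
  have hsum : ∀ N k i, wt p r (Z (N + k) - Z N).coeff i ≤ a * l ^ N := by
    intro N k i
    have e1 : Z (N + k) - Z N = A' * (b ^ N * ∑ n ∈ Finset.range k, b ^ n) := by
      simp only [Z]
      rw [Finset.sum_range_add, mul_add, add_sub_cancel_left, Finset.mul_sum (a := b ^ N)]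
      simp only [pow_add]
    have e2 : ∀ k i, wt p r (∑ n ∈ Finset.range k, b ^ n).coeff i ≤ 1 := by
      intro k
      induction k with
      | zero => intro i; rw [Finset.sum_range_zero, wt_eq_zero rfl]; exact zero_le_one
      | succ k ih =>
        intro i
        rw [Finset.sum_range_succ]
        exact (wt_add_le_max _ _ _ _).trans
          (max_le (ih i) ((wt_pow_le hl k i).trans (pow_le_one₀ hl0 hl1.le)))
    rw [e1]
    refine wt_conv_le_mul hAa (fun j => ?_) i
    have := wt_conv_le_mul (wt_pow_le hl N) (e2 k) j
    rwa [mul_one] at this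
  have hlim0 : ∀ ε : ℝ, 0 < ε → ∃ N, ∀ n ≥ N, a * l ^ n ≤ ε := by
    intro ε hε
    have := (tendsto_pow_atTop_nhds_zero_of_lt_one hl0 hl1).const_mul a
    rw [mul_zero] at this
    obtain ⟨N, hN⟩ := Filter.eventually_atTop.1 (this.eventually (gt_mem_nhds hε))
    exact ⟨N, fun n hn => (hN n hn).le⟩
  have hcoe : ∀ n m, (Z n - Z m).coeff = (Z n).coeff - (Z m).coeff :=
    fun n m => funext fun i => coeff_sub _ _ i
  have hcauchy : ∀ ε : ℝ, 0 < ε → ∃ N, ∀ n ≥ N, ∀ m ≥ N, ∀ i,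
      wt p r ((Z n).coeff - (Z m).coeff) i ≤ ε := by
    intro ε hε
    obtain ⟨N, hN⟩ := hlim0 ε hε
    refine ⟨N, fun n hn m hm i => ?_⟩
    rcases le_total m n with hmn | hmn
    · obtain ⟨k, rfl⟩ := Nat.exists_eq_add_of_le hmn
      rw [← hcoe]
      exact (hsum m k i).trans (hN m hm)
    · obtain ⟨k, rfl⟩ := Nat.exists_eq_add_of_le hmn
      have : wt p r ((Z n).coeff - (Z (n + k)).coeff) i =
          wt p r ((Z (n + k)).coeff - (Z n).coeff) i := by
        unfold wt
        rw [Pi.sub_apply, Pi.sub_apply, norm_sub_rev]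
      rw [this, ← hcoe]
      exact (hsum n k i).trans (hN n hn)
  -- The series converges for `w_r` only, so at first `Y` is just a coefficient function bounded at
  -- radius `r`, not known to lie in `Ω^imm_an`.
  obtain ⟨Y, hY⟩ := exists_pointwise_limit hcauchy
  have hYlim : ∀ ε : ℝ, 0 < ε → ∃ N, ∀ n ≥ N, ∀ i, wt p r ((Z n).coeff - Y) i ≤ ε := by
    intro ε hε
    obtain ⟨N, hN⟩ := hcauchy ε hε
    exact ⟨N, wt_sub_limit_le hY hN⟩
  have hY0 : ∀ i < 0, Y i = 0 := fun i hi => limit_supp hY fun n => (Z n).coeff_neg_index hi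
  have hYwo : WOLevels Y := limit_wo hr0.le hYlim fun n => (Z n).2.2.1
  obtain ⟨C, hYC⟩ : ∃ C, ∀ i, wt p r Y i ≤ C := by
    obtain ⟨N, hN⟩ := hYlim 1 one_pos
    obtain ⟨C, -, hC⟩ := (Z N).exists_wt_le hr0
    refine ⟨max C 1, fun i => ?_⟩
    have h1 := norm_sub_le_max' ((Z N).coeff i) (((Z N).coeff - Y) i)
    rw [Pi.sub_apply, sub_sub_cancel] at h1
    have hP := prime_rpow_pos p (-(r * i))
    calc wt p r Y i ≤ max (wt p r (Z N).coeff i) (wt p r ((Z N).coeff - Y) i) := by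
          unfold wt
          rw [← max_mul_of_nonneg _ _ hP.le]
          gcongr
          exact h1
      _ ≤ _ := max_le_max (hC i) (hN N le_rfl i)
  have hconv : conv Y y.coeff = z.coeff := by
    funext m
    by_contra hne
    have hpos : 0 < ‖conv Y y.coeff m - z.coeff m‖ := norm_pos_iff.2 (sub_ne_zero.2 hne)
    set δ := ‖conv Y y.coeff m - z.coeff m‖ with hδ
    have hP := prime_rpow_pos p (r * m)
    set ε := δ / 2 / (p : ℝ) ^ (r * m) with hε
    have hε0 : 0 < ε := by positivity
    obtain ⟨N₁, hN₁⟩ := hYlim (ε / cy) (by positivity)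
    obtain ⟨N₂, hN₂⟩ := hlim0 (a * (ε / cz)) (by positivity)
    set n := max N₁ N₂
    have hS1 : Summable fun i => (Z n).coeff i * y.coeff (m - i) :=
      summable_conv_of_mem (Z n).2 y.2 m
    have hS2 : Summable fun i => Y i * y.coeff (m - i) :=
      summable_conv_of_nonneg hY0 y.2.1 hYwo y.2.2.1 (bdd_trunc_of_wt_le hr0.le hYC)
      (bdd_trunc_of_mem y.2) m
    have hdiff : conv ((Z n).coeff - Y) y.coeff m =
        conv (Z n).coeff y.coeff m - conv Y y.coeff m := by
      unfold conv
      rw [← hS1.tsum_sub hS2]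
      refine tsum_congr fun i => ?_
      rw [Pi.sub_apply, sub_mul]
    have h1 : ‖conv (Z n).coeff y.coeff m - conv Y y.coeff m‖ ≤ δ / 2 := by
      rw [← hdiff]
      have := wt_le_iff.1 (wt_conv_le_mul (hN₁ n (le_max_left _ _)) hycy m)
      rwa [div_mul_cancel₀ _ hcy.ne', hε, div_mul_cancel₀ _ hP.ne'] at this
    have h2 : ‖z.coeff m - conv (Z n).coeff y.coeff m‖ ≤ δ / 2 := by
      have e : z.coeff m - conv (Z n).coeff y.coeff m = (z * b ^ n).coeff m := by
        rw [← coeff_mul, hZy, coeff_sub, sub_sub_cancel]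
      rw [e]
      have h3 : l ^ n ≤ ε / cz := le_of_mul_le_mul_left (hN₂ n (le_max_right _ _)) ha
      have := wt_le_iff.1 (wt_conv_le_mul hzcz (fun j => (wt_pow_le hl n j).trans h3) m)
      rwa [mul_div_cancel₀ _ hcz.ne', hε, div_mul_cancel₀ _ hP.ne'] at this
    have h4 := IsUltrametricDist.norm_add_le_max
      (z.coeff m - conv (Z n).coeff y.coeff m) (conv (Z n).coeff y.coeff m - conv Y y.coeff m)
    rw [sub_add_sub_cancel, norm_sub_rev, ← hδ] at h4
    linarith [h4.trans (max_le h2 h1)]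
  obtain ⟨d, hd⟩ := hy.exists_dom hϖ
  -- For `r' < r < s` the series `y` has the same dominant index at `r'` and `r`, so the bound of
  -- `z` at `r'` gives one for `Y`.
  have hmem : Y ∈ omegaImmAnAddSubgroup p F := by
    refine ⟨hY0, hYwo, growth_of_small hY0 hr0 fun r' h0 h1 => ?_⟩
    obtain ⟨D, -, hD⟩ := z.exists_wt_le h0
    exact ⟨_, wt_le_of_conv_eq hϖ hY0 hYwo h0 h1 hYC y.2 (hd r' h0 (h1.trans hrs))
      (hd r hr0 hrs) hD hconv⟩
  exact ⟨⟨Y, hmem⟩, ext (hconv.symm.trans (conv_comm _ _))⟩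

end OmegaImmAn

end limits

/-! ### Tails of slope factorizations, uniqueness, and descent to `R` -/

section uniqueness

variable {p : ℕ} [hp : Fact p.Prime] {F : Type*} [NormedField F] [IsUltrametricDist F]
  [CompleteSpace F] {ϖ : F}

theorem OmegaImmAn.isDomain (hϖ : IsUnif ϖ) : IsDomain (OmegaImmAn p F) := by
  have : Nontrivial (OmegaImmAn p F) := ⟨1, 0, ne_zero_of_coeff (dom_one (p := p) 1).ne_zero⟩
  have : NoZeroDivisors (OmegaImmAn p F) := ⟨fun {x y} h => by
    by_contra! hne
    exact mul_ne_zero_of_unif hϖ hne.1 hne.2 h⟩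
  exact NoZeroDivisors.to_isDomain _

theorem dom_tPow (j : ℚ≥0) (r : ℝ) : Dom p r (tPow p F j).coeff j := by
  have h : (tPow p F j).coeff j ≠ 0 := by simp [OmegaImmAn.coeff_tPow, mono]
  refine ⟨h, fun k hk => ?_⟩
  rw [wt_eq_zero (by simp [OmegaImmAn.coeff_tPow, mono, hk])]
  exact wt_pos.2 h

namespace SlopeFactorization

variable {R : Subring (OmegaImmAn p F)} {x : R}

/-- `A` is the product of the factors of index at least `k`. -/
def IsTail (f : SlopeFactorization R x) (k : ℕ) (A : OmegaImmAn p F) : Prop :=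
  (f.prod : OmegaImmAn p F) = (∏ i ∈ Finset.range k, (f.y i : OmegaImmAn p F)) * A

theorem coe_eq (f : SlopeFactorization R x) :
    (x : OmegaImmAn p F) = (f.c : R) * tPow p F f.j * f.prod :=
  congrArg (Subtype.val) f.eq

theorem prod_ne_zero (f : SlopeFactorization R x) (hx : x ≠ 0) :
    (f.prod : OmegaImmAn p F) ≠ 0 := fun h => hx (Subtype.ext (by
  rw [f.coe_eq, h, mul_zero]; rfl))

theorem y_ne_zero (f : SlopeFactorization R x) {i : ℕ} (hi : (i : ℕ∞) < f.N) :
    (f.y i : OmegaImmAn p F) ≠ 0 := OmegaImmAn.ne_zero_of_coeff (f.isPure i hi).1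

theorem coe_partial_prod (f : SlopeFactorization R x) (n : ℕ) :
    ((∏ i ∈ Finset.range n, f.y i : R) : OmegaImmAn p F) =
      ∏ i ∈ Finset.range n, (f.y i : OmegaImmAn p F) := map_prod R.subtype _ _

theorem partial_prod_ne_zero (hϖ : IsUnif ϖ) (f : SlopeFactorization R x) {k : ℕ}
    (hk : (k : ℕ∞) ≤ f.N) : ∏ i ∈ Finset.range k, (f.y i : OmegaImmAn p F) ≠ 0 := by
  have := OmegaImmAn.isDomain (p := p) hϖ
  refine Finset.prod_ne_zero_iff.2 fun i hi => f.y_ne_zero (lt_of_lt_of_le ?_ hk)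
  exact_mod_cast Finset.mem_range.1 hi

/-- For an infinite product the tail is the limit of the products of the factors from index `k` on.
Multiplied by the first `k` factors these converge, and by multiplicativity of `w_r` one may divide
by that fixed nonzero product. Dominance by the constant term holds for each partial product and
passes to the nonzero limit. -/
theorem exists_tail (hϖ : IsUnif ϖ) (hx : x ≠ 0) (f : SlopeFactorization R x) {k : ℕ}
    (hk : (k : ℕ∞) ≤ f.N) : ∃ A, f.IsTail k A ∧ (f.N = k → A = 1) ∧
      ∀ r, 0 < r → (∀ i : ℕ, k ≤ i → (i : ℕ∞) < f.N → f.s i < r) → Dom p r A.coeff 0 := by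
  rcases eq_or_ne f.N ⊤ with hN | hN
  · have hlt : ∀ i : ℕ, (i : ℕ∞) < f.N := fun i => hN ▸ ENat.natCast_lt_top i
    set Y := ∏ i ∈ Finset.range k, (f.y i : OmegaImmAn p F) with hY
    have hY0 : Y ≠ 0 := f.partial_prod_ne_zero hϖ hk
    set P : OmegaImmAn p F := (f.prod : OmegaImmAn p F)
    let Q : ℕ → OmegaImmAn p F := fun n => ∏ i ∈ Finset.range n, (f.y i : OmegaImmAn p F)
    let u : ℕ → OmegaImmAn p F := fun n => ∏ i ∈ Finset.range n, (f.y (k + i) : OmegaImmAn p F)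
    have hu : ∀ n, Y * u n = Q (k + n) := fun n => (Finset.prod_range_add _ _ _).symm
    have hQ : FrechetTendsto Q P := by
      have := f.prod_infinite hN
      simp only [coe_partial_prod] at this
      exact this
    obtain ⟨A, hA⟩ := OmegaImmAn.exists_limit (u := u) fun r hr ε hε => by
      obtain ⟨a, -, ha⟩ := OmegaImmAn.exists_top hϖ hY0 hr
      have hW : 0 < wt p r Y.coeff a := wt_pos.2 ha.ne_zero
      obtain ⟨N, hN⟩ := hQ.exists_wt_le hr (mul_pos hε hW)
      refine ⟨N, fun n hn m hm i => ?_⟩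
      rw [← mul_div_cancel_right₀ ε hW.ne']
      refine OmegaImmAn.wt_le_of_mul hϖ hr ha (fun j => ?_) i
      have e : Y * (u n - u m) = (Q (k + n) - P) - (Q (k + m) - P) := by
        rw [mul_sub, hu, hu]; ring
      rw [e]
      exact (OmegaImmAn.wt_sub_le_max _ _ _ _).trans
        (max_le (hN _ (by omega) j) (hN _ (by omega) j))
    have hYA : P = Y * A := by
      refine OmegaImmAn.eq_of_wt_sub_le (r := 1) fun ε hε i => ?_
      obtain ⟨C, hC, hYC⟩ := Y.exists_wt_le one_pos
      obtain ⟨N, hN⟩ := hA 1 one_pos (ε / C) (by positivity)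
      obtain ⟨M, hM⟩ := hQ.exists_wt_le one_pos hε
      have e : P - Y * A = Y * (u (max N M) - A) - (Q (k + max N M) - P) := by
        rw [mul_sub, hu]; ring
      rw [e]
      refine (OmegaImmAn.wt_sub_le_max _ _ _ _).trans (max_le ?_ (hM _ (by omega) i))
      have := wt_conv_le_mul hYC (hN _ (le_max_left N M)) i
      rwa [mul_div_cancel₀ _ hC.ne'] at this
    have hA0 : A ≠ 0 := by
      rintro rfl
      rw [mul_zero] at hYA
      exact f.prod_ne_zero hx hYA
    refine ⟨A, hYA, fun h => absurd (hN.symm.trans h) (ENat.natCast_ne_top k).symm,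
      fun r hr hs => OmegaImmAn.dom_zero_of_limit hϖ hA0 hr (fun n => ?_) (hA r hr)⟩
    exact OmegaImmAn.dom_prod hϖ hr _ (fun i => (f.y (k + i) : OmegaImmAn p F)) fun i _ =>
      (f.isPure _ (hlt _)).dom_zero hϖ (hs _ (by omega) (hlt _))
  · obtain ⟨n, hn⟩ := ENat.ne_top_iff_exists.1 hN
    have hkn : k ≤ n := by rw [← hn] at hk; exact_mod_cast hk
    refine ⟨∏ i ∈ Finset.Ico k n, (f.y i : OmegaImmAn p F), ?_, fun h => ?_, fun r hr hs => ?_⟩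
    · rw [IsTail, Finset.prod_range_mul_prod_Ico _ hkn, f.prod_finite n hn.symm, coe_partial_prod]
    · rw [← hn] at h
      have : n = k := by exact_mod_cast h
      simp [this]
    · refine OmegaImmAn.dom_prod hϖ hr _ (fun i => (f.y i : OmegaImmAn p F)) fun i hi => ?_
      rw [Finset.mem_Ico] at hi
      have hiN : (i : ℕ∞) < f.N := by rw [← hn]; exact_mod_cast hi.2
      exact (f.isPure _ hiN).dom_zero hϖ (hs _ hi.1 hiN)

theorem IsTail.unique (hϖ : IsUnif ϖ) {f : SlopeFactorization R x} {k : ℕ}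
    (hk : (k : ℕ∞) ≤ f.N) {A B : OmegaImmAn p F} (hA : f.IsTail k A) (hB : f.IsTail k B) :
    A = B := by
  have := OmegaImmAn.isDomain (p := p) hϖ
  exact mul_left_cancel₀ (f.partial_prod_ne_zero hϖ hk) (hA.symm.trans hB)

theorem IsTail.dom (hϖ : IsUnif ϖ) (hx : x ≠ 0) {f : SlopeFactorization R x} {k : ℕ}
    (hk : (k : ℕ∞) ≤ f.N) {A : OmegaImmAn p F} (hA : f.IsTail k A) {r : ℝ} (hr : 0 < r)
    (hs : ∀ i : ℕ, k ≤ i → (i : ℕ∞) < f.N → f.s i < r) : Dom p r A.coeff 0 := by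
  obtain ⟨B, hB, -, hdom⟩ := f.exists_tail hϖ hx hk
  rw [hA.unique hϖ hk hB]
  exact hdom r hr hs

theorem IsTail.eq_one (hϖ : IsUnif ϖ) (hx : x ≠ 0) {f : SlopeFactorization R x} {k : ℕ}
    {A : OmegaImmAn p F} (hA : f.IsTail k A) (h : f.N = k) : A = 1 := by
  obtain ⟨B, hB, hone, -⟩ := f.exists_tail hϖ hx h.ge
  rw [hA.unique hϖ h.ge hB]
  exact hone h

theorem IsTail.exists_succ (hϖ : IsUnif ϖ) (hx : x ≠ 0) {f : SlopeFactorization R x} {k : ℕ}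
    (hk : (k : ℕ∞) < f.N) {A : OmegaImmAn p F} (hA : f.IsTail k A) :
    ∃ B, f.IsTail (k + 1) B ∧ A = f.y k * B := by
  obtain ⟨B, hB, -, -⟩ := f.exists_tail hϖ hx (k := k + 1) (by
    exact_mod_cast Order.add_one_le_of_lt hk)
  refine ⟨B, hB, hA.unique hϖ hk.le ?_⟩
  rw [IsTail, ← mul_assoc, ← Finset.prod_range_succ]
  exact hB

theorem slope_le (f : SlopeFactorization R x) {k i : ℕ} (hki : k ≤ i) (hi : (i : ℕ∞) < f.N) :
    f.s i ≤ f.s k := by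
  rcases hki.eq_or_lt with rfl | h
  exacts [le_rfl, (f.strictAnti k i h hi).le]

theorem slope_pos (f : SlopeFactorization R x) {k : ℕ} (hk : (k : ℕ∞) < f.N) : 0 < f.s k :=
  (f.isPure k hk).2.1.1

/-- Above all slopes the unit and the product of the pure factors are dominated by their constant
terms, leaving only `t^j`. -/
theorem exists_isTop (hϖ : IsUnif ϖ) (hx : x ≠ 0) (f : SlopeFactorization R x) :
    ∃ r₀ : ℝ, ∀ r, r₀ ≤ r → 0 < r → IsTop p r (x : OmegaImmAn p F).coeff f.j := by
  refine ⟨f.s 0 + 1, fun r hr hr0 => ?_⟩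
  have h1 : f.IsTail 0 f.prod := by simp [IsTail]
  have h2 := h1.dom hϖ hx (by simp) hr0 fun i _ hi =>
    (f.slope_le (Nat.zero_le i) hi).trans_lt (by linarith)
  have h3 : Dom p r (f.c : R).1.coeff 0 :=
    OmegaImmAn.dom_unit hϖ (Units.map R.subtype.toMonoidHom f.c) hr0
  have := OmegaImmAn.isTop_mul hϖ hr0 (OmegaImmAn.isTop_mul hϖ hr0 h3.isTop
    (dom_tPow f.j r).isTop) h2.isTop
  rw [f.coe_eq]
  simpa using this

theorem j_unique (hϖ : IsUnif ϖ) (hx : x ≠ 0) (f g : SlopeFactorization R x) : f.j = g.j := by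
  obtain ⟨a, ha⟩ := f.exists_isTop hϖ hx
  obtain ⟨b, hb⟩ := g.exists_isTop hϖ hx
  have := (ha (max 1 (max a b)) (by simp) (by positivity)).unique
    (hb (max 1 (max a b)) (by simp) (by positivity))
  exact_mod_cast this

theorem associated_prod (hϖ : IsUnif ϖ) (hx : x ≠ 0) (f g : SlopeFactorization R x) :
    Associated (f.prod : OmegaImmAn p F) g.prod := by
  have := OmegaImmAn.isDomain (p := p) hϖ
  let cf := Units.map R.subtype.toMonoidHom f.c
  let cg := Units.map R.subtype.toMonoidHom g.c
  have h1 : (x : OmegaImmAn p F) = (cf : OmegaImmAn p F) * tPow p F f.j * f.prod := f.coe_eq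
  have h2 : (x : OmegaImmAn p F) = (cg : OmegaImmAn p F) * tPow p F f.j * g.prod := by
    rw [f.j_unique hϖ hx g]; exact g.coe_eq
  have ht : tPow p F f.j ≠ 0 := OmegaImmAn.ne_zero_of_coeff (dom_tPow f.j 1).ne_zero
  have h3 : tPow p F f.j * ((cf : OmegaImmAn p F) * f.prod) =
      tPow p F f.j * ((cg : OmegaImmAn p F) * g.prod) := by
    rw [mul_left_comm, ← mul_assoc, ← h1, h2]; ring
  have h4 := mul_left_cancel₀ ht h3
  refine ⟨cf * cg⁻¹, ?_⟩
  rw [Units.val_mul, ← mul_assoc, mul_comm (f.prod : OmegaImmAn p F), h4,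
    mul_comm _ (g.prod : OmegaImmAn p F), Units.mul_inv_cancel_right]

/-- If the second factorization had ended, or had only slopes below `f.s k` left, then `B` would be
dominated by its constant term at `f.s k`. The factor `f.y k` divides `B` up to a unit, so it would
be too, although `f.s k` is its slope. -/
theorem lt_and_slope_le (hϖ : IsUnif ϖ) (hx : x ≠ 0) {f g : SlopeFactorization R x} {k : ℕ}
    (hf : (k : ℕ∞) < f.N) (hg : (k : ℕ∞) ≤ g.N) {A B : OmegaImmAn p F} (hA : f.IsTail k A)
    (hB : g.IsTail k B) (hAB : Associated A B) : (k : ℕ∞) < g.N ∧ f.s k ≤ g.s k := by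
  obtain ⟨v, hv⟩ := hAB
  obtain ⟨A', -, rfl⟩ := hA.exists_succ hϖ hx hf
  have key : ∀ r, 0 < r → Dom p r B.coeff 0 → Dom p r (f.y k : OmegaImmAn p F).coeff 0 := by
    intro r hr hd
    rw [← hv] at hd
    exact (OmegaImmAn.dom_of_dom_mul hϖ hr (OmegaImmAn.dom_of_dom_mul hϖ hr hd).1).1
  have hs := f.slope_pos hf
  have hne : (k : ℕ∞) < g.N := by
    refine lt_of_le_of_ne hg fun h => ?_
    refine (f.isPure k hf).not_dom (key _ hs ?_)
    rw [hB.eq_one hϖ hx h.symm]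
    exact OmegaImmAn.dom_one _
  refine ⟨hne, not_lt.1 fun hlt => (f.isPure k hf).not_dom (key _ hs ?_)⟩
  exact hB.dom hϖ hx hg hs fun i hki hi => (g.slope_le hki hi).trans_lt hlt

theorem dvd_of_tails (hϖ : IsUnif ϖ) (hx : x ≠ 0) {f g : SlopeFactorization R x} {k : ℕ}
    (hf : (k : ℕ∞) < f.N) (hg : (k : ℕ∞) < g.N) (hs : f.s k = g.s k) {A B : OmegaImmAn p F}
    (hB : g.IsTail (k + 1) B)
    (hAB : Associated ((f.y k : OmegaImmAn p F) * A) (g.y k * B)) :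
    (f.y k : OmegaImmAn p F) ∣ g.y k := by
  obtain ⟨v, hv⟩ := hAB
  refine OmegaImmAn.dvd_of_mul_eq_mul hϖ (f.isPure k hf) (A := A * (v : OmegaImmAn p F)) (B := B) ?_
    (by rw [← hv, mul_assoc])
  refine hB.dom hϖ hx (by exact_mod_cast Order.add_one_le_of_lt hg) (f.slope_pos hf)
    fun i hi hiN => ?_
  rw [hs]
  exact g.strictAnti k i hi hiN

/-- Induction on the number of factors removed: `lt_and_slope_le` in both directions equates the
next slopes, `dvd_of_tails` in both directions makes the next factors associated, and cancelling
them leaves associated tails. -/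
theorem associated_aux (hϖ : IsUnif ϖ) (hx : x ≠ 0) (f g : SlopeFactorization R x) (k : ℕ)
    (hk : (k : ℕ∞) ≤ f.N) : (k : ℕ∞) ≤ g.N ∧
      (∀ i < k, Associated (f.y i : OmegaImmAn p F) (g.y i)) ∧
      ∃ A B, f.IsTail k A ∧ g.IsTail k B ∧ Associated A B := by
  have := OmegaImmAn.isDomain (p := p) hϖ
  induction k with
  | zero =>
    refine ⟨by simp, by simp, f.prod, g.prod, by simp [IsTail], by simp [IsTail], ?_⟩
    exact f.associated_prod hϖ hx g
  | succ k ih =>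
    have hf : (k : ℕ∞) < f.N := lt_of_lt_of_le (by exact_mod_cast Nat.lt_succ_self k) hk
    obtain ⟨hg, hi, A, B, hA, hB, hAB⟩ := ih hf.le
    obtain ⟨hg, hle⟩ := lt_and_slope_le hϖ hx hf hg hA hB hAB
    have hs := le_antisymm hle (lt_and_slope_le hϖ hx hg hf.le hB hA hAB.symm).2
    obtain ⟨A', hA', rfl⟩ := hA.exists_succ hϖ hx hf
    obtain ⟨B', hB', rfl⟩ := hB.exists_succ hϖ hx hg
    have hy : Associated (f.y k : OmegaImmAn p F) (g.y k) := associated_of_dvd_dvd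
      (dvd_of_tails hϖ hx hf hg hs hB' hAB) (dvd_of_tails hϖ hx hg hf hs.symm hA' hAB.symm)
    refine ⟨by exact_mod_cast Order.add_one_le_of_lt hg, fun i hik => ?_, A', B', hA', hB',
      hAB.of_mul_left hy (f.y_ne_zero hf)⟩
    rcases (Nat.lt_succ_iff.1 hik).eq_or_lt with rfl | h
    exacts [hy, hi i h]

theorem N_le (hϖ : IsUnif ϖ) (hx : x ≠ 0) (f g : SlopeFactorization R x) : f.N ≤ g.N := by
  refine ENat.forall_natCast_le_iff_le.1 fun k hk => (associated_aux hϖ hx f g k hk).1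

/-- If quotients by series with nonzero constant coefficient stay in `R`, slope factorizations in
`R` are unique up to units of `R`. -/
theorem unique_of_quotient_mem (hϖ : IsUnif ϖ) (hx : x ≠ 0)
    (hR : ∀ y z : R, ∀ u : OmegaImmAn p F, (y : OmegaImmAn p F).coeff 0 ≠ 0 →
      (z : OmegaImmAn p F) = u * y → u ∈ R) (f g : SlopeFactorization R x) :
    f.j = g.j ∧ f.N = g.N ∧ ∀ i : ℕ, (i : ℕ∞) < f.N → Associated (f.y i) (g.y i) := by
  have hN : f.N = g.N := le_antisymm (N_le hϖ hx f g) (N_le hϖ hx g f)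
  refine ⟨f.j_unique hϖ hx g, hN, fun i hi => ?_⟩
  obtain ⟨v, hv⟩ := (associated_aux hϖ hx f g (i + 1)
    (by exact_mod_cast Order.add_one_le_of_lt hi)).2.1 i (Nat.lt_succ_self i)
  have h1 : (v : OmegaImmAn p F) ∈ R :=
    hR (f.y i) (g.y i) v (f.isPure i hi).1 (by rw [← hv, mul_comm])
  -- The inverse of `v` is the quotient with the two factors exchanged, so it lies in `R` for the
  -- same reason.
  have h2 : ((v⁻¹ : (OmegaImmAn p F)ˣ) : OmegaImmAn p F) ∈ R :=
    hR (g.y i) (f.y i) _ (g.isPure i (hN ▸ hi)).1 (by rw [← hv, mul_comm, Units.mul_inv_cancel_right])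
  exact ⟨⟨⟨v, h1⟩, ⟨_, h2⟩, Subtype.ext v.mul_inv, Subtype.ext v.inv_mul⟩, Subtype.ext hv⟩

end SlopeFactorization

/-- A subring of `Ω^imm_an` that contains the constants and all series which can be approximated,
uniformly below each exponent, by its elements, contains the quotients of its elements by series
with nonzero constant coefficient. -/
theorem quotient_mem_of_closed (hϖ : IsUnif ϖ) {R : Subring (OmegaImmAn p F)}
    (hconst : ∀ a : F, OmegaImmAn.const a ∈ R)
    (hclosed : ∀ u : OmegaImmAn p F, (∀ j : ℚ, ∀ δ : ℝ, 0 < δ →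
      ∃ v ∈ R, ∀ i < j, ‖u.coeff i - v.coeff i‖ ≤ δ) → u ∈ R)
    (y z : R) (u : OmegaImmAn p F) (hy : (y : OmegaImmAn p F).coeff 0 ≠ 0)
    (h : (z : OmegaImmAn p F) = u * y) : u ∈ R := by
  obtain ⟨r, hr, hdom⟩ := exists_forall_dom_zero y.1.2 hy
  obtain ⟨l, hl0, hl1, hl⟩ := OmegaImmAn.exists_wt_one_sub_le hϖ hr (hdom r le_rfl)
  set c : OmegaImmAn p F := OmegaImmAn.const ((y : OmegaImmAn p F).coeff 0)⁻¹
  set b : OmegaImmAn p F := 1 - c * y with hb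
  have hc : c ∈ R := hconst _
  have hbR : b ∈ R := sub_mem (one_mem _) (mul_mem hc y.2)
  obtain ⟨C, hC, huC⟩ := u.exists_wt_le hr
  refine hclosed u fun j δ hδ => ?_
  have hP := prime_rpow_pos p (r * j)
  have hlim := (tendsto_pow_atTop_nhds_zero_of_lt_one hl0 hl1).const_mul C
  rw [mul_zero] at hlim
  obtain ⟨N, hN⟩ := (hlim.eventually
    (gt_mem_nhds (show 0 < δ / (p : ℝ) ^ (r * j) by positivity))).exists
  -- Here `c * z = u * (1 - b)`, so the geometric sum misses `u` by exactly `u * b ^ N`, whose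
  -- coefficients below `j` are at most `C l^N p^{rj}`.
  refine ⟨c * z * ∑ n ∈ Finset.range N, b ^ n, mul_mem (mul_mem hc z.2)
    (sum_mem fun n _ => pow_mem hbR n), fun i hi => ?_⟩
  have e : u - c * z * ∑ n ∈ Finset.range N, b ^ n = u * b ^ N := by
    have h1 : c * z = u * (1 - b) := by rw [hb, sub_sub_cancel, h]; ring
    rw [h1, mul_assoc, mul_neg_geom_sum]; ring
  rw [← OmegaImmAn.coeff_sub, e]
  have hi' : (i : ℝ) ≤ j := by exact_mod_cast hi.le
  have hp1 := (one_lt_prime_cast p).le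
  calc _ ≤ C * l ^ N * (p : ℝ) ^ (r * i) :=
        wt_le_iff.1 (wt_conv_le_mul huC (OmegaImmAn.wt_pow_le hl N) i)
    _ ≤ δ / (p : ℝ) ^ (r * j) * (p : ℝ) ^ (r * j) := by gcongr
    _ = δ := div_mul_cancel₀ _ hP.ne'

theorem const_mem_omegaAn (a : F) : OmegaImmAn.const a ∈ OmegaAn p F := fun i hi => by
  change mono 0 a i ≠ 0 at hi
  by_cases h : i = 0
  · exact ⟨0, by simp [h]⟩
  · simp [mono, h] at hi

/-- An approximant closer to `u` than `‖u.coeff i‖` at a nonzero coefficient is itself nonzero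
there. -/
theorem omegaAn_closed (u : OmegaImmAn p F) (h : ∀ j : ℚ, ∀ δ : ℝ, 0 < δ →
      ∃ v ∈ OmegaAn p F, ∀ i < j, ‖u.coeff i - v.coeff i‖ ≤ δ) : u ∈ OmegaAn p F := by
  intro i hi
  obtain ⟨v, hv, hvu⟩ := h (i + 1) _ (half_pos (norm_pos_iff.2 hi))
  refine hv i fun h0 => ?_
  have := hvu i (by linarith)
  rw [h0, sub_zero] at this
  linarith [norm_pos_iff.2 hi]

end uniqueness

/-! ### Reduction of `Γ^imm` to Hahn series over the residue field -/

section residue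

variable {F : Type*} [NormedField F] [IsUltrametricDist F]

/-- The ring of integers of `F`. -/
noncomputable def intRing (F : Type*) [NormedField F] [IsUltrametricDist F] : ValuationSubring F :=
  (NormedField.valuation (K := F)).valuationSubring

theorem mem_intRing {a : F} : a ∈ intRing F ↔ ‖a‖ ≤ 1 := Iff.rfl

/-- The residue field of `F`. -/
abbrev ResField (F : Type*) [NormedField F] [IsUltrametricDist F] : Type _ :=
  IsLocalRing.ResidueField (intRing F)

open Classical in
/-- The reduction map, extended by zero to all of `F`. -/
noncomputable def red (a : F) : ResField F :=
  if h : a ∈ intRing F then IsLocalRing.residue _ ⟨a, h⟩ else 0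

theorem red_of_le {a : F} (h : ‖a‖ ≤ 1) :
    red a = IsLocalRing.residue _ (⟨a, mem_intRing.2 h⟩ : intRing F) :=
  dif_pos (mem_intRing.2 h)

theorem red_zero : red (0 : F) = 0 := by
  rw [red_of_le (by simp)]
  exact map_zero _

theorem red_one : red (1 : F) = 1 := by
  rw [red_of_le (by simp)]
  exact map_one _

theorem red_add {a b : F} (ha : ‖a‖ ≤ 1) (hb : ‖b‖ ≤ 1) : red (a + b) = red a + red b := by
  rw [red_of_le ha, red_of_le hb,
    red_of_le ((IsUltrametricDist.norm_add_le_max a b).trans (max_le ha hb)), ← map_add]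
  rfl

theorem norm_mul_le_one {a b : F} (ha : ‖a‖ ≤ 1) (hb : ‖b‖ ≤ 1) : ‖a * b‖ ≤ 1 := by
  rw [norm_mul]
  exact mul_le_one₀ ha (norm_nonneg _) hb

theorem red_mul {a b : F} (ha : ‖a‖ ≤ 1) (hb : ‖b‖ ≤ 1) : red (a * b) = red a * red b := by
  rw [red_of_le ha, red_of_le hb, red_of_le (norm_mul_le_one ha hb), ← map_mul]
  rfl

theorem red_eq_zero {a : F} (ha : ‖a‖ ≤ 1) : red a = 0 ↔ ‖a‖ < 1 := by
  rw [red_of_le ha, IsLocalRing.residue_eq_zero_iff, IsLocalRing.mem_maximalIdeal, mem_nonunits_iff]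
  have key : IsUnit (⟨a, mem_intRing.2 ha⟩ : intRing F) ↔ ‖a‖ = 1 := by
    constructor
    · rintro ⟨u, hu⟩
      have h1 : a * ((u⁻¹ : (intRing F)ˣ) : intRing F) = 1 := by
        have := congrArg Subtype.val u.mul_inv
        rw [hu] at this
        exact this
      have h2 : ‖(((u⁻¹ : (intRing F)ˣ) : intRing F) : F)‖ ≤ 1 :=
        mem_intRing.1 ((u⁻¹ : (intRing F)ˣ) : intRing F).2
      have h3 := congrArg norm h1
      rw [norm_mul, norm_one] at h3
      refine le_antisymm ha ?_
      nlinarith [norm_nonneg a]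
    · intro h
      have h0 : a ≠ 0 := by rintro rfl; simp at h
      have hi : a⁻¹ ∈ intRing F := mem_intRing.2 (by rw [norm_inv, h, inv_one])
      exact ⟨⟨⟨a, mem_intRing.2 ha⟩, ⟨a⁻¹, hi⟩, Subtype.ext (mul_inv_cancel₀ h0),
        Subtype.ext (inv_mul_cancel₀ h0)⟩, rfl⟩
  rw [key]
  exact ⟨fun h => lt_of_le_of_ne ha h, fun h => h.ne⟩

theorem red_sum {ι : Type*} (s : Finset ι) (f : ι → F) (h : ∀ i, ‖f i‖ ≤ 1) :
    red (∑ i ∈ s, f i) = ∑ i ∈ s, red (f i) := by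
  classical
  induction s using Finset.induction_on with
  | empty => simp [red_zero]
  | insert a s ha ih =>
    rw [Finset.sum_insert ha, Finset.sum_insert ha, red_add (h a), ih]
    exact IsUltrametricDist.norm_sum_le_of_forall_le_of_nonneg zero_le_one fun i _ => h i

/-- Choosing `0` as the lift of `0` lets coefficientwise lifts of Hahn series keep their supports.
-/
theorem exists_red_eq (c : ResField F) : ∃ a : F, ‖a‖ ≤ 1 ∧ red a = c ∧ (c = 0 → a = 0) := by
  by_cases hc : c = 0
  · exact ⟨0, by simp, by rw [red_zero, hc], fun _ => rfl⟩
  · obtain ⟨⟨a, ha⟩, rfl⟩ := IsLocalRing.residue_surjective c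
    exact ⟨a, mem_intRing.1 ha, red_of_le (mem_intRing.1 ha), fun h => absurd h hc⟩

/-- All but finitely many terms have norm below `1/2`; together they contribute an element of norm
at most `1/2`, which reduces to zero. The rest is a finite sum. -/
theorem red_tsum [CompleteSpace F] {ι : Type*} {f : ι → F} (hs : Summable f)
    (h : ∀ i, ‖f i‖ ≤ 1) (S : Finset ι) (hS : ∀ i, red (f i) ≠ 0 → i ∈ S) :
    red (∑' i, f i) = ∑ i ∈ S, red (f i) := by
  classical
  have hfin : {i | ¬ ‖f i‖ < 1 / 2}.Finite := by
    have := hs.tendsto_cofinite_zero.norm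
    rw [norm_zero] at this
    exact Filter.eventually_cofinite.1 (this.eventually (gt_mem_nhds (by norm_num)))
  set T := S ∪ hfin.toFinset with hT
  have h1 : ∑ i ∈ S, red (f i) = ∑ i ∈ T, red (f i) := by
    refine Finset.sum_subset Finset.subset_union_left fun i _ hi => ?_
    by_contra hne
    exact hi (hS i hne)
  have h2 : ‖∑' i : ↑(↑T : Set ι)ᶜ, f i‖ ≤ 1 / 2 := by
    refine IsUltrametricDist.norm_tsum_le_of_forall_le_of_nonneg (by norm_num) fun i => ?_
    have : (i : ι) ∉ T := i.2
    simp only [hT, Finset.mem_union, Set.Finite.mem_toFinset, not_or, Set.mem_ofPred_eq,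
      not_not] at this
    exact this.2.le
  rw [h1, ← hs.sum_add_tsum_compl (s := T), red_add _ (h2.trans (by norm_num)),
    (red_eq_zero (h2.trans (by norm_num))).2 (h2.trans_lt (by norm_num)), add_zero, red_sum _ _ h]
  exact IsUltrametricDist.norm_sum_le_of_forall_le_of_nonneg zero_le_one fun i _ => h i

end residue

/-! ### The ring `Γ^imm`, its reduction map and Hensel's lemma -/

section gammaInt

variable {F : Type*} [NormedField F] [IsUltrametricDist F] [CompleteSpace F] {ϖ : F}

namespace GammaImm

theorem coeff_add (x y : GammaImm F) (i : ℚ) : (x + y).coeff i = x.coeff i + y.coeff i := rfl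

theorem coeff_neg (x : GammaImm F) (i : ℚ) : (-x).coeff i = -x.coeff i := rfl

theorem coeff_sub (x y : GammaImm F) (i : ℚ) : (x - y).coeff i = x.coeff i - y.coeff i := by
  rw [sub_eq_add_neg, coeff_add, coeff_neg, sub_eq_add_neg]

theorem coeff_zero (i : ℚ) : (0 : GammaImm F).coeff i = 0 := rfl

theorem coeff_one (i : ℚ) : (1 : GammaImm F).coeff i = if i = 0 then 1 else 0 := rfl

theorem coeff_mul (x y : GammaImm F) : (x * y).coeff = conv x.coeff y.coeff := rfl

theorem coeff_sum {ι : Type*} (s : Finset ι) (f : ι → GammaImm F) (i : ℚ) :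
    (∑ k ∈ s, f k).coeff i = ∑ k ∈ s, (f k).coeff i := by
  classical
  induction s using Finset.induction_on with
  | empty => rfl
  | insert a s ha ih => rw [Finset.sum_insert ha, Finset.sum_insert ha, coeff_add, ih]

/-- The monomial `a t^j`. -/
def monomial (j : ℚ) (a : F) : GammaImm F := ⟨mono j a, wo_mono j a, bdd_mono j a⟩

theorem coeff_monomial (j : ℚ) (a : F) (i : ℚ) :
    (monomial j a).coeff i = if i = j then a else 0 := rfl

theorem coeff_monomial_mul (j : ℚ) (a : F) (x : GammaImm F) (i : ℚ) :
    (monomial j a * x).coeff i = a * x.coeff (i - j) := by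
  rw [coeff_mul]
  change conv (mono j a) x.coeff i = _
  simp only [conv, mono]
  rw [tsum_eq_single j]
  · simp
  · intro k hk; simp [hk]

theorem monomial_mul_monomial (i j : ℚ) (a b : F) :
    monomial i a * monomial j b = monomial (i + j) (a * b) := by
  refine ext (funext fun n => ?_)
  rw [coeff_monomial_mul, coeff_monomial, coeff_monomial]
  simp only [sub_eq_iff_eq_add, add_comm j i, mul_ite, mul_zero]

theorem monomial_zero_one : monomial 0 (1 : F) = 1 := rfl

theorem monomial_pow (j : ℚ) (a : F) (n : ℕ) : monomial j a ^ n = monomial (n * j) (a ^ n) := by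
  induction n with
  | zero => simp [monomial_zero_one]
  | succ n ih =>
    rw [pow_succ, ih, monomial_mul_monomial, pow_succ]
    congr 1
    push_cast; ring

/-- The part of `x` supported on `T`. -/
noncomputable def restrict (T : Set ℚ) (x : GammaImm F) : GammaImm F :=
  ⟨T.indicator x.coeff, fun r hr => (x.2.1 r hr).mono fun i hi => by
    by_cases h : i ∈ T
    · have h2 : r < ‖T.indicator x.coeff i‖ := hi
      rwa [Set.indicator_of_mem h] at h2
    · have h2 : r < ‖T.indicator x.coeff i‖ := hi
      rw [Set.indicator_of_notMem h, norm_zero] at h2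
      linarith, by
    obtain ⟨C, hC⟩ := x.2.2
    refine ⟨C, fun i => ?_⟩
    exact (norm_indicator_le_norm_self _ _).trans (hC i)⟩

theorem coeff_restrict_of_mem {T : Set ℚ} (x : GammaImm F) {i : ℚ} (hi : i ∈ T) :
    (restrict T x).coeff i = x.coeff i := Set.indicator_of_mem hi _

theorem coeff_restrict_of_notMem {T : Set ℚ} (x : GammaImm F) {i : ℚ} (hi : i ∉ T) :
    (restrict T x).coeff i = 0 := Set.indicator_of_notMem hi _

theorem coeff_mul_supp {x y : GammaImm F} (hx : ∀ i < 0, x.coeff i = 0)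
    (hy : ∀ i < 0, y.coeff i = 0) : ∀ i < 0, (x * y).coeff i = 0 := conv_supp hx hy

theorem coeff_pow_supp {x : GammaImm F} (hx : ∀ i < 0, x.coeff i = 0) (n : ℕ) :
    ∀ i < 0, (x ^ n).coeff i = 0 := by
  induction n with
  | zero =>
    intro i hi
    rw [pow_zero, coeff_one, if_neg hi.ne]
  | succ n ih =>
    rw [pow_succ]
    exact coeff_mul_supp ih hx

theorem exists_limit {u : ℕ → GammaImm F} {ρ : ℝ} (h0 : 0 ≤ ρ) (h1 : ρ < 1)
    (h : ∀ n i, ‖(u (n + 1)).coeff i - (u n).coeff i‖ ≤ ρ ^ n) :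
    ∃ x : GammaImm F, ∀ n i, ‖(u n).coeff i - x.coeff i‖ ≤ ρ ^ n := by
  have hd : ∀ n k i, ‖(u (n + k)).coeff i - (u n).coeff i‖ ≤ ρ ^ n := by
    intro n k i
    induction k with
    | zero => simpa using pow_nonneg h0 n
    | succ k ih =>
      have := IsUltrametricDist.norm_add_le_max ((u (n + k + 1)).coeff i - (u (n + k)).coeff i)
        ((u (n + k)).coeff i - (u n).coeff i)
      rw [sub_add_sub_cancel] at this
      refine this.trans (max_le ((h _ i).trans ?_) ih)
      exact pow_le_pow_of_le_one h0 h1.le (Nat.le_add_right n k)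
  have hlim : ∀ i, ∃ a, Filter.Tendsto (fun n => (u n).coeff i) Filter.atTop (nhds a) := by
    intro i
    refine cauchySeq_tendsto_of_complete (Metric.cauchySeq_iff'.2 fun ε hε => ?_)
    obtain ⟨N, hN⟩ := exists_pow_lt_of_lt_one hε h1
    refine ⟨N, fun n hn => ?_⟩
    obtain ⟨k, rfl⟩ := Nat.exists_eq_add_of_le hn
    rw [dist_eq_norm]
    exact (hd N k i).trans_lt hN
  choose x hx using hlim
  have hb : ∀ n i, ‖(u n).coeff i - x i‖ ≤ ρ ^ n := by
    intro n i
    refine le_of_tendsto ((tendsto_const_nhds.sub (hx i)).norm)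
      (Filter.eventually_atTop.2 ⟨n, fun m hm => ?_⟩)
    obtain ⟨k, rfl⟩ := Nat.exists_eq_add_of_le hm
    rw [norm_sub_rev]
    exact hd n k i
  refine ⟨⟨x, wo_of_approx fun m ε hε => ?_, ?_⟩, hb⟩
  · obtain ⟨N, hN⟩ := exists_pow_lt_of_lt_one hε h1
    exact ⟨(u N).coeff, (u N).2.1, fun i _ => (hb N i).trans hN.le⟩
  · obtain ⟨C, hC⟩ := (u 0).2.2
    refine ⟨max C 1, fun i => ?_⟩
    have := norm_sub_le_max' ((u 0).coeff i) ((u 0).coeff i - x i)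
    rw [sub_sub_cancel] at this
    exact this.trans (max_le_max (hC i) ((hb 0 i).trans (by simp)))

end GammaImm

/-- The ring `Γ^imm` of series with integral coefficients. -/
def GammaInt (F : Type*) [NormedField F] [IsUltrametricDist F] [CompleteSpace F] :
    Subring (GammaImm F) where
  carrier := {x | ∀ i, ‖x.coeff i‖ ≤ 1}
  zero_mem' i := by rw [GammaImm.coeff_zero]; simp
  one_mem' i := by
    rw [GammaImm.coeff_one]
    split_ifs <;> simp
  add_mem' hx hy i := (IsUltrametricDist.norm_add_le_max _ _).trans (max_le (hx i) (hy i))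
  neg_mem' {x} hx i := by
    rw [GammaImm.coeff_neg, norm_neg]
    exact hx i
  mul_mem' {x y} hx hy n := norm_conv_le (F := F) fun i =>
    mul_le_one₀ (hx i) (norm_nonneg _) (hy _)

/-- The Hahn series of reduced coefficients. -/
noncomputable def toHahnFun (x : GammaInt F) : HahnSeries ℚ (ResField F) :=
  ⟨fun i => red (x.1.coeff i), by
    refine (((x.1.2.1 (1 / 2) (by norm_num)).mono fun i hi => ?_).isPWO)
    by_contra h
    refine hi ((red_eq_zero (x.2 i)).2 ?_)
    have : ‖x.1.coeff i‖ ≤ 1 / 2 := not_lt.1 h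
    linarith⟩

theorem coeff_toHahnFun (x : GammaInt F) (i : ℚ) :
    (toHahnFun x).coeff i = red (x.1.coeff i) := rfl

theorem toHahnFun_mul (x y : GammaInt F) : toHahnFun (x * y) = toHahnFun x * toHahnFun y := by
  ext n
  rw [HahnSeries.coeff_mul, coeff_toHahnFun]
  set X := toHahnFun x
  set Y := toHahnFun y
  have hs : Summable fun i => x.1.coeff i * y.1.coeff (n - i) :=
    summable_conv x.1.2.1 x.1.2.2 y.1.2.1 y.1.2.2 n
  have hb : ∀ i, ‖x.1.coeff i * y.1.coeff (n - i)‖ ≤ 1 := fun i =>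
    norm_mul_le_one (x.2 i) (y.2 _)
  have hr : ∀ i, red (x.1.coeff i * y.1.coeff (n - i)) = X.coeff i * Y.coeff (n - i) := fun i =>
    red_mul (x.2 i) (y.2 _)
  change red (∑' i, x.1.coeff i * y.1.coeff (n - i)) = _
  rw [red_tsum hs hb
    ((Finset.antidiagonal X.isPWO_support Y.isPWO_support n).image Prod.fst) ?_,
    Finset.sum_image ?_]
  · refine Finset.sum_congr rfl fun q hq => ?_
    rw [Finset.mem_antidiagonal] at hq
    rw [hr, ← hq.2.2, add_sub_cancel_left]
  · rintro ⟨a, b⟩ hq ⟨c, d⟩ hq' h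
    have h1 := (Finset.mem_antidiagonal.1 hq).2.2
    have h2 := (Finset.mem_antidiagonal.1 hq').2.2
    simp only at h h1 h2
    subst h
    rw [Prod.mk.injEq]
    exact ⟨rfl, by linarith⟩
  · intro i hi
    rw [hr] at hi
    refine Finset.mem_image.2 ⟨(i, n - i), Finset.mem_antidiagonal.2 ⟨?_, ?_, ?_⟩, rfl⟩
    · exact left_ne_zero_of_mul hi
    · exact right_ne_zero_of_mul hi
    · simp

/-- Reduction of a series in `Γ^imm` to a Hahn series over the residue field. -/
noncomputable def toHahn (F : Type*) [NormedField F] [IsUltrametricDist F] [CompleteSpace F] :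
    GammaInt F →+* HahnSeries ℚ (ResField F) where
  toFun := toHahnFun
  map_zero' := by
    ext i
    exact red_zero
  map_one' := by
    ext i
    rw [coeff_toHahnFun, HahnSeries.coeff_one]
    change red ((1 : GammaImm F).coeff i) = _
    rw [GammaImm.coeff_one]
    split_ifs
    exacts [red_one, red_zero]
  map_add' x y := by
    ext i
    exact red_add (x.2 i) (y.2 i)
  map_mul' := toHahnFun_mul

theorem coeff_toHahn (x : GammaInt F) (i : ℚ) : (toHahn F x).coeff i = red (x.1.coeff i) := rfl

theorem toHahn_eq_zero {x : GammaInt F} : toHahn F x = 0 ↔ ∀ i, ‖x.1.coeff i‖ < 1 := by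
  rw [HahnSeries.ext_iff, funext_iff]
  exact forall_congr' fun i => red_eq_zero (x.2 i)

theorem exists_toHahn_eq (f : HahnSeries ℚ (ResField F)) :
    ∃ x : GammaInt F, toHahn F x = f ∧ ∀ i, f.coeff i = 0 → x.1.coeff i = 0 := by
  choose s h1 h2 h3 using exists_red_eq (F := F)
  refine ⟨⟨⟨fun i => s (f.coeff i), fun r hr => ?_, ⟨1, fun i => h1 _⟩⟩, fun i => h1 _⟩, ?_,
    fun i hi => h3 _ hi⟩
  · refine f.isWF_support.mono fun i hi h0 => ?_
    have h4 : r < ‖s (f.coeff i)‖ := hi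
    rw [h3 _ h0, norm_zero] at h4
    linarith
  · ext i
    exact h2 _

/-! ### The ideal generated by a uniformizer -/

/-- The uniformizer as an element of `Γ^imm`. -/
noncomputable def GammaInt.unif (hϖ : IsUnif ϖ) : GammaInt F :=
  ⟨GammaImm.monomial 0 ϖ, fun i => by
    rw [GammaImm.coeff_monomial]
    split_ifs
    · exact hϖ.lt_one.le
    · simp⟩

/-- The ideal generated by the uniformizer. -/
noncomputable def GammaInt.maxIdeal (hϖ : IsUnif ϖ) : Ideal (GammaInt F) :=
  Ideal.span {GammaInt.unif hϖ}

theorem GammaInt.mem_maxIdeal_pow (hϖ : IsUnif ϖ) {x : GammaInt F} {n : ℕ} :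
    x ∈ GammaInt.maxIdeal hϖ ^ n ↔ ∀ i, ‖x.1.coeff i‖ ≤ ‖ϖ‖ ^ n := by
  have hcoe : ∀ y : GammaInt F, ((GammaInt.unif hϖ ^ n * y : GammaInt F) : GammaImm F) =
      GammaImm.monomial 0 (ϖ ^ n) * y.1 := fun y => by
    have h1 : ((GammaInt.unif hϖ ^ n : GammaInt F) : GammaImm F) =
        GammaImm.monomial 0 (ϖ ^ n) := by
      rw [SubmonoidClass.coe_pow]
      change GammaImm.monomial 0 ϖ ^ n = _
      rw [GammaImm.monomial_pow, mul_zero]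
    rw [← h1]; rfl
  have hn : ϖ ^ n ≠ 0 := pow_ne_zero _ (norm_pos_iff.1 hϖ.pos)
  rw [GammaInt.maxIdeal, Ideal.span_singleton_pow, Ideal.mem_span_singleton]
  constructor
  · rintro ⟨y, rfl⟩ i
    rw [hcoe, GammaImm.coeff_monomial_mul, norm_mul, norm_pow]
    exact mul_le_of_le_one_right (by positivity) (y.2 _)
  · intro h
    refine ⟨⟨GammaImm.monomial 0 (ϖ ^ n)⁻¹ * x.1, fun i => ?_⟩, Subtype.ext ?_⟩
    · rw [GammaImm.coeff_monomial_mul, norm_mul, norm_inv, norm_pow, sub_zero,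
        inv_mul_le_iff₀ (pow_pos hϖ.pos n), mul_one]
      exact h i
    · rw [hcoe, ← mul_assoc, GammaImm.monomial_mul_monomial, add_zero, mul_inv_cancel₀ hn,
        GammaImm.monomial_zero_one, one_mul]

theorem IsUnif.le_of_lt_one (hϖ : IsUnif ϖ) {a : F} (ha : ‖a‖ < 1) : ‖a‖ ≤ ‖ϖ‖ := by
  by_cases h0 : a = 0
  · simp [h0]
  obtain ⟨n, hn⟩ := hϖ.exists_zpow a h0
  rw [hn] at ha ⊢
  have h1 : 0 < n := by
    by_contra! h
    exact absurd ha (not_lt.2 (one_le_zpow_of_nonpos₀ hϖ.pos hϖ.lt_one.le h))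
  calc ‖ϖ‖ ^ n ≤ ‖ϖ‖ ^ (1 : ℤ) := zpow_le_zpow_right_of_le_one₀ hϖ.pos hϖ.lt_one.le h1
    _ = ‖ϖ‖ := zpow_one _

theorem GammaInt.mem_maxIdeal (hϖ : IsUnif ϖ) {x : GammaInt F} :
    x ∈ GammaInt.maxIdeal hϖ ↔ toHahn F x = 0 := by
  have h := GammaInt.mem_maxIdeal_pow hϖ (x := x) (n := 1)
  rw [pow_one, pow_one] at h
  rw [h, toHahn_eq_zero]
  exact forall_congr' fun i => ⟨fun h => h.trans_lt hϖ.lt_one, hϖ.le_of_lt_one⟩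

theorem GammaInt.isAdicComplete (hϖ : IsUnif ϖ) :
    IsAdicComplete (GammaInt.maxIdeal hϖ) (GammaInt F) where
  haus' x hx := by
    refine Subtype.ext (GammaImm.ext (funext fun i => ?_))
    by_contra hne
    have hne' : x.1.coeff i ≠ 0 := hne
    obtain ⟨n, hn⟩ := exists_pow_lt_of_lt_one (norm_pos_iff.2 hne') hϖ.lt_one
    have h1 := hx n
    rw [SModEq.zero, smul_eq_mul, Ideal.mul_top, GammaInt.mem_maxIdeal_pow] at h1
    exact absurd hn (not_lt.2 (h1 i))
  prec' u hu := by
    have hsub : ∀ x y : GammaInt F, ∀ i, (x - y).1.coeff i = x.1.coeff i - y.1.coeff i :=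
      fun x y i => GammaImm.coeff_sub _ _ i
    have h1 : ∀ n i, ‖(u (n + 1)).1.coeff i - (u n).1.coeff i‖ ≤ ‖ϖ‖ ^ n := by
      intro n i
      have h2 := (hu (Nat.le_succ n)).symm
      rw [SModEq.sub_mem, smul_eq_mul, Ideal.mul_top, GammaInt.mem_maxIdeal_pow] at h2
      exact h2 i
    obtain ⟨x, hx⟩ := GammaImm.exists_limit (u := fun n => (u n).1) (norm_nonneg _) hϖ.lt_one h1
    refine ⟨⟨x, fun i => ?_⟩, fun n => ?_⟩
    · have := norm_sub_le_max' ((u 0).1.coeff i) ((u 0).1.coeff i - x.coeff i)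
      rw [sub_sub_cancel] at this
      exact this.trans (max_le ((u 0).2 i) ((hx 0 i).trans (by simp)))
    · rw [SModEq.sub_mem, smul_eq_mul, Ideal.mul_top, GammaInt.mem_maxIdeal_pow]
      exact fun i => hx n i

/-- Hensel's lemma in `Γ^imm`. -/
theorem GammaInt.exists_isRoot (hϖ : IsUnif ϖ) {P : Polynomial (GammaInt F)} (hP : P.Monic)
    {f : HahnSeries ℚ (ResField F)} (hf : (P.map (toHahn F)).eval f = 0)
    (hf' : (P.map (toHahn F)).derivative.eval f ≠ 0) :
    ∃ b : GammaInt F, P.IsRoot b ∧ toHahn F b = f := by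
  have := GammaInt.isAdicComplete hϖ
  obtain ⟨a, rfl, -⟩ := exists_toHahn_eq f
  rw [Polynomial.eval_map_apply] at hf
  rw [Polynomial.derivative_map, Polynomial.eval_map_apply] at hf'
  -- Hahn series over a field form a field, so a lift of the inverse of the reduced derivative shows
  -- that the derivative is a unit modulo the ideal.
  obtain ⟨c, hc, -⟩ := exists_toHahn_eq (toHahn F (P.derivative.eval a))⁻¹
  obtain ⟨b, hb, hba⟩ := HenselianRing.is_henselian (I := GammaInt.maxIdeal hϖ) P hP a
    ((GammaInt.mem_maxIdeal hϖ).2 hf) (by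
      refine IsUnit.of_mul_eq_one (Ideal.Quotient.mk _ c) ?_
      rw [← map_mul, ← map_one (Ideal.Quotient.mk _), Ideal.Quotient.eq,
        GammaInt.mem_maxIdeal, map_sub, map_mul, hc, mul_inv_cancel₀ hf', map_one, sub_self])
  refine ⟨b, hb, ?_⟩
  rw [GammaInt.mem_maxIdeal, map_sub, sub_eq_zero] at hba
  exact hba

end gammaInt

/-! ### Frobenius on Laurent series and the perfect closure of `k((t))` -/

section frobenius

variable {p : ℕ} [hp : Fact p.Prime] {k : Type*} [Field k] [CharP k p]

theorem charP_hahnSeries (p : ℕ) (k : Type*) [Field k] [CharP k p]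
    (Γ : Type*) [AddCommGroup Γ] [LinearOrder Γ] [IsOrderedAddMonoid Γ] :
    CharP (HahnSeries Γ k) p :=
  charP_of_injective_ringHom (f := (HahnSeries.C : k →+* HahnSeries Γ k))
    HahnSeries.C_injective p

/-- Frobenius is additive, so it suffices to treat the finitely many terms of exponent at most
`|N|`; what remains has order greater than `|N|`, and its `p`-th power has even larger order. -/
theorem coeff_pow_char (x : HahnSeries ℤ k) (N : ℤ) :
    (x ^ p).coeff N = if (p : ℤ) ∣ N then x.coeff (N / p) ^ p else 0 := by
  classical
  have := charP_hahnSeries p k ℤ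
  have hp0 : (0 : ℤ) < p := by exact_mod_cast hp.out.pos
  by_cases hx : x = 0
  · subst hx
    simp [zero_pow hp.out.ne_zero]
  -- The bound is `|N|` rather than `N` because for negative `N` the relevant exponent `N / p`
  -- exceeds `N`, and because the order of the remainder must be positive to grow under the `p`-th
  -- power.
  set S : Set ℤ := {m | x.coeff m ≠ 0 ∧ m ≤ |N|} with hS
  have hfin : S.Finite := (Set.finite_Icc x.order |N|).subset fun m hm =>
    ⟨HahnSeries.order_le_of_coeff_ne_zero hm.1, hm.2⟩
  set A : HahnSeries ℤ k := ∑ m ∈ hfin.toFinset, HahnSeries.single m (x.coeff m) with hA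
  have hAc : ∀ m, A.coeff m = if m ∈ S then x.coeff m else 0 := by
    intro m
    rw [hA, HahnSeries.coeff_sum]
    simp only [HahnSeries.coeff_single]
    have h := Finset.sum_ite_eq hfin.toFinset m x.coeff
    simp only [Set.Finite.mem_toFinset] at h
    convert h
  have hB : ∀ m, m ≤ |N| → (x - A).coeff m = 0 := by
    intro m hm
    rw [HahnSeries.coeff_sub, hAc]
    split_ifs with h
    · exact sub_self _
    · rw [sub_zero]
      by_contra hne
      exact h ⟨hne, hm⟩
  have hBp : ((x - A) ^ p).coeff N = 0 := by
    by_cases h0 : x - A = 0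
    · simp [h0, zero_pow hp.out.ne_zero]
    apply HahnSeries.coeff_eq_zero_of_lt_order
    rw [HahnSeries.order_pow]
    have h1 : |N| < (x - A).order := by
      by_contra! h
      exact h0 (HahnSeries.coeff_order_eq_zero.1 (hB _ h))
    have h2 : (1 : ℤ) ≤ p := hp0
    have h3 : 0 ≤ |N| := abs_nonneg N
    have h4 := le_abs_self N
    rw [nsmul_eq_mul]
    nlinarith
  have hAp : A ^ p = ∑ m ∈ hfin.toFinset, HahnSeries.single (p * m) (x.coeff m ^ p) := by
    rw [hA, sum_pow_char]
    refine Finset.sum_congr rfl fun m _ => ?_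
    rw [HahnSeries.single_pow, nsmul_eq_mul]
  have hxA : x ^ p = A ^ p + (x - A) ^ p := by
    rw [← add_pow_char, add_sub_cancel]
  rw [hxA, HahnSeries.coeff_add, hBp, add_zero, hAp, HahnSeries.coeff_sum]
  split_ifs with hd
  · obtain ⟨m, rfl⟩ := hd
    rw [Int.mul_ediv_cancel_left _ hp0.ne']
    have h1 : ∀ n : ℤ, (p * m = p * n) ↔ m = n := fun n =>
      ⟨fun h => mul_left_cancel₀ hp0.ne' h, fun h => h ▸ rfl⟩
    simp only [HahnSeries.coeff_single, h1]
    rw [Finset.sum_ite_eq]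
    split_ifs with h
    · rfl
    · rw [eq_comm, pow_eq_zero_iff hp.out.ne_zero]
      by_contra hne
      refine h (hfin.mem_toFinset.2 ⟨hne, ?_⟩)
      rw [abs_mul, abs_of_pos hp0]
      have := abs_nonneg m
      have := le_abs_self m
      have : (1 : ℤ) ≤ p := hp0
      nlinarith
  · refine Finset.sum_eq_zero fun m _ => HahnSeries.coeff_single_of_ne ?_
    rintro rfl
    exact hd (Dvd.intro _ rfl)

end frobenius

/-! ### The perfect closure of the Laurent series field inside `k((t^ℚ))` -/

section perfectClosure

variable (p : ℕ) [hp : Fact p.Prime] (k : Type*) [Field k]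

theorem natCast_prime_pow_pos (n : ℕ) : (0 : ℚ) < (p : ℚ) ^ n :=
  pow_pos (by exact_mod_cast hp.out.pos) n

/-- The embedding of Laurent series as series in `t^{1/p^n}`. -/
noncomputable def rootEmb (n : ℕ) : HahnSeries ℤ k →+* HahnSeries ℚ k :=
  HahnSeries.embDomainRingHom
    ((AddMonoidHom.mulRight ((p : ℚ) ^ n)⁻¹).comp (Int.castAddHom ℚ))
    (fun a b h => by
      have h1 := (natCast_prime_pow_pos p n).ne'
      simpa [h1] using h)
    (fun a b => by
      have h1 := inv_pos.2 (natCast_prime_pow_pos p n)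
      simp [mul_le_mul_iff_left₀ h1])

variable {k}

theorem coeff_rootEmb (n : ℕ) (h : HahnSeries ℤ k) (m : ℤ) :
    (rootEmb p k n h).coeff (m * ((p : ℚ) ^ n)⁻¹) = h.coeff m :=
  HahnSeries.embDomain_coeff

theorem coeff_rootEmb_eq_zero {n : ℕ} {h : HahnSeries ℤ k} {i : ℚ}
    (hi : ∀ m : ℤ, i ≠ m * ((p : ℚ) ^ n)⁻¹) : (rootEmb p k n h).coeff i = 0 := by
  refine HahnSeries.embDomain_of_notMem_range ?_
  rintro ⟨m, rfl⟩
  exact hi m rfl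

theorem exists_rootEmb_eq (n : ℕ) {f : HahnSeries ℚ k}
    (hf : ∀ i, f.coeff i ≠ 0 → ∃ m : ℤ, i = m * ((p : ℚ) ^ n)⁻¹) :
    ∃ h, rootEmb p k n h = f := by
  have hpos := inv_pos.2 (natCast_prime_pow_pos p n)
  have hwf : {m : ℤ | f.coeff (m * ((p : ℚ) ^ n)⁻¹) ≠ 0}.IsWF := by
    rw [Set.isWF_iff_no_descending_seq]
    intro g hg hgs
    refine Set.isWF_iff_no_descending_seq.1 f.isWF_support
      (fun j => (g j : ℚ) * ((p : ℚ) ^ n)⁻¹) (fun a b hab => ?_) hgs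
    have : (g b : ℚ) < g a := by exact_mod_cast hg hab
    exact mul_lt_mul_of_pos_right this hpos
  refine ⟨⟨fun m => f.coeff (m * ((p : ℚ) ^ n)⁻¹), hwf.isPWO⟩, ?_⟩
  ext i
  by_cases h : ∃ m : ℤ, i = m * ((p : ℚ) ^ n)⁻¹
  · obtain ⟨m, rfl⟩ := h
    rw [coeff_rootEmb]
  · rw [coeff_rootEmb_eq_zero p (by simpa using h)]
    by_contra hne
    exact h (hf i (Ne.symm hne))

theorem supp_rootEmb {n : ℕ} {h : HahnSeries ℤ k} {i : ℚ} (hi : (rootEmb p k n h).coeff i ≠ 0) :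
    ∃ m : ℤ, i = m * ((p : ℚ) ^ n)⁻¹ := by
  by_contra! hne
  exact hi (coeff_rootEmb_eq_zero p hne)

theorem rootEmb_range_mono :
    Monotone fun n => (rootEmb p k n).fieldRange := by
  refine monotone_nat_of_le_succ fun n => ?_
  rintro _ ⟨h, rfl⟩
  obtain ⟨h', hh⟩ := exists_rootEmb_eq p (n + 1) (f := rootEmb p k n h) fun i hi => by
    obtain ⟨m, rfl⟩ := supp_rootEmb p hi
    refine ⟨m * p, ?_⟩
    have : (p : ℚ) ≠ 0 := by exact_mod_cast hp.out.ne_zero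
    push_cast
    field_simp
    ring
  exact ⟨h', hh⟩

variable (k) in
/-- The perfect closure `⋃ k((t^{1/p^n}))` of the field of Laurent series. -/
noncomputable def perfClosure : Subfield (HahnSeries ℚ k) := ⨆ n, (rootEmb p k n).fieldRange

theorem mem_perfClosure {f : HahnSeries ℚ k} :
    f ∈ perfClosure p k ↔ ∃ n h, rootEmb p k n h = f := by
  rw [perfClosure, Subfield.mem_iSup_of_directed (rootEmb_range_mono p).directed_le]
  rfl

/-- Take `p`-th roots of the coefficients and divide the exponents by `p`. -/
theorem exists_pow_eq_rootEmb [CharP k p] (hk : ∀ c : k, ∃ d, d ^ p = c) (n : ℕ)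
    (h : HahnSeries ℤ k) : ∃ h', rootEmb p k (n + 1) h' ^ p = rootEmb p k n h := by
  choose s hs using hk
  have hs0 : s 0 = 0 := (pow_eq_zero_iff hp.out.ne_zero).1 (hs 0)
  refine ⟨⟨fun m => s (h.coeff m), h.isPWO_support.mono fun m hm h0 => hm ?_⟩, ?_⟩
  · change s (h.coeff m) = 0
    rw [h0, hs0]
  have hp0 : (p : ℚ) ≠ 0 := by exact_mod_cast hp.out.ne_zero
  have hpz : (p : ℤ) ≠ 0 := by exact_mod_cast hp.out.ne_zero
  rw [← map_pow]
  ext i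
  by_cases hi : ∃ N : ℤ, i = N * ((p : ℚ) ^ (n + 1))⁻¹
  · obtain ⟨N, rfl⟩ := hi
    rw [coeff_rootEmb, coeff_pow_char]
    split_ifs with hd
    · obtain ⟨m, rfl⟩ := hd
      have : ((p * m : ℤ) : ℚ) * ((p : ℚ) ^ (n + 1))⁻¹ = m * ((p : ℚ) ^ n)⁻¹ := by
        push_cast
        field_simp
        ring
      rw [this, coeff_rootEmb, Int.mul_ediv_cancel_left _ hpz, hs]
    · rw [coeff_rootEmb_eq_zero]
      intro m hm
      refine hd ⟨m, ?_⟩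
      have h1 : (N : ℚ) = p * m := by
        have h2 := pow_ne_zero n hp0
        field_simp at hm
        refine mul_right_cancel₀ h2 (hm.trans ?_)
        ring
      exact_mod_cast h1
  · rw [coeff_rootEmb_eq_zero p (by simpa using hi), coeff_rootEmb_eq_zero]
    intro m hm
    refine hi ⟨m * p, ?_⟩
    rw [hm]
    push_cast
    field_simp
    ring

theorem charP_subfield [CharP k p] (K : Subfield (HahnSeries ℚ k)) : CharP K p := by
  have := charP_hahnSeries p k ℚ
  exact (RingHom.charP_iff K.subtype K.subtype_injective p).2 this

theorem perfectField_perfClosure [CharP k p] (hk : ∀ c : k, ∃ d, d ^ p = c) :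
    PerfectField (perfClosure p k) := by
  have := charP_subfield p (perfClosure p k)
  have : ExpChar (perfClosure p k) p := ExpChar.prime hp.out
  have : PerfectRing (perfClosure p k) p := PerfectRing.ofSurjective _ p (by
    rintro ⟨f, hf⟩
    obtain ⟨n, h, rfl⟩ := (mem_perfClosure p).1 hf
    obtain ⟨h', hh⟩ := exists_pow_eq_rootEmb p hk n h
    exact ⟨⟨_, (mem_perfClosure p).2 ⟨n + 1, h', rfl⟩⟩, Subtype.ext hh⟩)
  exact PerfectRing.toPerfectField _ p

/-- An algebraic extension of a perfect field is perfect; this is applied to the relative algebraic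
closure of `perfClosure` in the Hahn series. -/
theorem exists_isAlgebraic_pow_eq [CharP k p] (hk : ∀ c : k, ∃ d, d ^ p = c)
    {f : HahnSeries ℚ k} (hf : IsAlgebraic (perfClosure p k) f) :
    ∃ g, IsAlgebraic (perfClosure p k) g ∧ g ^ p = f := by
  have := perfectField_perfClosure p hk
  have := charP_hahnSeries p k ℚ
  let A := algebraicClosure (perfClosure p k) (HahnSeries ℚ k)
  have : PerfectField A := Algebra.IsAlgebraic.perfectField (perfClosure p k)
  have : CharP A p := (RingHom.charP_iff A.val.toRingHom A.val.injective p).2 ‹_›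
  have : ExpChar A p := ExpChar.prime hp.out
  obtain ⟨g, hg⟩ := surjective_frobenius A p (⟨f, mem_algebraicClosure_iff.2 hf⟩ : A)
  exact ⟨g, mem_algebraicClosure_iff.1 g.2, congrArg Subtype.val hg⟩

end perfectClosure

/-! ### Integral elements over `Γ[1/p]` and their reductions -/

section integral

variable {F : Type*} [NormedField F] [IsUltrametricDist F] [CompleteSpace F] {ϖ : F}

theorem monomial_intCast_mem_gamma (m : ℤ) (a : F) : GammaImm.monomial (m : ℚ) a ∈ Gamma F := by
  intro i hi
  rw [GammaImm.coeff_monomial] at hi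
  by_contra! h
  exact hi (if_neg fun h' => h m h'.symm)

theorem isIntegral_of_mem_gamma {x : GammaImm F} (hx : x ∈ Gamma F) : IsIntegral (Gamma F) x :=
  isIntegral_algebraMap (R := Gamma F) (x := ⟨x, hx⟩)

/-- The power with exponent `j.den` has an integral exponent of `t`, so it lies in `Γ[1/p]`. -/
theorem isIntegral_monomial (j : ℚ) (a : F) : IsIntegral (Gamma F) (GammaImm.monomial j a) := by
  refine IsIntegral.of_pow j.den_pos ?_
  rw [GammaImm.monomial_pow, mul_comm, Rat.mul_den_eq_num]
  exact isIntegral_of_mem_gamma (monomial_intCast_mem_gamma _ _)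

/-- Sorting the exponents by their numerators modulo `q` writes `x` as a finite sum of terms
`t^{a/q}` times elements of `Γ[1/p]`. -/
theorem isIntegral_of_supp {q : ℕ} (hq : 0 < q) {x : GammaImm F}
    (hx : ∀ i, x.coeff i ≠ 0 → ∃ m : ℤ, i = m * (q : ℚ)⁻¹) : IsIntegral (Gamma F) x := by
  have hq0 : (q : ℚ) ≠ 0 := by exact_mod_cast hq.ne'
  set T : ℕ → Set ℚ := fun a => {i | ∃ n : ℤ, i = n + a * (q : ℚ)⁻¹} with hT
  have hsum : x = ∑ a ∈ Finset.range q, GammaImm.restrict (T a) x := by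
    refine GammaImm.ext (funext fun i => ?_)
    rw [GammaImm.coeff_sum]
    have hr : ∀ a, (GammaImm.restrict (T a) x).coeff i = 0 ∨ i ∈ T a := fun a => by
      by_cases h : i ∈ T a
      · exact Or.inr h
      · exact Or.inl (GammaImm.coeff_restrict_of_notMem x h)
    by_cases hi : x.coeff i = 0
    · rw [hi, eq_comm]
      refine Finset.sum_eq_zero fun a _ => ?_
      rcases hr a with h | h
      · exact h
      · rw [GammaImm.coeff_restrict_of_mem x h, hi]
    · obtain ⟨m, hm⟩ := hx i hi
      have hqz : (q : ℤ) ≠ 0 := by exact_mod_cast hq.ne'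
      have h0 := Int.emod_nonneg m hqz
      have h1 := Int.emod_lt_of_pos m (by exact_mod_cast hq : (0 : ℤ) < q)
      obtain ⟨b, hb⟩ := Int.eq_ofNat_of_zero_le h0
      have hmb : m = q * (m / q) + b := by rw [← hb]; exact (Int.mul_ediv_add_emod m q).symm
      have hmb' : (m : ℚ) = q * ((m / q : ℤ) : ℚ) + b := by exact_mod_cast hmb
      have hib : i ∈ T b := ⟨m / q, by rw [hm, hmb']; field_simp⟩
      rw [Finset.sum_eq_single b, GammaImm.coeff_restrict_of_mem x hib]
      · intro a ha hab
        rcases hr a with h | ⟨n, hn⟩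
        · exact h
        · exfalso
          rw [hm, ← sub_eq_iff_eq_add] at hn
          field_simp at hn
          have hn' : m - a = q * n := by exact_mod_cast hn
          have ha' := Finset.mem_range.1 ha
          have h2 : m % q = a := by
            rw [← sub_eq_iff_eq_add.1 hn' |>.symm, Int.mul_add_emod_self_left]
            exact Int.emod_eq_of_lt (by positivity) (by exact_mod_cast ha')
          rw [hb] at h2
          exact hab (by exact_mod_cast h2.symm)
      · intro h
        rw [Finset.mem_range] at h
        omega
  rw [hsum]
  refine IsIntegral.sum _ fun a _ => ?_
  have e : GammaImm.restrict (T a) x = GammaImm.monomial (a * (q : ℚ)⁻¹) 1 *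
      (GammaImm.monomial (-(a * (q : ℚ)⁻¹)) 1 * GammaImm.restrict (T a) x) := by
    rw [← mul_assoc, GammaImm.monomial_mul_monomial, add_neg_cancel, one_mul,
      GammaImm.monomial_zero_one, one_mul]
  rw [e]
  refine (isIntegral_monomial _ _).mul (isIntegral_of_mem_gamma fun i hi => ?_)
  rw [GammaImm.coeff_monomial_mul, one_mul, sub_neg_eq_add] at hi
  by_contra! h
  refine hi (GammaImm.coeff_restrict_of_notMem x ?_)
  rintro ⟨n, hn⟩
  exact h n (add_right_cancel hn).symm

theorem exists_isIntegral_toHahn_eq (p : ℕ) [hp : Fact p.Prime] {f : HahnSeries ℚ (ResField F)}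
    (hf : f ∈ perfClosure p (ResField F)) :
    ∃ b : GammaInt F, IsIntegral (Gamma F) b.1 ∧ toHahn F b = f := by
  obtain ⟨n, h, rfl⟩ := (mem_perfClosure p).1 hf
  obtain ⟨b, hb, hb0⟩ := exists_toHahn_eq (rootEmb p (ResField F) n h)
  refine ⟨b, isIntegral_of_supp (pow_pos hp.out.pos n) fun i hi => ?_, hb⟩
  push_cast
  exact supp_rootEmb p fun h0 => hi (hb0 i h0)

/-- The elements of `Γ^imm` that are integral over `Γ[1/p]`. -/
noncomputable def GammaInt.integralSubring (F : Type*) [NormedField F] [IsUltrametricDist F]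
    [CompleteSpace F] : Subring (GammaInt F) :=
  (integralClosure (Gamma F) (GammaImm F)).toSubring.comap (GammaInt F).subtype

/-- Over the perfect field `perfClosure` the minimal polynomial of `f` is separable, so `f` is a
simple root. Lifting the polynomial to a monic one with integral coefficients, Hensel's lemma lifts
`f` to a root, which is integral by transitivity. -/
theorem exists_isIntegral_toHahn_eq_of_isAlgebraic {p : ℕ} [hp : Fact p.Prime] (hϖ : IsUnif ϖ)
    [CharP (ResField F) p] (hk : ∀ c : ResField F, ∃ d, d ^ p = c)
    {f : HahnSeries ℚ (ResField F)} (hf : IsAlgebraic (perfClosure p (ResField F)) f) :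
    ∃ b : GammaInt F, IsIntegral (Gamma F) b.1 ∧ toHahn F b = f := by
  have := perfectField_perfClosure p hk
  set K := perfClosure p (ResField F)
  have hfi : IsIntegral K f := hf.isIntegral
  have hirr := minpoly.irreducible hfi
  have hsep : (minpoly K f).Separable := PerfectField.separable_of_irreducible hirr
  set m := (minpoly K f).map (algebraMap K (HahnSeries ℚ (ResField F))) with hm
  have hmm : m.Monic := (minpoly.monic hfi).map _
  have hroot : m.eval f = 0 := by
    rw [hm, Polynomial.eval_map_algebraMap, minpoly.aeval]
  have hder : m.derivative.eval f ≠ 0 := by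
    rw [hm, Polynomial.derivative_map, Polynomial.eval_map_algebraMap]
    exact hsep.aeval_derivative_ne_zero (minpoly.aeval K f)
  set φ := (toHahn F).comp (GammaInt.integralSubring F).subtype with hφ
  have hlift : m ∈ Polynomial.lifts φ := by
    rw [Polynomial.lifts_iff_coeff_lifts]
    intro n
    rw [hm, Polynomial.coeff_map]
    obtain ⟨b, hb, hbf⟩ := exists_isIntegral_toHahn_eq p ((minpoly K f).coeff n).2
    exact ⟨⟨b, hb⟩, hbf⟩
  obtain ⟨Q, hQ, -, hQm⟩ := Polynomial.lifts_and_natDegree_eq_and_monic hlift hmm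
  have hQ' : (Q.map (GammaInt.integralSubring F).subtype).map (toHahn F) = m := by
    rw [Polynomial.map_map, ← hQ]
  obtain ⟨b, hb, hbf⟩ := GammaInt.exists_isRoot hϖ
    (P := Q.map (GammaInt.integralSubring F).subtype) (hQm.map _)
    (by rw [hQ', hroot]) (by rw [hQ']; exact hder)
  refine ⟨b, ?_, hbf⟩
  let A := integralClosure (Gamma F) (GammaImm F)
  let ψ : GammaInt.integralSubring F →+* A :=
    ((GammaInt F).subtype.comp (GammaInt.integralSubring F).subtype).codRestrict A fun x => x.2
  refine isIntegral_trans (A := A) b.1 ⟨Q.map ψ, hQm.map _, ?_⟩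
  rw [Polynomial.eval₂_map]
  have h1 := congrArg (GammaInt F).subtype hb
  rw [Polynomial.eval_map, Polynomial.hom_eval₂, map_zero] at h1
  exact h1

theorem toHahn_mem_perfClosure (p : ℕ) [hp : Fact p.Prime] {x : GammaInt F}
    (hx : x.1 ∈ Gamma F) : toHahn F x ∈ perfClosure p (ResField F) := by
  refine (mem_perfClosure p).2 ⟨0, exists_rootEmb_eq p 0 fun i hi => ?_⟩
  obtain ⟨n, hn⟩ := hx i fun h0 => hi (by rw [coeff_toHahn, h0, red_zero])
  exact ⟨n, by simp [hn]⟩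

theorem IsUnif.exists_pow_mul_le (hϖ : IsUnif ϖ) (C : ℝ) : ∃ N : ℕ, ‖ϖ‖ ^ N * C ≤ 1 := by
  have h0 : 0 < max C 1 := zero_lt_one.trans_le (le_max_right C 1)
  obtain ⟨N, hN⟩ := exists_pow_lt_of_lt_one (inv_pos.2 h0) hϖ.lt_one
  refine ⟨N, ?_⟩
  calc ‖ϖ‖ ^ N * C ≤ ‖ϖ‖ ^ N * max C 1 :=
        mul_le_mul_of_nonneg_left (le_max_left C 1) (pow_pos hϖ.pos N).le
    _ ≤ (max C 1)⁻¹ * max C 1 := mul_le_mul_of_nonneg_right hN.le h0.le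
    _ = 1 := inv_mul_cancel₀ h0.ne'

/-- Scale the integral relation by the least power of `ϖ` that makes all coefficients integral, and
reduce. By minimality some coefficient survives; if no scaling is needed, the leading coefficient
`1` does. -/
theorem isAlgebraic_toHahn_of_isIntegral (p : ℕ) [hp : Fact p.Prime] (hϖ : IsUnif ϖ)
    {x : GammaInt F} (hx : IsIntegral (Gamma F) x.1) :
    IsAlgebraic (perfClosure p (ResField F)) (toHahn F x) := by
  classical
  obtain ⟨P, hP, hPx⟩ := hx
  have hex : ∃ N : ℕ, ∀ n i, ‖ϖ‖ ^ N * ‖(P.coeff n).1.coeff i‖ ≤ 1 := by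
    have h1 : ∀ n, ∃ N : ℕ, ∀ i, ‖ϖ‖ ^ N * ‖(P.coeff n).1.coeff i‖ ≤ 1 := fun n => by
      obtain ⟨C, hC⟩ := (P.coeff n).1.2.2
      obtain ⟨N, hN⟩ := hϖ.exists_pow_mul_le C
      refine ⟨N, fun i => le_trans ?_ hN⟩
      gcongr
      exact hC i
    choose N hN using h1
    refine ⟨∑ n ∈ P.support, N n, fun n i => ?_⟩
    by_cases hn : n ∈ P.support
    · refine le_trans ?_ (hN n i)
      gcongr ?_ * _
      exact pow_le_pow_of_le_one hϖ.pos.le hϖ.lt_one.le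
        (Finset.single_le_sum (fun _ _ => Nat.zero_le _) hn)
    · rw [Polynomial.notMem_support_iff.1 hn]
      change _ * ‖(0 : GammaImm F).coeff i‖ ≤ 1
      rw [GammaImm.coeff_zero]
      simp
  set N := Nat.find hex with hN
  have hNs := Nat.find_spec hex
  have hc : ∀ n i, (GammaImm.monomial 0 (ϖ ^ N) * (P.coeff n).1).coeff i =
      ϖ ^ N * (P.coeff n).1.coeff i := fun n i => by
    rw [GammaImm.coeff_monomial_mul, sub_zero]
  let d : ℕ → GammaInt F := fun n => ⟨GammaImm.monomial 0 (ϖ ^ N) * (P.coeff n).1, fun i => by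
    rw [hc, norm_mul, norm_pow]
    exact hNs n i⟩
  have hdm : ∀ n, (d n).1 ∈ Gamma F := fun n =>
    mul_mem (by exact_mod_cast monomial_intCast_mem_gamma 0 (ϖ ^ N)) (P.coeff n).2
  have hsum : ∑ n ∈ Finset.range (P.natDegree + 1), d n * x ^ n = 0 := by
    refine Subtype.ext ?_
    rw [AddSubmonoidClass.coe_finsetSum]
    have h1 : ∀ n, ((d n * x ^ n : GammaInt F) : GammaImm F) =
        GammaImm.monomial 0 (ϖ ^ N) * ((P.coeff n).1 * x.1 ^ n) := fun n => mul_assoc _ _ _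
    rw [Finset.sum_congr rfl fun n _ => h1 n, ← Finset.mul_sum]
    rw [Polynomial.eval₂_eq_sum_range] at hPx
    change _ * (∑ n ∈ _, (algebraMap (Gamma F) (GammaImm F)) (P.coeff n) * x.1 ^ n) = _
    rw [hPx, mul_zero]
    rfl
  let e : ℕ → perfClosure p (ResField F) := fun n =>
    ⟨toHahn F (d n), toHahn_mem_perfClosure p (hdm n)⟩
  let Q : Polynomial (perfClosure p (ResField F)) :=
    ∑ n ∈ Finset.range (P.natDegree + 1), Polynomial.monomial n (e n)
  have hQc : ∀ n, n ≤ P.natDegree → Q.coeff n = e n := fun n hn => by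
    simp only [Q, Polynomial.finsetSum_coeff, Polynomial.coeff_monomial]
    rw [Finset.sum_ite_eq', if_pos (Finset.mem_range.2 (Nat.lt_succ_of_le hn))]
  refine ⟨Q, fun hQ0 => ?_, ?_⟩
  · have he : ∀ n, n ≤ P.natDegree → ∀ i, ‖(d n).1.coeff i‖ < 1 := fun n hn => by
      rw [← toHahn_eq_zero]
      have h1 := hQc n hn
      rw [hQ0, Polynomial.coeff_zero] at h1
      exact (congrArg Subtype.val h1).symm
    have hlead := he _ le_rfl 0
    rcases Nat.eq_zero_or_pos N with h0 | h0
    · have h2 : (d P.natDegree).1.coeff 0 = 1 := by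
        change (GammaImm.monomial 0 (ϖ ^ N) * (P.coeff P.natDegree).1).coeff 0 = 1
        rw [hc, h0, hP.coeff_natDegree, pow_zero, one_mul]
        change (1 : GammaImm F).coeff 0 = 1
        rw [GammaImm.coeff_one, if_pos rfl]
      rw [h2, norm_one] at hlead
      exact lt_irrefl _ hlead
    · obtain ⟨M, hM⟩ := Nat.exists_eq_succ_of_ne_zero h0.ne'
      refine Nat.find_min hex (m := M) (by rw [← hN, hM]; exact Nat.lt_succ_self M) fun n i => ?_
      by_cases hn : n ≤ P.natDegree
      · have h2 := hϖ.le_of_lt_one (he n hn i)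
        have h3 : (d n).1.coeff i = ϖ ^ N * (P.coeff n).1.coeff i := hc n i
        rw [h3, hM, norm_mul, norm_pow, pow_succ, mul_right_comm] at h2
        exact le_of_mul_le_mul_right (by rwa [one_mul]) hϖ.pos
      · rw [Polynomial.coeff_eq_zero_of_natDegree_lt (not_le.1 hn)]
        change _ * ‖(0 : GammaImm F).coeff i‖ ≤ 1
        rw [GammaImm.coeff_zero]
        simp
  · have h1 := congrArg (toHahn F) hsum
    rw [map_zero, map_sum] at h1
    simp only [Q, map_sum, Polynomial.aeval_monomial]
    rw [← h1]
    refine Finset.sum_congr rfl fun n _ => ?_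
    rw [map_mul, map_pow]
    rfl

/-- An integral element within distance `1/2` has the same reduction. -/
theorem isAlgebraic_toHahn_of_mem_gammaAlg (p : ℕ) [hp : Fact p.Prime] (hϖ : IsUnif ϖ)
    {x : GammaInt F} (hx : x.1 ∈ GammaAlg F) :
    IsAlgebraic (perfClosure p (ResField F)) (toHahn F x) := by
  obtain ⟨z, hz, hxz⟩ := hx (1 / 2) (by norm_num)
  have hz1 : z ∈ GammaInt F := fun i => by
    have := norm_sub_le_max' (x.1.coeff i) (x.1.coeff i - z.coeff i)
    rw [sub_sub_cancel] at this
    exact this.trans (max_le (x.2 i) ((hxz i).trans (by norm_num)))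
  have e : toHahn F x = toHahn F ⟨z, hz1⟩ := by
    rw [← sub_eq_zero, ← map_sub, toHahn_eq_zero]
    intro i
    have h := hxz i
    rw [← GammaImm.coeff_sub] at h
    exact lt_of_le_of_lt h (by norm_num)
  rw [e]
  exact isAlgebraic_toHahn_of_isIntegral p hϖ hz

end integral

/-! ### Teichmüller lifts and approximation in `Γ^alg` -/

/-- Modulo `p (a - b)` the difference `a^p - b^p` is `(a - b)^p`, and both terms gain at least one
power of `I`. -/
theorem pow_prime_sub_pow_prime_mem {A : Type*} [CommRing A] {I : Ideal A} {p : ℕ}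
    (hp : p.Prime) (hpI : (p : A) ∈ I) {a b : A} {n : ℕ} (h : a - b ∈ I ^ (n + 1)) :
    a ^ p - b ^ p ∈ I ^ (n + 2) := by
  obtain ⟨r, hr⟩ := exists_add_pow_prime_eq hp b (a - b)
  rw [add_sub_cancel] at hr
  have e : a ^ p - b ^ p = (a - b) ^ p + p * (a - b) * (b * r) := by rw [hr]; ring
  rw [e]
  refine add_mem ?_ (Ideal.mul_mem_right _ _ ?_)
  · have h1 := Ideal.pow_mem_pow h p
    rw [← pow_mul] at h1
    refine Ideal.pow_le_pow_right ?_ h1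
    nlinarith [hp.two_le]
  · rw [pow_succ' I (n + 1)]
    exact Ideal.mul_mem_mul hpI h

theorem pow_prime_pow_sub_mem {A : Type*} [CommRing A] {I : Ideal A} {p : ℕ}
    (hp : p.Prime) (hpI : (p : A) ∈ I) {a b : A} (h : a - b ∈ I) (n : ℕ) :
    a ^ p ^ n - b ^ p ^ n ∈ I ^ (n + 1) := by
  induction n with
  | zero => simpa using h
  | succ n ih =>
    rw [pow_succ p n, pow_mul, pow_mul]
    exact pow_prime_sub_pow_prime_mem hp hpI ih

section teichmuller

variable {F : Type*} [NormedField F] [IsUltrametricDist F] [CompleteSpace F] {ϖ : F}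

theorem mem_gammaAlg_of_isIntegral {x : GammaImm F} (hx : IsIntegral (Gamma F) x) :
    x ∈ GammaAlg F := fun ε hε => ⟨x, hx, fun i => by simpa using hε.le⟩

theorem mem_gammaAlg_of_approx {x : GammaImm F}
    (h : ∀ ε : ℝ, 0 < ε → ∃ z ∈ GammaAlg F, ∀ i, ‖x.coeff i - z.coeff i‖ ≤ ε) :
    x ∈ GammaAlg F := by
  intro ε hε
  obtain ⟨z, hz, hxz⟩ := h ε hε
  obtain ⟨w, hw, hzw⟩ := hz ε hε
  refine ⟨w, hw, fun i => ?_⟩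
  have := IsUltrametricDist.norm_add_le_max (x.coeff i - z.coeff i) (z.coeff i - w.coeff i)
  rw [sub_add_sub_cancel] at this
  exact this.trans (max_le (hxz i) (hzw i))

theorem mem_gammaAlg_of_tendsto {u : ℕ → GammaImm F} {x : GammaImm F} {ρ : ℝ} (h1 : ρ < 1)
    (hu : ∀ n, u n ∈ GammaAlg F) (h : ∀ n i, ‖(u n).coeff i - x.coeff i‖ ≤ ρ ^ n) :
    x ∈ GammaAlg F := by
  refine mem_gammaAlg_of_approx fun ε hε => ?_
  obtain ⟨n, hn⟩ := exists_pow_lt_of_lt_one hε h1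
  exact ⟨u n, hu n, fun i => by rw [norm_sub_rev]; exact (h n i).trans hn.le⟩

theorem eq_zero_of_norm_le_pow {a : F} {ρ : ℝ} (h1 : ρ < 1) (h : ∀ n : ℕ, ‖a‖ ≤ ρ ^ n) :
    a = 0 := by
  by_contra hne
  obtain ⟨n, hn⟩ := exists_pow_lt_of_lt_one (norm_pos_iff.2 hne) h1
  exact absurd hn (not_lt.2 (h n))

theorem natCast_mem_maxIdeal {p : ℕ} (hϖ : IsUnif ϖ) (hpF : ‖(p : F)‖ < 1) :
    (p : GammaInt F) ∈ GammaInt.maxIdeal hϖ := by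
  rw [GammaInt.mem_maxIdeal, toHahn_eq_zero]
  intro i
  have h1 : ∀ n : ℕ, ((n : GammaInt F) : GammaImm F) = GammaImm.monomial 0 (n : F) := fun n => by
    induction n with
    | zero =>
      refine GammaImm.ext (funext fun i => ?_)
      rw [GammaImm.coeff_monomial]
      simp only [Nat.cast_zero, ite_self]
      rfl
    | succ n ih =>
      refine GammaImm.ext (funext fun i => ?_)
      have h2 := congrFun (congrArg GammaImm.coeff ih) i
      rw [GammaImm.coeff_monomial] at h2 ⊢
      rw [Nat.cast_succ, Nat.cast_succ]
      change (n : GammaInt F).1.coeff i + (1 : GammaImm F).coeff i = _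
      rw [h2, GammaImm.coeff_one]
      split_ifs <;> simp
  rw [h1, GammaImm.coeff_monomial]
  split_ifs
  · exact hpF
  · simp

/-- The order of `g ^ p` is `p` times that of `g`, so a root has no negative exponents either. -/
theorem exists_isAlgebraic_pow_eq_of_supp {p : ℕ} [hp : Fact p.Prime] {k : Type*} [Field k]
    [CharP k p] (hk : ∀ c : k, ∃ d, d ^ p = c) {f : HahnSeries ℚ k}
    (hf : IsAlgebraic (perfClosure p k) f) (hf0 : ∀ i < 0, f.coeff i = 0) :
    ∃ g, (IsAlgebraic (perfClosure p k) g ∧ ∀ i < 0, g.coeff i = 0) ∧ g ^ p = f := by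
  obtain ⟨g, hg, rfl⟩ := exists_isAlgebraic_pow_eq p hk hf
  refine ⟨g, ⟨hg, fun i hi => ?_⟩, rfl⟩
  by_cases hg0 : g = 0
  · rw [hg0, HahnSeries.coeff_zero]
  refine HahnSeries.coeff_eq_zero_of_lt_order (hi.trans_le ?_)
  by_contra! hneg
  have h1 : (g ^ p).order < 0 := by
    rw [HahnSeries.order_pow, nsmul_eq_mul]
    exact mul_neg_of_pos_of_neg (by exact_mod_cast hp.out.pos) hneg
  exact pow_ne_zero p hg0 (HahnSeries.coeff_order_eq_zero.1 (hf0 _ h1))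

/-- Lifting of algebraic series without negative exponents to `Γ^alg`. -/
theorem exists_gammaAlg_toHahn_eq {p : ℕ} [hp : Fact p.Prime] (hϖ : IsUnif ϖ)
    (hpF : ‖(p : F)‖ < 1) [CharP (ResField F) p] (hk : ∀ c : ResField F, ∃ d, d ^ p = c)
    {f : HahnSeries ℚ (ResField F)} (hf : IsAlgebraic (perfClosure p (ResField F)) f)
    (hf0 : ∀ i < 0, f.coeff i = 0) :
    ∃ x : GammaInt F, x.1 ∈ GammaAlg F ∧ toHahn F x = f ∧ ∀ i < 0, x.1.coeff i = 0 := by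
  let S := {g : HahnSeries ℚ (ResField F) //
    IsAlgebraic (perfClosure p (ResField F)) g ∧ ∀ i < 0, g.coeff i = 0}
  have hstep : ∀ g : S, ∃ g' : S, g'.1 ^ p = g.1 := fun g => by
    obtain ⟨g', h, e⟩ := exists_isAlgebraic_pow_eq_of_supp hk g.2.1 g.2.2
    exact ⟨⟨g', h⟩, e⟩
  choose step hstep using hstep
  let g : ℕ → S := fun n => step^[n] ⟨f, hf, hf0⟩
  have hg : ∀ n, (g (n + 1)).1 ^ p = (g n).1 := fun n => by
    simp only [g, Function.iterate_succ_apply']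
    exact hstep _
  choose b hbi hb using fun n => exists_isIntegral_toHahn_eq_of_isAlgebraic hϖ hk (g n).2.1
  have hpI := natCast_mem_maxIdeal hϖ hpF
  -- A lift of `f` given by Hensel's lemma may have negative exponents. Lifting the `p^n`-th root of
  -- `f` and raising it to the power `p^n` gives a sequence converging to a lift without them.
  let u : ℕ → GammaInt F := fun n => b n ^ p ^ n
  have hu : ∀ n, u (n + 1) - u n ∈ GammaInt.maxIdeal hϖ ^ (n + 1) := fun n => by
    have h1 : b (n + 1) ^ p - b n ∈ GammaInt.maxIdeal hϖ := by
      rw [GammaInt.mem_maxIdeal, map_sub, map_pow, hb, hb, hg, sub_self]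
    have h2 := pow_prime_pow_sub_mem hp.out hpI h1 n
    rwa [← pow_mul, ← pow_succ'] at h2
  have hu' : ∀ n i, ‖(u (n + 1)).1.coeff i - (u n).1.coeff i‖ ≤ ‖ϖ‖ ^ n := fun n i => by
    rw [← GammaImm.coeff_sub]
    exact (GammaInt.mem_maxIdeal_pow hϖ).1 (Ideal.pow_le_pow_right (Nat.le_succ n) (hu n)) i
  obtain ⟨x, hx⟩ := GammaImm.exists_limit (u := fun n => (u n).1) (norm_nonneg _) hϖ.lt_one hu'
  have hx1 : x ∈ GammaInt F := fun i => by
    have := norm_sub_le_max' ((u 0).1.coeff i) ((u 0).1.coeff i - x.coeff i)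
    rw [sub_sub_cancel] at this
    exact this.trans (max_le ((u 0).2 i) ((hx 0 i).trans (by simp)))
  refine ⟨⟨x, hx1⟩, mem_gammaAlg_of_tendsto hϖ.lt_one (fun n => ?_) hx, ?_, fun i hi => ?_⟩
  · refine mem_gammaAlg_of_isIntegral ?_
    change IsIntegral (Gamma F) ((b n).1 ^ p ^ n)
    exact (hbi n).pow _
  · have h1 : toHahn F (u 1) = f := by
      simp only [u, pow_one, map_pow, hb, hg]
      rfl
    rw [← h1, eq_comm, ← sub_eq_zero, ← map_sub, toHahn_eq_zero]
    intro i
    have h2 := hx 1 i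
    rw [← GammaImm.coeff_sub, pow_one] at h2
    exact lt_of_le_of_lt h2 hϖ.lt_one
  · refine eq_zero_of_norm_le_pow hϖ.lt_one fun n => ?_
    -- Dropping the negative exponents of `b n` does not change its reduction. So `b n ^ p ^ n`
    -- agrees modulo `ϖ^{n+1}` with `c ^ p ^ n`, which has no negative exponents; `c` itself need
    -- not be integral over `Γ[1/p]`.
    let c : GammaInt F := ⟨GammaImm.restrict (Set.Ici 0) (b n).1, fun i => by
      by_cases h : i ∈ Set.Ici (0 : ℚ)
      · rw [GammaImm.coeff_restrict_of_mem _ h]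
        exact (b n).2 i
      · rw [GammaImm.coeff_restrict_of_notMem _ h, norm_zero]
        exact zero_le_one⟩
    have hc0 : ∀ i < 0, c.1.coeff i = 0 := fun i hi =>
      GammaImm.coeff_restrict_of_notMem _ (not_le.2 hi)
    have hbc : b n - c ∈ GammaInt.maxIdeal hϖ := by
      rw [GammaInt.mem_maxIdeal, map_sub, sub_eq_zero]
      ext i
      rcases lt_or_ge i 0 with h | h
      · rw [hb, (g n).2.2 i h, coeff_toHahn, hc0 i h, red_zero]
      · rw [coeff_toHahn, coeff_toHahn]
        exact congrArg red (GammaImm.coeff_restrict_of_mem (b n).1 (T := Set.Ici 0) h).symm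
    have h1 := (GammaInt.mem_maxIdeal_pow hϖ).1 (Ideal.pow_le_pow_right (Nat.le_succ n)
      (pow_prime_pow_sub_mem hp.out hpI hbc n)) i
    have h2 : (b n ^ p ^ n - c ^ p ^ n : GammaInt F).1.coeff i = (u n).1.coeff i := by
      have h3 := GammaImm.coeff_pow_supp hc0 (p ^ n) i hi
      change (((b n).1 ^ p ^ n - c.1 ^ p ^ n : GammaImm F)).coeff i = _
      rw [GammaImm.coeff_sub, h3, sub_zero]
      rfl
    rw [h2] at h1
    have := norm_sub_le_max' ((u n).1.coeff i) ((u n).1.coeff i - x.coeff i)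
    rw [sub_sub_cancel] at this
    exact this.trans (max_le h1 (hx n i))

/-- The excess of the norm over `‖ϖ‖ ^ n` is removed one factor `ϖ` at a time. Scaled to be integral
and shifted by `t^{-J}`, the series has a reduction with no negative exponents, since its
coefficients below `J` are already small. This reduction is algebraic and lifts to `Γ^alg` without
negative exponents, so subtracting the lift changes nothing below `J`. -/
theorem exists_gammaAlg_norm_le {p : ℕ} [hp : Fact p.Prime] (hϖ : IsUnif ϖ)
    (hpF : ‖(p : F)‖ < 1) [CharP (ResField F) p] (hk : ∀ c : ResField F, ∃ d, d ^ p = c)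
    {J : ℚ} (hJ : 0 ≤ J) (n : ℕ) {x : GammaImm F} (hx : x ∈ GammaAlg F)
    (hx0 : ∀ i < 0, x.coeff i = 0) (hxJ : ∀ i < J, ‖x.coeff i‖ ≤ ‖ϖ‖ ^ n) :
    ∃ y ∈ GammaAlg F, (∀ i < 0, y.coeff i = 0) ∧ (∀ i < J, y.coeff i = x.coeff i) ∧
      ∀ i, ‖y.coeff i‖ ≤ ‖ϖ‖ ^ n := by
  have hϖ0 : ϖ ≠ 0 := norm_pos_iff.1 hϖ.pos
  obtain ⟨M, hM⟩ : ∃ M : ℕ, ∀ i, ‖ϖ‖ ^ M * ‖x.coeff i‖ ≤ ‖ϖ‖ ^ n := by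
    obtain ⟨C, hC⟩ := x.2.2
    obtain ⟨M, hM⟩ := hϖ.exists_pow_mul_le (C / ‖ϖ‖ ^ n)
    rw [← mul_div_assoc, div_le_one (pow_pos hϖ.pos n)] at hM
    refine ⟨M, fun i => le_trans ?_ hM⟩
    gcongr
    exact hC i
  induction M generalizing x with
  | zero => exact ⟨x, hx, hx0, fun _ _ => rfl, fun i => by simpa using hM i⟩
  | succ M ih =>
    -- This is `ϖ^{M+1-n}`, written as a quotient because the exponent may be negative; the current
    -- bound on `x` says precisely that `a * x` is integral.
    set a : F := ϖ ^ (M + 1) / ϖ ^ n with ha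
    have ha0 : a ≠ 0 := div_ne_zero (pow_ne_zero _ hϖ0) (pow_ne_zero _ hϖ0)
    have hna : ‖a‖ = ‖ϖ‖ ^ (M + 1) / ‖ϖ‖ ^ n := by rw [ha, norm_div, norm_pow, norm_pow]
    have hn0 := pow_pos hϖ.pos n
    let y : GammaInt F := ⟨GammaImm.monomial (-J) a * x, fun i => by
      rw [GammaImm.coeff_monomial_mul, norm_mul, hna, div_mul_eq_mul_div, div_le_one hn0]
      exact hM _⟩
    have hyc : ∀ i, y.1.coeff i = a * x.coeff (i + J) := fun i => by
      have := GammaImm.coeff_monomial_mul (-J) a x i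
      rwa [sub_neg_eq_add] at this
    have hyalg : y.1 ∈ GammaAlg F :=
      mul_mem (mem_gammaAlg_of_isIntegral (isIntegral_monomial _ _)) hx
    obtain ⟨t, ht, hty, ht0⟩ := exists_gammaAlg_toHahn_eq hϖ hpF hk
      (isAlgebraic_toHahn_of_mem_gammaAlg p hϖ hyalg) (fun i hi => by
        rw [coeff_toHahn, red_eq_zero (y.2 i), hyc, norm_mul, hna, div_mul_eq_mul_div,
          div_lt_one hn0]
        calc _ ≤ ‖ϖ‖ ^ (M + 1) * ‖ϖ‖ ^ n := by
              gcongr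
              exact hxJ _ (by linarith)
          _ < 1 * ‖ϖ‖ ^ n := by
              gcongr
              exact pow_lt_one₀ hϖ.pos.le hϖ.lt_one (Nat.succ_ne_zero M)
          _ = _ := one_mul _)
    have hyt : ∀ i, ‖y.1.coeff i - t.1.coeff i‖ ≤ ‖ϖ‖ := fun i => by
      rw [eq_comm, ← sub_eq_zero, ← map_sub, ← GammaInt.mem_maxIdeal hϖ,
        ← pow_one (GammaInt.maxIdeal hϖ), GammaInt.mem_maxIdeal_pow] at hty
      rw [← GammaImm.coeff_sub, ← pow_one ‖ϖ‖]
      exact hty i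
    have hx1c : ∀ i, (x - GammaImm.monomial J a⁻¹ * t.1).coeff i =
        x.coeff i - a⁻¹ * t.1.coeff (i - J) := fun i => by
      rw [GammaImm.coeff_sub, GammaImm.coeff_monomial_mul]
    have hsame : ∀ i < J, (x - GammaImm.monomial J a⁻¹ * t.1).coeff i = x.coeff i := fun i hi => by
      rw [hx1c, ht0 _ (by linarith), mul_zero, sub_zero]
    obtain ⟨z, hz, hz0, hzJ, hzn⟩ := ih (x := x - GammaImm.monomial J a⁻¹ * t.1)
      (sub_mem hx (mul_mem (mem_gammaAlg_of_isIntegral (isIntegral_monomial _ _)) ht))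
      (fun i hi => by rw [hsame i (hi.trans_le hJ), hx0 i hi])
      (fun i hi => by rw [hsame i hi]; exact hxJ i hi)
      (fun i => by
        have h1 : x.coeff i - a⁻¹ * t.1.coeff (i - J) =
            a⁻¹ * (y.1.coeff (i - J) - t.1.coeff (i - J)) := by
          rw [hyc, sub_add_cancel, mul_sub, inv_mul_cancel_left₀ ha0]
        rw [hx1c, h1, norm_mul, norm_inv, hna, inv_div]
        have h2 : ‖ϖ‖ ^ M * (‖ϖ‖ ^ n / ‖ϖ‖ ^ (M + 1) * ‖ϖ‖) = ‖ϖ‖ ^ n := by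
          have := hϖ.pos.ne'
          rw [pow_succ]
          field_simp
        refine le_trans ?_ h2.le
        have := hyt (i - J)
        gcongr)
    exact ⟨z, hz, hz0, fun i hi => by rw [hzJ i hi, hsame i hi], hzn⟩

theorem const_mem_omegaAlgAn {p : ℕ} [hp : Fact p.Prime] (a : F) :
    OmegaImmAn.const a ∈ OmegaAlgAn p F := fun _ =>
  ⟨GammaImm.monomial 0 a, mem_gammaAlg_of_isIntegral (isIntegral_monomial 0 a),
    fun _ hi => if_neg hi.ne, fun _ _ => rfl⟩

/-- Approximations `a n` to `u` in `Γ^alg[1/p]` converge below `J` only. Replacing the differences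
`a (n + 1) - a n` by elements that agree with them below `J` and are small everywhere gives a series
convergent in `Γ^alg[1/p]` whose sum agrees with `u` below `J`. -/
theorem omegaAlgAn_closed {p : ℕ} [hp : Fact p.Prime] (hϖ : IsUnif ϖ)
    (hpF : ‖(p : F)‖ < 1) [CharP (ResField F) p] (hk : ∀ c : ResField F, ∃ d, d ^ p = c)
    (u : OmegaImmAn p F) (hu : ∀ j : ℚ, ∀ δ : ℝ, 0 < δ →
      ∃ v ∈ OmegaAlgAn p F, ∀ i < j, ‖u.coeff i - v.coeff i‖ ≤ δ) : u ∈ OmegaAlgAn p F := by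
  intro j
  -- `exists_gammaAlg_norm_le` needs `0 ≤ J`, so that changes from `J` on create no negative
  -- exponents.
  set J := max j 0 with hJ
  have h1 : ∀ n : ℕ, ∃ a ∈ GammaAlg F, (∀ i < 0, a.coeff i = 0) ∧
      ∀ i < J, ‖u.coeff i - a.coeff i‖ ≤ ‖ϖ‖ ^ n := fun n => by
    obtain ⟨v, hv, huv⟩ := hu J (‖ϖ‖ ^ n) (pow_pos hϖ.pos n)
    obtain ⟨a, ha, ha0, hav⟩ := hv J
    exact ⟨a, ha, ha0, fun i hi => by rw [hav i hi]; exact huv i hi⟩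
  choose a ha ha0 hau using h1
  have h2 : ∀ n, ∃ d ∈ GammaAlg F, (∀ i < 0, d.coeff i = 0) ∧
      (∀ i < J, d.coeff i = (a (n + 1)).coeff i - (a n).coeff i) ∧
      ∀ i, ‖d.coeff i‖ ≤ ‖ϖ‖ ^ n := fun n => by
    have := exists_gammaAlg_norm_le hϖ hpF hk (le_max_right j 0) n
      (sub_mem (ha (n + 1)) (ha n))
      (fun i hi => by rw [GammaImm.coeff_sub, ha0 _ i hi, ha0 _ i hi, sub_zero])
      (fun i hi => by
        have h3 := norm_sub_le_max' (u.coeff i - (a n).coeff i) (u.coeff i - (a (n + 1)).coeff i)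
        rw [sub_sub_sub_cancel_left] at h3
        rw [GammaImm.coeff_sub]
        refine h3.trans (max_le (hau n i hi) ((hau _ i hi).trans ?_))
        exact pow_le_pow_of_le_one hϖ.pos.le hϖ.lt_one.le (Nat.le_succ n))
    simpa only [GammaImm.coeff_sub] using this
  choose d hd hd0 hdJ hdn using h2
  let s : ℕ → GammaImm F := fun n => a 0 + ∑ m ∈ Finset.range n, d m
  have hs : ∀ n i, (s (n + 1)).coeff i = (s n).coeff i + (d n).coeff i := fun n i => by
    simp only [s, Finset.sum_range_succ, ← add_assoc]
    rw [GammaImm.coeff_add]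
  have hs0 : ∀ n, ∀ i < 0, (s n).coeff i = 0 := fun n i hi => by
    induction n with
    | zero => simp only [s, Finset.range_zero, Finset.sum_empty, add_zero, ha0 0 i hi]
    | succ n ih => rw [hs, ih, hd0 n i hi, add_zero]
  have hsJ : ∀ n, ∀ i < J, (s n).coeff i = (a n).coeff i := fun n i hi => by
    induction n with
    | zero => simp only [s, Finset.range_zero, Finset.sum_empty, add_zero]
    | succ n ih => rw [hs, ih, hdJ n i hi, add_sub_cancel]
  obtain ⟨y, hy⟩ := GammaImm.exists_limit (u := s) (norm_nonneg ϖ) hϖ.lt_one fun n i => by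
    rw [hs, add_sub_cancel_left]
    exact hdn n i
  refine ⟨y, mem_gammaAlg_of_tendsto hϖ.lt_one
    (fun n => add_mem (ha 0) (sum_mem fun m _ => hd m)) hy, fun i hi => ?_, fun i hi => ?_⟩
  · refine eq_zero_of_norm_le_pow hϖ.lt_one fun n => ?_
    have := hy n i
    rwa [hs0 n i hi, zero_sub, norm_neg] at this
  · have hiJ : i < J := hi.trans_le (le_max_left _ _)
    refine sub_eq_zero.1 (eq_zero_of_norm_le_pow hϖ.lt_one fun n => ?_)
    have h3 := hy n i
    rw [hsJ n i hiJ] at h3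
    have h4 := norm_sub_le_max' (u.coeff i - (a n).coeff i) (y.coeff i - (a n).coeff i)
    rw [sub_sub_sub_cancel_right, norm_sub_rev] at h4
    rw [norm_sub_rev] at h3
    exact h4.trans (max_le (hau n i hiJ) h3)

end teichmuller

/-! ### The field of fractions of a finite extension of the Witt vectors -/

section witt

variable {O : Type*} [CommRing O] [IsDomain O] [IsDiscreteValuationRing O]
  {F : Type*} [NormedField F] [Algebra O F]

theorem norm_algebraMap_unit (hO : ∀ a : O, ‖algebraMap O F a‖ ≤ 1) (u : Oˣ) :
    ‖algebraMap O F u‖ = 1 := by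
  refine le_antisymm (hO _) ?_
  have h1 : ‖algebraMap O F u‖ * ‖algebraMap O F (u⁻¹ : Oˣ)‖ = 1 := by
    rw [← norm_mul, ← map_mul, Units.mul_inv, map_one, norm_one]
  nlinarith [hO (u⁻¹ : Oˣ), norm_nonneg (algebraMap O F u)]

theorem exists_norm_algebraMap_eq_pow (hO : ∀ a : O, ‖algebraMap O F a‖ ≤ 1) {ϖ a : O}
    (hϖ : Irreducible ϖ) (ha : a ≠ 0) :
    ∃ n : ℕ, Associated a (ϖ ^ n) ∧ ‖algebraMap O F a‖ = ‖algebraMap O F ϖ‖ ^ n := by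
  obtain ⟨n, hn⟩ := IsDiscreteValuationRing.associated_pow_irreducible ha hϖ
  refine ⟨n, hn, ?_⟩
  obtain ⟨u, hu⟩ := hn
  rw [← norm_pow, ← map_pow, ← hu, map_mul, norm_mul, norm_algebraMap_unit hO, mul_one]

/-- That `‖ϖ‖ < 1` comes from `‖p‖ < 1`, as `p` is a unit times a power of `ϖ`. -/
theorem isUnif_algebraMap [IsFractionRing O F] {p : ℕ} [hp : Fact p.Prime]
    (hO : ∀ a : O, ‖algebraMap O F a‖ ≤ 1) (hpF : ‖(p : F)‖ = (p : ℝ)⁻¹) {ϖ : O}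
    (hϖ : Irreducible ϖ) : IsUnif (algebraMap O F ϖ) := by
  have hinj := IsFractionRing.injective O F
  have hp1 : (p : ℝ)⁻¹ < 1 := inv_lt_one_of_one_lt₀ (one_lt_prime_cast p)
  have hp0 : (p : O) ≠ 0 := fun h0 => by
    have h1 := congrArg (algebraMap O F) h0
    rw [map_natCast, map_zero] at h1
    rw [h1, norm_zero, eq_comm, inv_eq_zero] at hpF
    exact (prime_cast_pos p).ne' hpF
  refine ⟨norm_pos_iff.2 fun h0 => hϖ.ne_zero (hinj (by rw [h0, map_zero])), ?_, fun a ha => ?_⟩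
  · refine lt_of_le_of_ne (hO ϖ) fun h1 => ?_
    obtain ⟨n, -, hn⟩ := exists_norm_algebraMap_eq_pow hO hϖ hp0
    rw [h1, one_pow, map_natCast, hpF] at hn
    exact hp1.ne hn
  · obtain ⟨x, y, hy, rfl⟩ := IsFractionRing.div_surjective (A := O) a
    have hx : x ≠ 0 := by
      rintro rfl
      simp at ha
    obtain ⟨m, -, hm⟩ := exists_norm_algebraMap_eq_pow hO hϖ hx
    obtain ⟨n, -, hn⟩ := exists_norm_algebraMap_eq_pow hO hϖ (nonZeroDivisors.ne_zero hy)
    have h0 : ‖algebraMap O F ϖ‖ ≠ 0 :=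
      norm_ne_zero_iff.2 fun h0 => hϖ.ne_zero (hinj (by rw [h0, map_zero]))
    exact ⟨m - n, by rw [norm_div, hm, hn, zpow_sub₀ h0, zpow_natCast, zpow_natCast]⟩

/-- The unit ball of `F` is the image of `O`: for a fraction `x / y`, the norm compares the powers
of the uniformizer in `x` and `y`. -/
theorem exists_algebraMap_eq_of_norm_le_one [IsFractionRing O F] {p : ℕ} [hp : Fact p.Prime]
    (hO : ∀ a : O, ‖algebraMap O F a‖ ≤ 1) (hpF : ‖(p : F)‖ = (p : ℝ)⁻¹) {a : F}
    (ha : ‖a‖ ≤ 1) : ∃ b : O, algebraMap O F b = a := by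
  obtain ⟨ϖ, hϖ⟩ := IsDiscreteValuationRing.exists_irreducible O
  have hu := isUnif_algebraMap hO hpF hϖ
  obtain ⟨x, y, hy, rfl⟩ := IsFractionRing.div_surjective (A := O) a
  by_cases hx : x = 0
  · exact ⟨0, by simp [hx]⟩
  obtain ⟨m, hxm, hm⟩ := exists_norm_algebraMap_eq_pow hO hϖ hx
  obtain ⟨n, hyn, hn⟩ := exists_norm_algebraMap_eq_pow hO hϖ (nonZeroDivisors.ne_zero hy)
  rw [norm_div, hm, hn, div_le_one (pow_pos hu.pos n)] at ha
  have hnm : n ≤ m := (pow_le_pow_iff_right_of_lt_one₀ hu.pos hu.lt_one).1 ha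
  obtain ⟨b, rfl⟩ : y ∣ x := hyn.dvd.trans ((pow_dvd_pow ϖ hnm).trans hxm.symm.dvd)
  refine ⟨b, ?_⟩
  have hy0 : algebraMap O F y ≠ 0 := fun h0 =>
    nonZeroDivisors.ne_zero hy (IsFractionRing.injective O F (by rw [h0, map_zero]))
  rw [map_mul, mul_div_cancel_left₀ _ hy0]

theorem charP_resField [IsUltrametricDist F] {p : ℕ} [hp : Fact p.Prime] (hpF : ‖(p : F)‖ < 1) :
    CharP (ResField F) p := by
  rw [CharP.charP_iff_prime_eq_zero hp.out]
  have h1 := (red_eq_zero hpF.le).2 hpF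
  rw [red_of_le hpF.le] at h1
  rw [← h1, ← map_natCast (IsLocalRing.residue (intRing F))]
  rfl

/-- The map from `W(k)` to the residue field kills `p`, so it factors through `k`. Each residue
class comes from `O`, hence is integral over `k`, and so lies in the image of the algebraically
closed field `k`, where `p`-th roots exist. -/
theorem exists_pow_eq_resField [IsUltrametricDist F] [IsFractionRing O F] {p : ℕ}
    [hp : Fact p.Prime] {k : Type*} [Field k] [CharP k p] [IsAlgClosed k]
    [Algebra (WittVector p k) O] [Module.Finite (WittVector p k) O]
    (hO : ∀ a : O, ‖algebraMap O F a‖ ≤ 1) (hpF : ‖(p : F)‖ = (p : ℝ)⁻¹) (c : ResField F) :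
    ∃ d, d ^ p = c := by
  have hp1 : ‖(p : F)‖ < 1 := by
    rw [hpF]
    exact inv_lt_one_of_one_lt₀ (one_lt_prime_cast p)
  have := charP_resField hp1
  obtain ⟨a, ha, rfl, -⟩ := exists_red_eq c
  obtain ⟨b, rfl⟩ := exists_algebraMap_eq_of_norm_le_one hO hpF ha
  let θ : O →+* ResField F := (IsLocalRing.residue (intRing F)).comp
    ((algebraMap O F).codRestrict (intRing F) fun x => mem_intRing.2 (hO x))
  have hθ : θ b = red (algebraMap O F b) := (red_of_le ha).symm
  let η : WittVector p k →+* ResField F := θ.comp (algebraMap (WittVector p k) O)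
  have hker : RingHom.ker (WittVector.constantCoeff : WittVector p k →+* k) ≤ RingHom.ker η := by
    rw [WittVector.ker_constantCoeff, Ideal.span_le, Set.singleton_subset_iff]
    change η p = 0
    rw [map_natCast, CharP.cast_eq_zero]
  have hsurj := WittVector.constantCoeff_surjective p (R := k)
  let ηk : k →+* ResField F := RingHom.liftOfSurjective _ hsurj ⟨η, hker⟩
  have hηk : ηk.comp WittVector.constantCoeff = η := RingHom.liftOfRightInverse_comp _ _ _ _
  let : Algebra k (ResField F) := ηk.toAlgebra
  have hint : IsIntegral k (θ b) := by
    obtain ⟨P, hP, hPb⟩ := Algebra.IsIntegral.isIntegral (R := WittVector p k) b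
    refine ⟨P.map WittVector.constantCoeff, hP.map _, ?_⟩
    rw [Polynomial.eval₂_map]
    change Polynomial.eval₂ (ηk.comp WittVector.constantCoeff) (θ b) P = 0
    rw [hηk, ← Polynomial.hom_eval₂, hPb, map_zero]
  obtain ⟨r, hr⟩ := minpoly.mem_range_of_degree_eq_one k (θ b)
    (IsAlgClosed.degree_eq_one_of_irreducible k (minpoly.irreducible hint))
  obtain ⟨s, rfl⟩ := IsAlgClosed.exists_pow_nat_eq r hp.out.pos
  exact ⟨algebraMap k _ s, by rw [← map_pow, ← hθ]; exact hr⟩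

end witt

end AnRing

theorem mainTheorem5 (p : ℕ) [Fact p.Prime]
    (k : Type*) [Field k] [CharP k p] [IsAlgClosed k]
    -- `O` is a finite extension of the Witt ring `W(k)`
    (O : Type*) [CommRing O] [IsDomain O] [IsDiscreteValuationRing O]
    [Algebra (WittVector p k) O] [FaithfulSMul (WittVector p k) O]
    [Module.Finite (WittVector p k) O]
    -- `F = O[1/p]` is its fraction field, with the absolute value normalized by `|p| = p⁻¹`
    (F : Type*) [NormedField F] [IsUltrametricDist F] [CompleteSpace F]
    [Algebra O F] [IsFractionRing O F]
    (hO : ∀ a : O, ‖algebraMap O F a‖ ≤ 1) (hp : ‖(p : F)‖ = (p : ℝ)⁻¹)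
    -- `R` is one of the three rings
    (R : Subring (AnRing.OmegaImmAn p F))
    (hR : R = AnRing.OmegaAn p F ∨ R = AnRing.OmegaAlgAn p F ∨ R = ⊤)
    (x : R) (hx : x ≠ 0) (f g : AnRing.SlopeFactorization R x) :
    f.j = g.j ∧ f.N = g.N ∧ ∀ i : ℕ, (i : ℕ∞) < f.N → Associated (f.y i) (g.y i) := by
  obtain ⟨ϖ, hirr⟩ := IsDiscreteValuationRing.exists_irreducible O
  have hϖ := AnRing.isUnif_algebraMap hO hp hirr
  have hp1 : ‖(p : F)‖ < 1 := by
    rw [hp]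
    exact inv_lt_one_of_one_lt₀ (AnRing.one_lt_prime_cast p)
  have := AnRing.charP_resField hp1
  refine AnRing.SlopeFactorization.unique_of_quotient_mem hϖ hx (fun y z u hy h => ?_) f g
  rcases hR with rfl | rfl | rfl
  · exact AnRing.quotient_mem_of_closed hϖ AnRing.const_mem_omegaAn AnRing.omegaAn_closed
      y z u hy h
  · exact AnRing.quotient_mem_of_closed hϖ AnRing.const_mem_omegaAlgAn
      (AnRing.omegaAlgAn_closed hϖ hp1 (AnRing.exists_pow_eq_resField (k := k) hO hp))
      y z u hy h
  · exact Subring.mem_top u
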